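/- Let ${\rm Vir}$ be the Virasoro algebra over $\mathbb{C}$, with basis $z$, $e_j$ $(j\in\mathbb{Z})$, $z$ central and $[e_j,e_k]=(k-j)e_{j+k}+\delta_{k,-j}\frac{j^3-j}{12}z$. Let $\theta:{\rm Vir}\to\mathbb{C}[t^{\pm1}]$ be the linear map with $\theta(e_j)=t^j$, $\theta(z)=0$. For $f=\sum_{i} a_it^i\in\mathbb{C}[t]$ let ${\rm Vir}^f=\theta^{-1}(\langle f\rangle)$, where $\langle f\rangle$ is the ideal of $\mathbb{C}[t^{\pm1}]$ generated by $f$; this is a Lie subalgebra of ${\rm Vir}$, and we write $x^f_j=\sum_i a_ie_{j+i}\in{\rm Vir}^f$ $(j\in\mathbb Z)$. For a Lie algebra homomorphism $\mu:{\rm Vir}^f\to\mathbb{C}$ let $\mathbb{C}_\mu$ be the corresponding one-dimensional ${\rm Vir}^f$-module and $V^f_\mu=U({\rm Vir})\otimes_{U({\rm Vir}^f)}\mathbb{C}_\mu$. For $\lambda\in\mathbb{C}^\times$ and $n\ge1$, a homomorphism $\mu:{\rm Vir}^{(t-\lambda)^n}\to\mathbb{C}$ is associated to the polynomial $p\in\mathbb{C}[t]$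 if $\mu\bigl(x_j^{(t-\lambda)^n}\bigr)=p(j)\lambda^j$ for all $j\in\mathbb{Z}$. The degree of the zero polynomial is $-\infty$. (1) Let $k\ge0$, let $\lambda_1,\dots,\lambda_k\in\mathbb{C}^\times$ be distinct, let $n_1,\dots,n_k\ge1$, and for each $i$ let $\mu_i:{\rm Vir}^{(t-\lambda_i)^{n_i}}\to\mathbb{C}$ be a Lie algebra homomorphism. Put $f=\prod_{i=1}^k(t-\lambda_i)^{n_i}$ and $\mu=\sum_{i=1}^k\mu_i|_{{\rm Vir}^f}:{\rm Vir}^f\to\mathbb{C}$. Then $$\bigotimes_{i=1}^kV^{(t-\lambda_i)^{n_i}}_{\mu_i}\cong V^f_\mu$$ as ${\rm Vir}$-modules. If moreover each $\mu_i$ is associated to the polynomial $p_i$, then $V^f_\mu$ is simple if and only if $\deg p_i\ge n_i-2$ for all $i$. (2) Let $f\in\mathbb{C}[t]$ have nonzero constant term and let $\mu:{\rm Vir}^f\to\mathbb{C}$ be any Lie algebra homomorphism. Then there are $k$, distinct $\lambda_i\in\mathbb{C}^\times$, $n_i\ge1$, and homomorphisms $\mu_i:{\rm Vir}^{(t-\lambda_i)^{n_i}}\to\mathbb{C}$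 associated to polynomials $p_i$ $(1\le i\le k)$ such that $f=c\prod_{i}(t-\lambda_i)^{n_i}$ for some $c\in\mathbb{C}^\times$, $\mu=\sum_i\mu_i|_{{\rm Vir}^f}$, and $V^f_\mu\cong\bigotimes_iV^{(t-\lambda_i)^{n_i}}_{\mu_i}$. Moreover $V^f_\mu$ is simple if and only if $\mu$ has large degree, i.e. $\deg p_i\ge n_i-2$ for all $i$ in such a decomposition of $f$ and $\mu$. -/

import Mathlib

open Polynomial
open scoped LaurentPolynomial TensorProduct

attribute [local instance 100] LieRing.ofAssociativeRing

noncomputable section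

/-! ### Tensor products of finite families of Lie modules -/

namespace PiTensorLie

set_option linter.unusedSectionVars false

variable {ι R L : Type*} [Fintype ι] [DecidableEq ι] [CommRing R] [LieRing L] [LieAlgebra R L]
variable (M : ι → Type*) [∀ i, AddCommGroup (M i)] [∀ i, Module R (M i)]
  [∀ i, LieRingModule L (M i)] [∀ i, LieModule R L (M i)]

/-- The action of `x` on the `i`-th tensor factor (and the identity on all others). -/
def actAt (i : ι) (x : L) : Module.End R (⨂[R] i, M i) :=
  PiTensorProduct.map (Function.update (fun j => (1 : Module.End R (M j))) i
    (LieModule.toEnd R L (M i) x))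

/-- The action of `x` on `⨂ i, M i`, i.e. `m₁ ⊗ ⋯ ⊗ mₖ ↦ ∑ i, m₁ ⊗ ⋯ ⊗ x mᵢ ⊗ ⋯ ⊗ mₖ`. -/
def act (x : L) : Module.End R (⨂[R] i, M i) := ∑ i, actAt M i x

theorem actAt_add (i : ι) (x y : L) :
    actAt (R := R) M i (x + y) = actAt M i x + actAt M i y := by
  simp only [actAt, map_add]
  exact PiTensorProduct.map_update_add _ _ _ _

theorem actAt_smul (i : ι) (c : R) (x : L) :
    actAt (R := R) M i (c • x) = c • actAt M i x := by
  simp only [actAt, map_smul]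
  exact PiTensorProduct.map_update_smul _ _ _ _

theorem actAt_tprod (i : ι) (x : L) (m : ∀ i, M i) :
    actAt (R := R) M i x (PiTensorProduct.tprod R m) =
      PiTensorProduct.tprod R (Function.update m i ⁅x, m i⁆) := by
  rw [actAt, PiTensorProduct.map_tprod]
  congr 1
  funext j
  by_cases h : j = i
  · subst h; simp
  · simp [h]

theorem actAt_lie (i : ι) (x y : L) :
    actAt (R := R) M i ⁅x, y⁆ = actAt M i x * actAt M i y - actAt M i y * actAt M i x := by
  refine PiTensorProduct.ext (MultilinearMap.ext fun m => ?_)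
  simp only [LinearMap.compMultilinearMap_apply, LinearMap.sub_apply, Module.End.mul_apply,
    actAt_tprod, Function.update_self, Function.update_idem]
  rw [lie_lie, MultilinearMap.map_update_sub]

theorem actAt_comm {i j : ι} (h : i ≠ j) (x y : L) :
    actAt (R := R) M i x * actAt M j y = actAt M j y * actAt M i x := by
  refine PiTensorProduct.ext (MultilinearMap.ext fun m => ?_)
  simp only [LinearMap.compMultilinearMap_apply, Module.End.mul_apply,
    actAt_tprod, Function.update_of_ne h, Function.update_of_ne h.symm]
  rw [Function.update_comm h]

theorem act_lie (x y : L) :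
    act (R := R) M ⁅x, y⁆ = act M x * act M y - act M y * act M x := by
  simp only [act, Finset.sum_mul_sum]
  rw [Finset.sum_comm (s := Finset.univ) (t := Finset.univ)
    (f := fun i j => actAt (R := R) M i y * actAt M j x), ← Finset.sum_sub_distrib]
  refine Finset.sum_congr rfl fun i _ => ?_
  rw [← Finset.sum_sub_distrib, Finset.sum_eq_single i, actAt_lie]
  · intro j _ hj
    rw [actAt_comm M hj.symm, sub_self]
  · simp

instance lieRingModule : LieRingModule L (⨂[R] i, M i) where
  bracket x := act M x
  add_lie x y t := by
    change act M (x + y) t = act M x t + act M y t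
    simp only [act, actAt_add, Finset.sum_add_distrib, LinearMap.add_apply]
  lie_add _ := map_add _
  leibniz_lie x y t := by
    change act M x (act M y t) = act M ⁅x, y⁆ t + act M y (act M x t)
    rw [act_lie]
    simp

instance lieModule : LieModule R L (⨂[R] i, M i) where
  smul_lie c x t := by
    change act M (c • x) t = c • act M x t
    simp only [act, actAt_smul, ← Finset.smul_sum, LinearMap.smul_apply]
  lie_smul c x t := map_smul (act M x) c t

/-- `x (m₁ ⊗ ⋯ ⊗ mₖ) = ∑ i, m₁ ⊗ ⋯ ⊗ x mᵢ ⊗ ⋯ ⊗ mₖ`. -/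
theorem lie_tprod (x : L) (m : ∀ i, M i) :
    ⁅x, PiTensorProduct.tprod R m⁆ =
      ∑ i, PiTensorProduct.tprod R (Function.update m i ⁅x, m i⁆) := by
  change act M x _ = _
  simp [act, actAt_tprod]

end PiTensorLie

/-! ### Modules induced from a one-dimensional module of a subalgebra -/

section Induced

variable {R L : Type*} [CommRing R] [LieRing L] [LieAlgebra R L]

/-- The algebra map `U(𝔞) → U(𝔤)` induced by the inclusion of a Lie subalgebra `𝔞` of `𝔤`. -/
def envelopingIncl (a : LieSubalgebra R L) :
    UniversalEnvelopingAlgebra R a →ₐ[R] UniversalEnvelopingAlgebra R L :=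
  UniversalEnvelopingAlgebra.lift R ((UniversalEnvelopingAlgebra.ι R).comp a.incl)

/-- The relations `(u b) ⊗ c = u ⊗ (b c)` with `u ∈ U(𝔤)`, `b ∈ U(𝔞)`, `c ∈ R_μ`, where `b` acts on
the one-dimensional module `R_μ` by the extension of `μ` to `U(𝔞)`. -/
def balancedRelations (a : LieSubalgebra R L) (μ : a →ₗ⁅R⁆ R) :
    Submodule (UniversalEnvelopingAlgebra R L) (UniversalEnvelopingAlgebra R L ⊗[R] R) :=
  Submodule.span _ {w | ∃ (u : UniversalEnvelopingAlgebra R L)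
    (b : UniversalEnvelopingAlgebra R a) (c : R),
    w = (u * envelopingIncl a b) ⊗ₜ[R] c -
      u ⊗ₜ[R] (UniversalEnvelopingAlgebra.lift R μ b * c)}

/-- The induced `𝔤`-module `U(𝔤) ⊗_{U(𝔞)} R_μ`, where `R_μ = R` with `x · c = μ(x) c`. -/
def InducedModule (a : LieSubalgebra R L) (μ : a →ₗ⁅R⁆ R) : Type _ :=
  (UniversalEnvelopingAlgebra R L ⊗[R] R) ⧸ balancedRelations a μ

namespace InducedModule

variable (a : LieSubalgebra R L) (μ : a →ₗ⁅R⁆ R)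

instance : AddCommGroup (InducedModule a μ) :=
  inferInstanceAs (AddCommGroup (_ ⧸ balancedRelations a μ))

instance : Module (UniversalEnvelopingAlgebra R L) (InducedModule a μ) :=
  inferInstanceAs (Module (UniversalEnvelopingAlgebra R L) (_ ⧸ balancedRelations a μ))

instance : Module R (InducedModule a μ) :=
  inferInstanceAs (Module R (_ ⧸ balancedRelations a μ))

instance : IsScalarTower R (UniversalEnvelopingAlgebra R L) (InducedModule a μ) :=
  inferInstanceAs (IsScalarTower R (UniversalEnvelopingAlgebra R L) (_ ⧸ balancedRelations a μ))

/-- `𝔤` acts through `𝔤 → U(𝔤)`. -/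
instance : LieRingModule L (InducedModule a μ) where
  bracket x v := UniversalEnvelopingAlgebra.ι R x • v
  add_lie x y v := by
    change UniversalEnvelopingAlgebra.ι R (x + y) • v = _ • v + _ • v
    rw [map_add, add_smul]
  lie_add x v w := smul_add (UniversalEnvelopingAlgebra.ι R x) v w
  leibniz_lie x y v := by
    change UniversalEnvelopingAlgebra.ι R x • UniversalEnvelopingAlgebra.ι R y • v =
      UniversalEnvelopingAlgebra.ι R ⁅x, y⁆ • v +
        UniversalEnvelopingAlgebra.ι R y • UniversalEnvelopingAlgebra.ι R x • v
    rw [LieHom.map_lie, LieRing.of_associative_ring_bracket, sub_smul, mul_smul, mul_smul,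
      sub_add_cancel]

instance : LieModule R L (InducedModule a μ) where
  smul_lie c x v := by
    change UniversalEnvelopingAlgebra.ι R (c • x) • v = c • UniversalEnvelopingAlgebra.ι R x • v
    rw [map_smul, smul_assoc]
  lie_smul c x v := by
    change UniversalEnvelopingAlgebra.ι R x • c • v = c • UniversalEnvelopingAlgebra.ι R x • v
    rw [← algebraMap_smul (UniversalEnvelopingAlgebra R L) c v,
      ← algebraMap_smul (UniversalEnvelopingAlgebra R L) c, ← mul_smul, ← mul_smul,
      Algebra.commutes]

end InducedModule

end Induced

/-! ### The Virasoro algebra -/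

/-- The derivative `t ^ n ↦ n t ^ (n - 1)` on `ℂ[t, t⁻¹]`. -/
def laurentDeriv : ℂ[T;T⁻¹] →ₗ[ℂ] ℂ[T;T⁻¹] :=
  Finsupp.lsum ℂ (fun n : ℤ => (LinearMap.toSpanSingleton ℂ ℂ[T;T⁻¹]
    ((n : ℂ) • LaurentPolynomial.T (n - 1)))) ∘ₗ
    (AddMonoidAlgebra.coeffLinearEquiv ℂ).toLinearMap

theorem laurentDeriv_C_mul_T (n : ℤ) (c : ℂ) :
    laurentDeriv (LaurentPolynomial.C c * LaurentPolynomial.T n) =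
      LaurentPolynomial.C (n * c) * LaurentPolynomial.T (n - 1) := by
  rw [← LaurentPolynomial.single_eq_C_mul_T, laurentDeriv, LinearMap.comp_apply]
  change Finsupp.lsum ℂ _ (AddMonoidAlgebra.single n c).coeff = _
  rw [AddMonoidAlgebra.coeff_single, Finsupp.lsum_single, LinearMap.toSpanSingleton_apply,
    smul_smul, LaurentPolynomial.smul_eq_C_mul, mul_comm c]

theorem laurentDeriv_mul (f g : ℂ[T;T⁻¹]) :
    laurentDeriv (f * g) = f * laurentDeriv g + laurentDeriv f * g := by
  induction f using LaurentPolynomial.induction_on' with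
  | add p q hp hq => simp only [add_mul, map_add, hp, hq]; ring
  | C_mul_T m a =>
    induction g using LaurentPolynomial.induction_on' with
    | add p q hp hq => simp only [mul_add, map_add, hp, hq]; ring
    | C_mul_T n b =>
      have h : LaurentPolynomial.C a * LaurentPolynomial.T m *
          (LaurentPolynomial.C b * LaurentPolynomial.T n) =
          LaurentPolynomial.C (a * b) * LaurentPolynomial.T (m + n) := by
        rw [map_mul, LaurentPolynomial.T_add]; ring
      rw [h]
      rw [laurentDeriv_C_mul_T, laurentDeriv_C_mul_T, laurentDeriv_C_mul_T]
      simp only [map_mul, LaurentPolynomial.T_add, sub_eq_add_neg,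
        Int.cast_add, map_add]
      ring

/-- The bracket `[f, g] = t (f g' - g f')` on `ℂ[t, t⁻¹]`. -/
def wittBracket (f g : ℂ[T;T⁻¹]) : ℂ[T;T⁻¹] :=
  LaurentPolynomial.T 1 * (f * laurentDeriv g - g * laurentDeriv f)

theorem laurentDeriv_T_one_mul (f : ℂ[T;T⁻¹]) :
    laurentDeriv (LaurentPolynomial.T 1 * f) = LaurentPolynomial.T 1 * laurentDeriv f + f := by
  have h := laurentDeriv_C_mul_T 1 1
  simp only [map_one, one_mul, Int.cast_one, sub_self, LaurentPolynomial.T_zero, mul_one] at h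
  rw [laurentDeriv_mul, h, one_mul]

theorem wittBracket_jacobi (f g h : ℂ[T;T⁻¹]) :
    wittBracket f (wittBracket g h) =
      wittBracket (wittBracket f g) h + wittBracket g (wittBracket f h) := by
  simp only [wittBracket]
  rw [laurentDeriv_T_one_mul, laurentDeriv_T_one_mul, laurentDeriv_T_one_mul]
  simp only [map_sub, laurentDeriv_mul]
  ring

theorem wittBracket_single (m n : ℤ) (a b : ℂ) :
    wittBracket (LaurentPolynomial.C a * LaurentPolynomial.T m)
      (LaurentPolynomial.C b * LaurentPolynomial.T n) =
      LaurentPolynomial.C ((n - m) * (a * b)) * LaurentPolynomial.T (m + n) := by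
  have h : (LaurentPolynomial.T 1 * LaurentPolynomial.T (-1) : ℂ[T;T⁻¹]) = 1 := by
    rw [← LaurentPolynomial.T_add]; simp
  simp only [wittBracket, laurentDeriv_C_mul_T, map_mul, map_sub, LaurentPolynomial.T_add,
    sub_eq_add_neg n 1, sub_eq_add_neg m 1]
  linear_combination (LaurentPolynomial.C (n : ℂ) - LaurentPolynomial.C (m : ℂ)) *
    LaurentPolynomial.C a * LaurentPolynomial.C b * LaurentPolynomial.T m *
    LaurentPolynomial.T n * h

/-- The bilinear form with `(t ^ j, t ^ k) ↦ δ_{k, -j} (j ^ 3 - j) / 12`. -/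
def virCocycle (f g : ℂ[T;T⁻¹]) : ℂ :=
  f.coeff.sum fun j a => a * g.coeff (-j) * (((j : ℂ) ^ 3 - j) / 12)

theorem virCocycle_add_left (f f' g : ℂ[T;T⁻¹]) :
    virCocycle (f + f') g = virCocycle f g + virCocycle f' g := by
  rw [virCocycle, AddMonoidAlgebra.coeff_add, Finsupp.sum_add_index']
  · rfl
  · intros; simp
  · intros; ring

theorem virCocycle_add_right (f g g' : ℂ[T;T⁻¹]) :
    virCocycle f (g + g') = virCocycle f g + virCocycle f g' := by
  simp only [virCocycle, AddMonoidAlgebra.coeff_add, Finsupp.add_apply, mul_add, add_mul,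
    Finsupp.sum_add]

theorem virCocycle_smul_right (c : ℂ) (f g : ℂ[T;T⁻¹]) :
    virCocycle f (c • g) = c * virCocycle f g := by
  rw [virCocycle, virCocycle, Finsupp.mul_sum]
  refine Finsupp.sum_congr fun j _ => ?_
  rw [AddMonoidAlgebra.coeff_smul, Finsupp.smul_apply, smul_eq_mul]
  ring

theorem virCocycle_single (m n : ℤ) (a b : ℂ) :
    virCocycle (LaurentPolynomial.C a * LaurentPolynomial.T m)
      (LaurentPolynomial.C b * LaurentPolynomial.T n) =
      if n = -m then a * b * (((m : ℂ) ^ 3 - m) / 12) else 0 := by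
  rw [← LaurentPolynomial.single_eq_C_mul_T, ← LaurentPolynomial.single_eq_C_mul_T, virCocycle,
    AddMonoidAlgebra.coeff_single, AddMonoidAlgebra.coeff_single, Finsupp.sum_single_index]
  · rw [Finsupp.single_apply]; split_ifs <;> simp
  · simp

theorem virCocycle_antisymm (f g : ℂ[T;T⁻¹]) : virCocycle f g = -virCocycle g f := by
  induction f using LaurentPolynomial.induction_on' with
  | add p q hp hq => rw [virCocycle_add_left, virCocycle_add_right, hp, hq]; ring
  | C_mul_T m a =>
    induction g using LaurentPolynomial.induction_on' with
    | add p q hp hq => rw [virCocycle_add_left, virCocycle_add_right, hp, hq]; ring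
    | C_mul_T n b =>
      rw [virCocycle_single, virCocycle_single]
      by_cases h : n = -m
      · subst h; simp; ring
      · rw [if_neg h, if_neg (by omega), neg_zero]

theorem wittBracket_add_left (f f' g : ℂ[T;T⁻¹]) :
    wittBracket (f + f') g = wittBracket f g + wittBracket f' g := by
  simp only [wittBracket, map_add]; ring

theorem wittBracket_add_right (f g g' : ℂ[T;T⁻¹]) :
    wittBracket f (g + g') = wittBracket f g + wittBracket f g' := by
  simp only [wittBracket, map_add]; ring

theorem virCocycle_jacobi (f g h : ℂ[T;T⁻¹]) :
    virCocycle f (wittBracket g h) =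
      virCocycle (wittBracket f g) h + virCocycle g (wittBracket f h) := by
  induction f using LaurentPolynomial.induction_on' with
  | add p q hp hq =>
    simp only [wittBracket_add_left, virCocycle_add_left, virCocycle_add_right, hp, hq]; ring
  | C_mul_T l a =>
    induction g using LaurentPolynomial.induction_on' with
    | add p q hp hq =>
      simp only [wittBracket_add_left, wittBracket_add_right, virCocycle_add_left,
        virCocycle_add_right, hp, hq]
      ring
    | C_mul_T m b =>
      induction h using LaurentPolynomial.induction_on' with
      | add p q hp hq =>
        simp only [wittBracket_add_right, virCocycle_add_right, hp, hq]; ring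
      | C_mul_T n c =>
        simp only [wittBracket_single, virCocycle_single]
        by_cases h : n = -(l + m)
        · subst h
          rw [if_pos (by ring), if_pos rfl, if_pos (by ring)]
          push_cast
          ring
        · rw [if_neg (by omega), if_neg (by omega), if_neg (by omega), add_zero]

/-- The underlying space of the Virasoro algebra: `ℂ[t, t⁻¹] ⊕ ℂ z`, with `e_j = t ^ j`. -/
def Vir : Type := ℂ[T;T⁻¹] × ℂ

namespace Vir

instance : AddCommGroup Vir := inferInstanceAs (AddCommGroup (ℂ[T;T⁻¹] × ℂ))

instance : Module ℂ Vir := inferInstanceAs (Module ℂ (ℂ[T;T⁻¹] × ℂ))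

/-- The basis elements `e_j`. -/
def e (j : ℤ) : Vir := (LaurentPolynomial.T j, 0)

/-- The central element. -/
def z : Vir := (0, 1)

/-- The projection `e_j ↦ t ^ j`, `z ↦ 0`. -/
def θ : Vir →ₗ[ℂ] ℂ[T;T⁻¹] := LinearMap.fst ℂ ℂ[T;T⁻¹] ℂ

/-- The linear section `t ^ j ↦ e_j` of `θ`. -/
def lift : ℂ[T;T⁻¹] →ₗ[ℂ] Vir := LinearMap.inl ℂ ℂ[T;T⁻¹] ℂ

instance : LieRing Vir where
  bracket x y := (wittBracket x.1 y.1, virCocycle x.1 y.1)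
  add_lie x y w := Prod.ext (wittBracket_add_left x.1 y.1 w.1) (virCocycle_add_left x.1 y.1 w.1)
  lie_add x y w := Prod.ext (wittBracket_add_right x.1 y.1 w.1) (virCocycle_add_right x.1 y.1 w.1)
  lie_self x := Prod.ext (show wittBracket x.1 x.1 = 0 by simp [wittBracket])
    (by
      have h := virCocycle_antisymm x.1 x.1
      change virCocycle x.1 x.1 = 0
      linear_combination h / 2)
  leibniz_lie x y w := Prod.ext (wittBracket_jacobi x.1 y.1 w.1) (virCocycle_jacobi x.1 y.1 w.1)

theorem θ_lie (x y : Vir) : θ ⁅x, y⁆ = wittBracket (θ x) (θ y) := rfl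

instance : LieAlgebra ℂ Vir where
  lie_smul c x y := Prod.ext
    (by
      change wittBracket x.1 (c • y.1) = c • wittBracket x.1 y.1
      rw [wittBracket, wittBracket, show laurentDeriv (c • y.1) = c • laurentDeriv y.1 from
        laurentDeriv.map_smul c y.1]
      simp only [LaurentPolynomial.smul_eq_C_mul]
      ring)
    (virCocycle_smul_right c x.1 y.1)

/-- The defining relations of the Virasoro algebra. -/
theorem e_lie_e (j k : ℤ) :
    ⁅e j, e k⁆ = ((k : ℂ) - j) • e (j + k) +
      (if k = -j then ((j : ℂ) ^ 3 - j) / 12 else 0) • z := by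
  have h1 := wittBracket_single j k 1 1
  have h2 := virCocycle_single j k 1 1
  simp only [map_one, one_mul, mul_one] at h1 h2
  refine Prod.ext ?_ ?_
  · change wittBracket _ _ = ((k : ℂ) - j) • LaurentPolynomial.T (j + k) + _ • 0
    rw [smul_zero, add_zero, LaurentPolynomial.smul_eq_C_mul]
    exact h1
  · change virCocycle _ _ = ((k : ℂ) - j) • (0 : ℂ) + _ • (1 : ℂ)
    rw [smul_zero, zero_add, smul_eq_mul, mul_one]
    exact h2

theorem z_lie (x : Vir) : ⁅z, x⁆ = 0 :=
  Prod.ext (show wittBracket 0 x.1 = 0 by simp [wittBracket])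
    (show virCocycle 0 x.1 = 0 by simp [virCocycle])

/-- The polynomial subalgebra `Vir^f = θ⁻¹(⟨f⟩)`, where `⟨f⟩` is the ideal of `ℂ[t, t⁻¹]` generated
by `f`. -/
def poly (f : ℂ[X]) : LieSubalgebra ℂ Vir where
  toSubmodule := ((Ideal.span {Polynomial.toLaurent f}).restrictScalars ℂ).comap θ
  lie_mem' {x y} hx hy := by
    change wittBracket x.1 y.1 ∈ Ideal.span {Polynomial.toLaurent f}
    exact Ideal.mul_mem_left _ _ (sub_mem (Ideal.mul_mem_right _ _ hx) (Ideal.mul_mem_right _ _ hy))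

theorem mem_poly {f : ℂ[X]} {x : Vir} :
    x ∈ poly f ↔ θ x ∈ Ideal.span {Polynomial.toLaurent f} := Iff.rfl

theorem poly_le_of_dvd {f g : ℂ[X]} (h : f ∣ g) : poly g ≤ poly f := fun _ hx =>
  mem_poly.2 (Ideal.span_singleton_le_span_singleton.2 (map_dvd Polynomial.toLaurent h)
    (mem_poly.1 hx))

/-- The element `x_j^f = ∑ i, a_i e_{j + i}` of `Vir^f`, where `f = ∑ i, a_i t ^ i`; that is,
`t ^ j f` regarded as an element of `Vir^f`. -/
def polyElt (f : ℂ[X]) (j : ℤ) : poly f :=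
  ⟨lift (LaurentPolynomial.T j * Polynomial.toLaurent f),
    mem_poly.2 <| Ideal.mul_mem_left _ _ (Ideal.subset_span (Set.mem_singleton _))⟩

theorem coe_polyElt (f : ℂ[X]) (j : ℤ) :
    (polyElt f j : Vir) = f.sum fun i a => a • e (j + i) := by
  have h : LaurentPolynomial.T j * Polynomial.toLaurent f =
      f.sum fun i a => a • LaurentPolynomial.T (j + i) := by
    conv_lhs => rw [← Polynomial.sum_monomial_eq f]
    simp only [Polynomial.sum, map_sum, Finset.mul_sum]
    refine Finset.sum_congr rfl fun i _ => ?_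
    rw [← Polynomial.C_mul_X_pow_eq_monomial, Polynomial.toLaurent_C_mul_X_pow,
      LaurentPolynomial.smul_eq_C_mul, LaurentPolynomial.T_add]
    ring
  change lift _ = _
  rw [h, Polynomial.sum, map_sum]
  refine Finset.sum_congr rfl fun i _ => ?_
  rw [map_smul]
  rfl

/-- The Virasoro module `V^f_μ = U(Vir) ⊗_{U(Vir^f)} ℂ_μ`. -/
abbrev V (f : ℂ[X]) (μ : poly f →ₗ⁅ℂ⁆ ℂ) : Type := InducedModule (poly f) μ

/-- `p` is associated to the homomorphism `μ : Vir^{(t - lam)^n} → ℂ`: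
`μ(t ^ j (t - lam) ^ n) = p(j) lam ^ j` for all integers `j`. -/
def IsAssociated (lam : ℂ) (n : ℕ) (μ : poly ((X - C lam) ^ n) →ₗ⁅ℂ⁆ ℂ) (p : ℂ[X]) : Prop :=
  ∀ j : ℤ, μ (polyElt ((X - C lam) ^ n) j) = p.eval (j : ℂ) * lam ^ j

/-- Distinct nonzero `lam 1, …, lam k`, positive multiplicities `n i` and homomorphisms
`μ i : Vir^{(t - lam i)^{n i}} → ℂ`. -/
structure Data (k : ℕ) where
  lam : Fin k → ℂ
  lam_ne_zero : ∀ i, lam i ≠ 0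
  lam_injective : Function.Injective lam
  n : Fin k → ℕ
  n_pos : ∀ i, 1 ≤ n i
  μ : ∀ i, poly ((X - C (lam i)) ^ n i) →ₗ⁅ℂ⁆ ℂ

namespace Data

variable {k : ℕ} (D : Data k)

/-- `f = ∏ i, (t - lam i) ^ n i`. -/
def f : ℂ[X] := ∏ i, (X - C (D.lam i)) ^ D.n i

theorem poly_f_le (i : Fin k) : poly D.f ≤ poly ((X - C (D.lam i)) ^ D.n i) :=
  poly_le_of_dvd (Finset.dvd_prod_of_mem _ (Finset.mem_univ i))

/-- `μ = ∑ i, μ i : Vir^f → ℂ`, the sum of the restrictions of the `μ i` to `Vir^f`. -/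
def sumμ : poly D.f →ₗ⁅ℂ⁆ ℂ where
  toLinearMap := ∑ i, ((D.μ i).comp (LieSubalgebra.inclusion (D.poly_f_le i)) : poly D.f →ₗ[ℂ] ℂ)
  map_lie' {x y} := by
    have h : ∀ a b : ℂ, ⁅a, b⁆ = 0 := fun a b => by
      rw [LieRing.of_associative_ring_bracket, mul_comm, sub_self]
    change (∑ i, ((D.μ i).comp (LieSubalgebra.inclusion (D.poly_f_le i)) :
      poly D.f →ₗ[ℂ] ℂ)) ⁅x, y⁆ = _
    rw [h, LinearMap.sum_apply]
    refine Finset.sum_eq_zero fun i _ => ?_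
    rw [LieHom.coe_toLinearMap, LieHom.map_lie, h]

theorem sumμ_apply (x : poly D.f) : D.sumμ x = ∑ i, D.μ i ⟨x, D.poly_f_le i x.2⟩ := by
  change (∑ i, ((D.μ i).comp (LieSubalgebra.inclusion (D.poly_f_le i)) :
    poly D.f →ₗ[ℂ] ℂ)) x = _
  rw [LinearMap.sum_apply]
  rfl

/-- The `Vir`-module `⨂ i, V^{(t - lam i)^{n i}}_{μ i}`. -/
abbrev tensor : Type := ⨂[ℂ] i, V ((X - C (D.lam i)) ^ D.n i) (D.μ i)

/-- `f = c ∏ i, (t - lam i) ^ n i` for a nonzero constant `c`, and `μ` is the sum of the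
restrictions of the `μ i` to `Vir^f`. -/
def Decomposes (f : ℂ[X]) (μ : poly f →ₗ⁅ℂ⁆ ℂ) : Prop :=
  ∃ (c : ℂ) (_ : c ≠ 0) (h : f = C c * D.f),
    ∀ x : poly f, μ x = D.sumμ ⟨x, poly_le_of_dvd (Dvd.intro_left (C c) h.symm) x.2⟩

end Data

/-- `μ : Vir^f → ℂ` has large degree: in the decomposition `μ = ∑ i, μ i` along the roots of `f`,
where `μ i` is associated to the polynomial `p i`, one has `deg (p i) ≥ n i - 2` for all `i`; the
zero polynomial has degree `-∞`. -/
def HasLargeDegree (f : ℂ[X]) (μ : poly f →ₗ⁅ℂ⁆ ℂ) : Prop :=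
  ∃ (k : ℕ) (D : Data k) (p : Fin k → ℂ[X]),
    D.Decomposes f μ ∧ (∀ i, IsAssociated (D.lam i) (D.n i) (D.μ i) (p i)) ∧
      ∀ i, (D.n i : WithBot ℕ) ≤ (p i).degree + 2

end Vir

end

/-! # Modules induced from polynomial subalgebras of the Virasoro algebra -/

/-! ### The enveloping algebra and induced modules -/

namespace UniversalEnvelopingAlgebra

variable {R L : Type*} [CommRing R] [LieRing L] [LieAlgebra R L]

/-! Write V for V^f_μ and `gen` for 1 ⊗ 1. As f has nonzero constant term, μ kills z and every
multiple of f². Hence each vector of V is killed by all multiples of some power of f, and the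
Chinese remainder theorem splits the action of Vir on V into commuting actions, one for each root of
f. Under the i-th action `gen` is an eigenvector with character μ_i, so the tensor product maps to
V; the map from V sending `gen` to the tensor product of the generators is inverse to it
(`nonempty_tensor_equiv`).

That `gen` is nonzero comes from an explicit model instead of a basis of V. Vector fields act on
polynomial functions of pairs of functionals (χ₁, χ₂) on ℂ[t, t⁻¹], twisted by the cocycle (v(t) -
v(u)) / (t - u). In the dual module, evaluation at a suitable pair is an eigenvector with character
μ (`IsTopCoeff.exists_hom`).

For one root put s = t - λ and let s^c d/ds have eigenvalue m_c on `gen` for c ≥ n. If μ is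
associated to p ≠ 0, the last nonzero m_c is at k = n + deg p, and deg p ≥ n - 2 forces k ∈ {2n - 2,
2n - 1}. Filter V by giving s^a d/ds, a < n, the weight k - a. Subtracting m_c from s^c d/ds gives
an operator that lowers weights when c ≥ 2. Products of such operators give an Euler operator: it
multiplies weight w by w up to lower weight, yet kills every vector sharing the eigenvalues of
`gen`. (For k = 1 the operator depends on the weight.) So every nonzero submodule contains `gen`,
and eigenvectors with character μ are multiples of `gen` (`LocalModel.gen_mem_of_stable`,
`LocalModel.mem_span_of_eigen`). The second fact makes endomorphisms scalar, and the Jacobson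
density theorem then carries simplicity to the tensor product.

Conversely, if deg p_i < n_i - 2, remove one factor t - λ_i from f. The character extends to the
larger subalgebra. If V were simple it would embed in the module induced from any extension, so
`gen` would be an eigenvector of the larger subalgebra with that extension as character
(`lie_gen_of_isIrreducible`). At a multiple root there are two extensions; at a simple root the
model shows that `gen` is no such eigenvector.

A general μ is decomposed by multiplying with idempotents modulo f², and each p_i solves a linear
recurrence. -/

theorem induction_ι {P : UniversalEnvelopingAlgebra R L → Prop}
    (halg : ∀ r : R, P (algebraMap R (UniversalEnvelopingAlgebra R L) r)) (hι : ∀ x, P (ι R x))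
    (hadd : ∀ u w, P u → P w → P (u + w)) (hmul : ∀ u w, P u → P w → P (u * w))
    (u : UniversalEnvelopingAlgebra R L) : P u := by
  let S : Subalgebra R (UniversalEnvelopingAlgebra R L) :=
    { carrier := {u | P u}
      mul_mem' := fun {a b} ha hb => hmul a b ha hb
      add_mem' := fun {a b} ha hb => hadd a b ha hb
      algebraMap_mem' := halg }
  let j : L →ₗ⁅R⁆ S :=
    { toLinearMap := (ι R : L →ₗ⁅R⁆ UniversalEnvelopingAlgebra R L).toLinearMap.codRestrict
        (Subalgebra.toSubmodule S) hι
      map_lie' := fun {x y} => Subtype.ext (LieHom.map_lie (ι R) x y) }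
  have h : S.val.comp (lift R j) = AlgHom.id R (UniversalEnvelopingAlgebra R L) := by
    refine hom_ext R ?_
    ext x
    change S.val (lift R j (ι R x)) = ι R x
    rw [lift_ι_apply]
    rfl
  have h2 : S.val (lift R j u) = u := congrArg (fun φ : UniversalEnvelopingAlgebra R L →ₐ[R]
    UniversalEnvelopingAlgebra R L => φ u) h
  rw [← h2]
  exact (lift R j u).2

/-- The action of the enveloping algebra on a Lie module. -/
noncomputable def toEnd (R L : Type*) [CommRing R] [LieRing L] [LieAlgebra R L] (M : Type*)
    [AddCommGroup M] [Module R M] [LieRingModule L M] [LieModule R L M] :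
    UniversalEnvelopingAlgebra R L →ₐ[R] Module.End R M :=
  lift R (LieModule.toEnd R L M)

section
variable {M : Type*} [AddCommGroup M] [Module R M] [LieRingModule L M] [LieModule R L M]

theorem toEnd_ι (x : L) (m : M) : toEnd R L M (ι R x) m = ⁅x, m⁆ := by
  rw [toEnd, lift_ι_apply, LieModule.toEnd_apply_apply]

theorem toEnd_mem (N : LieSubmodule R L M) (u : UniversalEnvelopingAlgebra R L) :
    ∀ m ∈ N, toEnd R L M u m ∈ N := by
  induction u using induction_ι with
  | halg r =>
    intro m hm
    rw [AlgHom.commutes, Module.algebraMap_end_apply]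
    exact N.smul_mem r hm
  | hι x =>
    intro m hm
    rw [toEnd_ι]
    exact N.lie_mem hm
  | hadd u w hu hw =>
    intro m hm
    rw [map_add, LinearMap.add_apply]
    exact N.add_mem (hu m hm) (hw m hm)
  | hmul u w hu hw =>
    intro m hm
    rw [map_mul, Module.End.mul_apply]
    exact hu _ (hw m hm)

end

end UniversalEnvelopingAlgebra

namespace InducedModule

variable {R L : Type*} [CommRing R] [LieRing L] [LieAlgebra R L]
variable (a : LieSubalgebra R L) (μ : a →ₗ⁅R⁆ R)

/-- The generator `1 ⊗ 1` of the induced module. -/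
noncomputable def gen : InducedModule a μ :=
  Submodule.Quotient.mk ((1 : UniversalEnvelopingAlgebra R L) ⊗ₜ[R] (1 : R))

variable {a μ}

theorem lie_eq_smul (x : L) (w : InducedModule a μ) :
    ⁅x, w⁆ = UniversalEnvelopingAlgebra.ι R x • w := rfl

theorem lie_gen (x : L) (hx : x ∈ a) : ⁅x, gen a μ⁆ = μ ⟨x, hx⟩ • gen a μ := by
  -- The balancing relation with u = 1, b = ι x and c = 1.
  have h := Submodule.subset_span (R := UniversalEnvelopingAlgebra R L)
    (s := {w | ∃ (u : UniversalEnvelopingAlgebra R L) (b : UniversalEnvelopingAlgebra R a) (c : R),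
      w = (u * envelopingIncl a b) ⊗ₜ[R] c -
        u ⊗ₜ[R] (UniversalEnvelopingAlgebra.lift R μ b * c)})
    ⟨1, UniversalEnvelopingAlgebra.ι R ⟨x, hx⟩, 1, rfl⟩
  have h2 := (Submodule.Quotient.mk_eq_zero (balancedRelations a μ)).2 h
  rw [Submodule.Quotient.mk_sub, sub_eq_zero, one_mul, mul_one,
    UniversalEnvelopingAlgebra.lift_ι_apply, envelopingIncl,
    UniversalEnvelopingAlgebra.lift_ι_apply] at h2
  have h3 : (1 : UniversalEnvelopingAlgebra R L) ⊗ₜ[R] μ ⟨x, hx⟩ =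
      μ ⟨x, hx⟩ • ((1 : UniversalEnvelopingAlgebra R L) ⊗ₜ[R] (1 : R)) := by
    rw [← TensorProduct.tmul_smul, smul_eq_mul, mul_one]
  rw [h3] at h2
  have h4 : ⁅x, gen a μ⁆ = Submodule.Quotient.mk
      (UniversalEnvelopingAlgebra.ι R x • ((1 : UniversalEnvelopingAlgebra R L) ⊗ₜ[R] (1 : R))) :=
    rfl
  rw [h4, TensorProduct.smul_tmul', smul_eq_mul, mul_one]
  exact h2

theorem exists_smul_gen (w : InducedModule a μ) :
    ∃ u : UniversalEnvelopingAlgebra R L, w = u • gen a μ := by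
  obtain ⟨t, rfl⟩ := Submodule.Quotient.mk_surjective (balancedRelations a μ) w
  induction t using TensorProduct.induction_on with
  | zero => exact ⟨0, by rw [zero_smul]; rfl⟩
  | tmul u c =>
    refine ⟨c • u, ?_⟩
    change Submodule.Quotient.mk (u ⊗ₜ[R] c) =
      Submodule.Quotient.mk ((c • u) • ((1 : UniversalEnvelopingAlgebra R L) ⊗ₜ[R] (1 : R)))
    rw [TensorProduct.smul_tmul', smul_eq_mul, mul_one, TensorProduct.smul_tmul, smul_eq_mul,
      mul_one]
  | add s t hs ht =>
    obtain ⟨u, hu⟩ := hs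
    obtain ⟨w, hw⟩ := ht
    exact ⟨u + w, by rw [Submodule.Quotient.mk_add, hu, hw, add_smul]; rfl⟩

theorem toEnd_apply (u : UniversalEnvelopingAlgebra R L) :
    ∀ w : InducedModule a μ, UniversalEnvelopingAlgebra.toEnd R L _ u w = u • w := by
  induction u using UniversalEnvelopingAlgebra.induction_ι with
  | halg r =>
    intro w
    rw [AlgHom.commutes, Module.algebraMap_end_apply, algebraMap_smul]
  | hι x => intro w; rw [UniversalEnvelopingAlgebra.toEnd_ι]; rfl
  | hadd u w hu hw => intro m; rw [map_add, LinearMap.add_apply, hu, hw, add_smul]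
  | hmul u w hu hw => intro m; rw [map_mul, Module.End.mul_apply, hu, hw, mul_smul]

theorem eq_top_of_gen_mem (N : LieSubmodule R L (InducedModule a μ)) (h : gen a μ ∈ N) :
    N = ⊤ := by
  refine eq_top_iff.2 fun w _ => ?_
  obtain ⟨u, rfl⟩ := exists_smul_gen w
  rw [← toEnd_apply]
  exact UniversalEnvelopingAlgebra.toEnd_mem N u _ h

section Lift

variable {M : Type*} [AddCommGroup M] [Module R M] [LieRingModule L M]

/-- Frobenius reciprocity; together with `hom_ext` it is the universal property through which
induced modules are used below. -/
theorem exists_hom [LieModule R L M] (m : M) (h : ∀ x : a, ⁅(x : L), m⁆ = μ x • m) :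
    ∃ φ : InducedModule a μ →ₗ⁅R,L⁆ M, φ (gen a μ) = m := by
  let _ : Module (UniversalEnvelopingAlgebra R L) M :=
    Module.compHom M (UniversalEnvelopingAlgebra.toEnd R L M).toRingHom
  have hsm : ∀ (u : UniversalEnvelopingAlgebra R L) (w : M),
    u • w = UniversalEnvelopingAlgebra.toEnd R L M u w := fun _ _ => rfl
  have : IsScalarTower R (UniversalEnvelopingAlgebra R L) M :=
    ⟨fun r u w => by rw [hsm, hsm, map_smul, LinearMap.smul_apply]⟩
  -- An eigenvector of `a` is an eigenvector of all of U(a), with the extended character.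
  have hb : ∀ b : UniversalEnvelopingAlgebra R a,
      envelopingIncl a b • m = UniversalEnvelopingAlgebra.lift R μ b • m := by
    intro b
    induction b using UniversalEnvelopingAlgebra.induction_ι with
    | halg r =>
      rw [AlgHom.commutes, AlgHom.commutes, algebraMap_smul]; rfl
    | hι x =>
      rw [envelopingIncl, UniversalEnvelopingAlgebra.lift_ι_apply,
        UniversalEnvelopingAlgebra.lift_ι_apply, ← h x, hsm]
      exact UniversalEnvelopingAlgebra.toEnd_ι _ _
    | hadd u w hu hw => rw [map_add, map_add, add_smul, add_smul, hu, hw]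
    | hmul u w hu hw =>
      rw [map_mul, map_mul, mul_smul, hw, hsm, map_smul, ← hsm, hu, smul_smul, mul_comm]
  let T : UniversalEnvelopingAlgebra R L ⊗[R] R →ₗ[UniversalEnvelopingAlgebra R L] M :=
    (LinearMap.toSpanSingleton _ M m) ∘ₗ
      (TensorProduct.AlgebraTensorModule.rid R (UniversalEnvelopingAlgebra R L)
        (UniversalEnvelopingAlgebra R L)).toLinearMap
  have hT : ∀ u c, T (u ⊗ₜ[R] c) = c • u • m := by
    intro u c
    change (TensorProduct.AlgebraTensorModule.rid R (UniversalEnvelopingAlgebra R L)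
        (UniversalEnvelopingAlgebra R L) (u ⊗ₜ[R] c)) • m = _
    rw [TensorProduct.AlgebraTensorModule.rid_tmul, smul_assoc]
  have hle : balancedRelations a μ ≤ LinearMap.ker T := by
    refine Submodule.span_le.2 ?_
    rintro _ ⟨u, b, c, rfl⟩
    rw [SetLike.mem_coe, LinearMap.mem_ker, map_sub, hT, hT, mul_smul, hb, sub_eq_zero, hsm,
      map_smul, ← hsm, smul_smul, mul_comm]
  let φ : InducedModule a μ →ₗ[UniversalEnvelopingAlgebra R L] M :=
    (balancedRelations a μ).liftQ T hle
  refine ⟨{ toLinearMap := φ.restrictScalars R, map_lie' := fun {x w} => ?_ }, ?_⟩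
  · change φ (UniversalEnvelopingAlgebra.ι R x • w) = ⁅x, φ w⁆
    rw [map_smul, hsm, UniversalEnvelopingAlgebra.toEnd_ι]
  · change T (1 ⊗ₜ[R] 1) = m
    rw [hT, one_smul, one_smul]

theorem hom_ext {φ ψ : InducedModule a μ →ₗ⁅R,L⁆ M} (h : φ (gen a μ) = ψ (gen a μ)) : φ = ψ := by
  let N : LieSubmodule R L (InducedModule a μ) :=
    { toSubmodule := LinearMap.eqLocus (φ : InducedModule a μ →ₗ[R] M) ψ
      lie_mem := fun {x w} hw => by
        change φ ⁅x, w⁆ = ψ ⁅x, w⁆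
        rw [LieModuleHom.map_lie, LieModuleHom.map_lie]
        exact congrArg _ hw }
  have hN := eq_top_of_gen_mem N h
  ext w
  have : w ∈ N := by rw [hN]; trivial
  exact this

end Lift

end InducedModule

/-! ### Characters of polynomial subalgebras -/

namespace Vir

theorem z_mem_poly (f : ℂ[X]) : z ∈ poly f := mem_poly.2 (Submodule.zero_mem _)

theorem eq_lift_add (x : Vir) : x = lift (θ x) + x.2 • z :=
  Prod.ext (show x.1 = x.1 + x.2 • (0 : ℂ[T;T⁻¹]) by rw [smul_zero, add_zero])
    (show x.2 = 0 + x.2 * 1 by rw [zero_add, mul_one])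

theorem θ_lift (g : ℂ[T;T⁻¹]) : θ (lift g) = g := rfl

theorem wittBracket_mul_mul (f g h : ℂ[T;T⁻¹]) :
    wittBracket (f * g) (f * h) = f * f * wittBracket g h := by
  simp only [wittBracket, laurentDeriv_mul]; ring

theorem wittBracket_T (j k : ℤ) :
    wittBracket (LaurentPolynomial.T j) (LaurentPolynomial.T k) =
      ((k : ℂ) - j) • LaurentPolynomial.T (j + k) := by
  have h := wittBracket_single j k 1 1
  simp only [map_one, one_mul, mul_one] at h
  rw [h, LaurentPolynomial.smul_eq_C_mul]

/-- The cocycle only pairs exponents with sum zero, and here that leaves only the two constant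
terms. -/
theorem virCocycle_toLaurent_mul_T (p q : ℂ[X]) (j : ℤ) :
    virCocycle (toLaurent p * LaurentPolynomial.T j) (toLaurent q * LaurentPolynomial.T (-j)) =
      p.coeff 0 * q.coeff 0 * (((j : ℂ) ^ 3 - j) / 12) := by
  induction p using Polynomial.induction_on' with
  | add p p' hp hp' =>
    rw [map_add, add_mul, virCocycle_add_left, hp, hp', coeff_add]; ring
  | monomial m a =>
    induction q using Polynomial.induction_on' with
    | add q q' hq hq' =>
      rw [map_add, add_mul, virCocycle_add_right, hq, hq', coeff_add]; ring
    | monomial n b =>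
      rw [← C_mul_X_pow_eq_monomial, ← C_mul_X_pow_eq_monomial, toLaurent_C_mul_X_pow,
        toLaurent_C_mul_X_pow, mul_assoc, mul_assoc, ← LaurentPolynomial.T_add,
        ← LaurentPolynomial.T_add, virCocycle_single]
      rcases Nat.eq_zero_or_pos m with rfl | hm
      · rcases Nat.eq_zero_or_pos n with rfl | hn
        · simp
        · rw [if_neg (by omega)]
          simp [coeff_X_pow, hn.ne]
      · rw [if_neg (by omega)]
        simp [coeff_X_pow, hm.ne]

theorem map_lie_eq_zero {a : LieSubalgebra ℂ Vir} (μ : a →ₗ⁅ℂ⁆ ℂ) (x y : a) : μ ⁅x, y⁆ = 0 := by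
  rw [LieHom.map_lie, LieRing.of_associative_ring_bracket, mul_comm, sub_self]

section Character

variable {f : ℂ[X]} (μ : poly f →ₗ⁅ℂ⁆ ℂ)

/-- The linear functional `g ↦ μ(g f)`. -/
noncomputable def onMul : ℂ[T;T⁻¹] →ₗ[ℂ] ℂ where
  toFun g := μ ⟨lift (toLaurent f * g),
    mem_poly.2 <| Ideal.mul_mem_right _ _ (Ideal.subset_span (Set.mem_singleton _))⟩
  map_add' g h := by
    rw [← map_add]
    congr 1
    exact Subtype.ext (by simp only [mul_add, map_add]; rfl)
  map_smul' c g := by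
    rw [RingHom.id_apply, ← map_smul]
    congr 1
    exact Subtype.ext (by simp only [mul_smul_comm, map_smul]; rfl)

variable {μ}

theorem onMul_T (j : ℤ) : onMul μ (LaurentPolynomial.T j) = μ (polyElt f j) := by
  change μ _ = μ _
  congr 1
  exact Subtype.ext (congrArg lift (mul_comm _ _))

theorem apply_eq_onMul_add (x : Vir) (g : ℂ[T;T⁻¹]) (hx : x ∈ poly f)
    (h : θ x = toLaurent f * g) : μ ⟨x, hx⟩ = onMul μ g + x.2 * μ ⟨z, z_mem_poly f⟩ := by
  change _ = μ _ + x.2 • _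
  rw [← map_smul, ← map_add]
  congr 1
  refine Subtype.ext ?_
  change x = lift (toLaurent f * g) + x.2 • z
  rw [← h]
  exact eq_lift_add x

theorem onMul_wittBracket (g h : ℂ[T;T⁻¹]) :
    onMul μ (toLaurent f * wittBracket g h) +
      virCocycle (toLaurent f * g) (toLaurent f * h) * μ ⟨z, z_mem_poly f⟩ = 0 := by
  have hm : ∀ g, lift (toLaurent f * g) ∈ poly f := fun g =>
    mem_poly.2 <| Ideal.mul_mem_right _ _ (Ideal.subset_span (Set.mem_singleton _))
  have h0 := map_lie_eq_zero μ ⟨_, hm g⟩ ⟨_, hm h⟩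
  rw [← h0]
  refine (apply_eq_onMul_add ⁅lift (toLaurent f * g), lift (toLaurent f * h)⁆ _
    (LieSubalgebra.lie_mem _ (hm g) (hm h)) ?_).symm
  rw [θ_lie, θ_lift, θ_lift, wittBracket_mul_mul, mul_assoc]

/-- μ vanishes on the bracket of f t^j and f t^(-j). This gives a term linear in j, from f², plus a
multiple of j³ - j times μ(z); two values of j separate them. -/
theorem apply_z (h0 : f.coeff 0 ≠ 0) : μ ⟨z, z_mem_poly f⟩ = 0 := by
  have key : ∀ j : ℤ, (-2 * j : ℂ) * onMul μ (toLaurent f) +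
      f.coeff 0 * f.coeff 0 * (((j : ℂ) ^ 3 - j) / 12) * μ ⟨z, z_mem_poly f⟩ = 0 := by
    intro j
    have h := onMul_wittBracket (μ := μ) (LaurentPolynomial.T j) (LaurentPolynomial.T (-j))
    rw [virCocycle_toLaurent_mul_T, wittBracket_T, add_neg_cancel, LaurentPolynomial.T_zero,
      mul_smul_comm, mul_one, map_smul, smul_eq_mul] at h
    rw [← h]
    push_cast
    ring
  have h1 := key 1
  have h2 := key 2
  push_cast at h1 h2
  have h3 : f.coeff 0 * f.coeff 0 * μ ⟨z, z_mem_poly f⟩ = 0 := by linear_combination 2 * h2 - 4 * h1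
  simpa [h0] using h3

/-- Once μ(z) = 0, each f² t^m is, for μ, a nonzero multiple of a bracket in Vir^f: of f with f t^m
if m ≠ 0, and of f t with f t⁻¹ if m = 0. -/
theorem onMul_self_mul (h0 : f.coeff 0 ≠ 0) (g : ℂ[T;T⁻¹]) :
    onMul μ (toLaurent f * g) = 0 := by
  have hw : ∀ g h, onMul μ (toLaurent f * wittBracket g h) = 0 := fun g h => by
    simpa [apply_z h0] using onMul_wittBracket (μ := μ) g h
  have hT : ∀ m : ℤ, onMul μ (toLaurent f * LaurentPolynomial.T m) = 0 := by
    intro m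
    rcases eq_or_ne m 0 with rfl | hm
    · have h := hw (LaurentPolynomial.T 1) (LaurentPolynomial.T (-1))
      rw [wittBracket_T, mul_smul_comm, map_smul, smul_eq_mul, add_neg_cancel] at h
      refine (mul_eq_zero.1 h).resolve_left ?_
      norm_num
    · have h := hw (LaurentPolynomial.T 0) (LaurentPolynomial.T m)
      rw [wittBracket_T, mul_smul_comm, map_smul, smul_eq_mul, zero_add] at h
      refine (mul_eq_zero.1 h).resolve_left ?_
      simpa using hm
  induction g using LaurentPolynomial.induction_on' with
  | add p q hp hq => rw [mul_add, map_add, hp, hq, add_zero]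
  | C_mul_T n a =>
    rw [← LaurentPolynomial.smul_eq_C_mul, mul_smul_comm, map_smul, hT, smul_zero]

theorem apply_eq_onMul (h0 : f.coeff 0 ≠ 0) (x : Vir) (g : ℂ[T;T⁻¹]) (hx : x ∈ poly f)
    (h : θ x = toLaurent f * g) : μ ⟨x, hx⟩ = onMul μ g := by
  rw [apply_eq_onMul_add x g hx h, apply_z h0, mul_zero, add_zero]

theorem apply_eq_zero_of_sq_dvd (h0 : f.coeff 0 ≠ 0) (x : Vir) (hx : x ∈ poly f)
    (h : toLaurent f * toLaurent f ∣ θ x) : μ ⟨x, hx⟩ = 0 := by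
  obtain ⟨g, hg⟩ := h
  rw [apply_eq_onMul h0 x (toLaurent f * g) hx (by rw [hg, mul_assoc]), onMul_self_mul h0]

theorem mem_poly_iff_dvd {x : Vir} : x ∈ poly f ↔ toLaurent f ∣ θ x := by
  rw [mem_poly, Ideal.mem_span_singleton]

end Character

/-! ### Local nilpotency -/

section Nilp

variable {M : Type*} [AddCommGroup M] [Module ℂ M] [LieRingModule Vir M] [LieModule ℂ Vir M]

/-- Differentiation lowers the order of vanishing along g by at most one. -/
theorem dvd_wittBracket_of_pow_succ {g x y : ℂ[T;T⁻¹]} {N : ℕ} (h : g ^ (N + 1) ∣ x) :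
    g ^ N ∣ wittBracket x y := by
  obtain ⟨a, rfl⟩ := h
  have hd : ∀ n : ℕ, ∃ b, laurentDeriv (g ^ (n + 1)) = g ^ n * b := by
    intro n
    induction n with
    | zero => exact ⟨laurentDeriv g, by simp⟩
    | succ n ih =>
      obtain ⟨b, hb⟩ := ih
      exact ⟨laurentDeriv g + b, by
        rw [pow_succ g (n + 1), laurentDeriv_mul, hb]; ring⟩
  obtain ⟨b, hb⟩ := hd N
  refine ⟨LaurentPolynomial.T 1 * (g * a * laurentDeriv y -
    y * (g * laurentDeriv a + b * a)), ?_⟩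
  rw [wittBracket, laurentDeriv_mul, hb]
  ring

variable (M) in
/-- The vectors of `M` killed by all sufficiently high powers of `f`. -/
noncomputable def nilpotentVectors (f : ℂ[T;T⁻¹]) : LieSubmodule ℂ Vir M where
  carrier := {u | ∃ N : ℕ, ∀ x : Vir, f ^ N ∣ θ x → ⁅x, u⁆ = 0}
  add_mem' := by
    rintro u w ⟨N, hN⟩ ⟨N', hN'⟩
    refine ⟨N + N', fun x hx => ?_⟩
    rw [lie_add, hN x ((pow_dvd_pow f (Nat.le_add_right _ _)).trans hx),
      hN' x ((pow_dvd_pow f (Nat.le_add_left _ _)).trans hx), add_zero]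
  zero_mem' := ⟨0, fun x _ => lie_zero x⟩
  smul_mem' := by
    rintro c u ⟨N, hN⟩
    exact ⟨N, fun x hx => by rw [lie_smul, hN x hx, smul_zero]⟩
  lie_mem := by
    rintro y u ⟨N, hN⟩
    refine ⟨N + 1, fun x hx => ?_⟩
    rw [leibniz_lie, hN x ((pow_dvd_pow f (Nat.le_succ N)).trans hx), lie_zero, add_zero]
    exact hN _ (dvd_wittBracket_of_pow_succ hx)

end Nilp

theorem nilpotentVectors_V {f : ℂ[X]} (h0 : f.coeff 0 ≠ 0) (μ : poly f →ₗ⁅ℂ⁆ ℂ) :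
    nilpotentVectors (V f μ) (toLaurent f) = ⊤ := by
  refine InducedModule.eq_top_of_gen_mem _ ⟨2, fun x hx => ?_⟩
  have hx' : x ∈ poly f := mem_poly_iff_dvd.2 ((dvd_pow_self _ two_ne_zero).trans hx)
  rw [InducedModule.lie_gen x hx', apply_eq_zero_of_sq_dvd h0 x hx' (by rwa [← sq]), zero_smul]

end Vir

namespace Vir

/-! ### Linear maps on Laurent polynomials -/

section LaurentLinear

variable {M : Type*} [AddCommGroup M] [Module ℂ M]

/-- The linear map with `t ^ n ↦ g n`. -/
noncomputable def ofT (g : ℤ → M) : ℂ[T;T⁻¹] →ₗ[ℂ] M :=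
  Finsupp.lsum ℂ (fun n : ℤ => LinearMap.toSpanSingleton ℂ M (g n)) ∘ₗ
    (AddMonoidAlgebra.coeffLinearEquiv ℂ).toLinearMap

theorem ofT_T (g : ℤ → M) (n : ℤ) : ofT g (LaurentPolynomial.T n) = g n := by
  rw [ofT, LinearMap.comp_apply]
  change Finsupp.lsum ℂ _ (AddMonoidAlgebra.single n (1 : ℂ)).coeff = _
  rw [AddMonoidAlgebra.coeff_single, Finsupp.lsum_single, LinearMap.toSpanSingleton_apply, one_smul]

theorem ext_T {φ ψ : ℂ[T;T⁻¹] →ₗ[ℂ] M}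
    (h : ∀ n, φ (LaurentPolynomial.T n) = ψ (LaurentPolynomial.T n)) : φ = ψ := by
  refine LinearMap.ext fun g => ?_
  induction g using LaurentPolynomial.induction_on' with
  | add p q hp hq => rw [map_add, map_add, hp, hq]
  | C_mul_T n a => rw [← LaurentPolynomial.smul_eq_C_mul, map_smul, map_smul, h]

end LaurentLinear

/-! ### A twisted module of functions on pairs of functionals -/

/-- The coefficients of the cocycle: `∑ t ^ i u ^ j` over `i + j = m`, with sign `1` for
`i, j ≥ 0` and sign `-1` for `i, j < 0`. -/
noncomputable def divDiffCoeff (m : ℤ) : ℤ × ℤ →₀ ℂ :=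
  Finsupp.ofSupportFinite
    (fun p => if p.1 + p.2 = m then (if 0 ≤ p.1 then 1 else 0) - (if p.2 < 0 then 1 else 0) else 0)
    (by
      refine ((Set.finite_Icc (-|m|) |m|).image fun i => (i, m - i)).subset ?_
      rintro ⟨i, j⟩ h
      rw [Function.mem_support] at h
      refine ⟨i, ?_, ?_⟩
      · rw [Set.mem_Icc]
        by_contra hc
        apply h
        have := abs_nonneg m
        have := le_abs_self m
        have := neg_abs_le m
        dsimp only
        split_ifs <;> first | rfl | omega | simp
      · have : i + j = m := by by_contra hc; exact h (if_neg hc)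
        simp only [Prod.mk.injEq, true_and]
        omega)

theorem divDiffCoeff_apply (m i j : ℤ) : divDiffCoeff m (i, j) =
    if i + j = m then (if 0 ≤ i then 1 else 0) - (if j < 0 then 1 else 0) else 0 := rfl

/-- The action of `t ^ (m + 1) d / dt` on functions of two variables. -/
noncomputable def biAct (m : ℤ) : (ℤ × ℤ →₀ ℂ) →ₗ[ℂ] (ℤ × ℤ →₀ ℂ) :=
  Finsupp.lsum ℂ fun p => LinearMap.toSpanSingleton ℂ _
    ((p.1 : ℂ) • Finsupp.single (p.1 + m, p.2) 1 + (p.2 : ℂ) • Finsupp.single (p.1, p.2 + m) 1)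

theorem biAct_single (m i j : ℤ) (a : ℂ) : biAct m (Finsupp.single (i, j) a) =
    a • ((i : ℂ) • Finsupp.single (i + m, j) 1 + (j : ℂ) • Finsupp.single (i, j + m) 1) := by
  rw [biAct, Finsupp.lsum_single, LinearMap.toSpanSingleton_apply]

theorem biAct_apply (m : ℤ) (a : ℤ × ℤ →₀ ℂ) (i j : ℤ) :
    biAct m a (i, j) = ((i : ℂ) - m) * a (i - m, j) + ((j : ℂ) - m) * a (i, j - m) := by
  induction a using Finsupp.induction_linear with
  | zero => simp
  | add a b ha hb => rw [map_add, Finsupp.add_apply, ha, hb, Finsupp.add_apply, Finsupp.add_apply]; ring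
  | single p c =>
    obtain ⟨k, l⟩ := p
    rw [biAct_single]
    simp only [Finsupp.smul_apply, Finsupp.add_apply, Finsupp.single_apply, smul_eq_mul,
      Prod.mk.injEq]
    have e1 : (k + m = i ∧ l = j) ↔ (k = i - m ∧ l = j) := by omega
    have e2 : (k = i ∧ l + m = j) ↔ (k = i ∧ l = j - m) := by omega
    rw [if_congr e1 rfl rfl, if_congr e2 rfl rfl]
    have h1 : (k : ℂ) * (if k = i - m ∧ l = j then 1 else 0) =
        ((i : ℂ) - m) * (if k = i - m ∧ l = j then 1 else 0) := by
      split_ifs with h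
      · rw [h.1]; push_cast; ring
      · simp
    have h2 : (l : ℂ) * (if k = i ∧ l = j - m then 1 else 0) =
        ((j : ℂ) - m) * (if k = i ∧ l = j - m then 1 else 0) := by
      split_ifs with h
      · rw [h.2]; push_cast; ring
      · simp
    rw [h1, h2]
    split_ifs <;> ring

/-- The coefficients are those of (t^(m+1) - u^(m+1)) / (t - u), formally the derivative of log(t -
u) along the field t^(m+1) d/dt acting in both variables. A formal coboundary satisfies the cocycle
identity; the proof checks it on coefficients. -/
theorem biAct_divDiffCoeff (m k : ℤ) :
    biAct m (divDiffCoeff k) - biAct k (divDiffCoeff m) =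
      ((k : ℂ) - m) • divDiffCoeff (m + k) := by
  ext ⟨i, j⟩
  rw [Finsupp.sub_apply, biAct_apply, biAct_apply, Finsupp.smul_apply, smul_eq_mul]
  simp only [divDiffCoeff_apply]
  by_cases h : i + j = m + k
  · rw [if_pos (show i - m + j = k by omega), if_pos (show i + (j - m) = k by omega),
      if_pos (show i - k + j = m by omega), if_pos (show i + (j - k) = m by omega), if_pos h]
    have hj : j = m + k - i := by omega
    subst hj
    push_cast
    have hm : ((if 0 ≤ i - m then 1 else 0 : ℂ)) = 1 - if i - m < 0 then 1 else 0 := by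
      by_cases hc : i - m < 0
      · rw [if_neg (by omega), if_pos hc]; ring
      · rw [if_pos (by omega), if_neg hc]; ring
    have hk : ((if 0 ≤ i - k then 1 else 0 : ℂ)) = 1 - if i - k < 0 then 1 else 0 := by
      by_cases hc : i - k < 0
      · rw [if_neg (by omega), if_pos hc]; ring
      · rw [if_pos (by omega), if_neg hc]; ring
    -- The two indicators differ only at i = m, where the factor i - m vanishes.
    have hm' : ((i : ℂ) - m) * (if m + k - i - k < 0 then 1 else 0) =
        ((i : ℂ) - m) * (1 - if i - m < 0 then 1 else 0) := by
      rcases lt_trichotomy i m with hc | rfl | hc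
      · rw [if_neg (by omega), if_pos (by omega)]; ring
      · simp
      · rw [if_pos (by omega), if_neg (by omega)]; ring
    have hk' : ((i : ℂ) - k) * (if m + k - i - m < 0 then 1 else 0) =
        ((i : ℂ) - k) * (1 - if i - k < 0 then 1 else 0) := by
      rcases lt_trichotomy i k with hc | rfl | hc
      · rw [if_neg (by omega), if_pos (by omega)]; ring
      · simp
      · rw [if_pos (by omega), if_neg (by omega)]; ring
    rw [hm, hk]
    linear_combination hk' - hm'
  · rw [if_neg (show ¬i - m + j = k by omega), if_neg (show ¬i + (j - m) = k by omega),
      if_neg (show ¬i - k + j = m by omega), if_neg (show ¬i + (j - k) = m by omega), if_neg h]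
    ring

/-- The divided difference satisfies D_{m+1} = u D_m + t^(m+1). With D_{-1} = 0 this recursion
determines the cocycle. -/
theorem divDiffCoeff_succ (m : ℤ) : divDiffCoeff (m + 1) =
    Finsupp.mapDomain (fun p => (p.1, p.2 + 1)) (divDiffCoeff m) + Finsupp.single (m + 1, 0) 1 := by
  ext ⟨i, j⟩
  have hinj : Function.Injective (fun p : ℤ × ℤ => (p.1, p.2 + 1)) := by
    rintro ⟨a, b⟩ ⟨c, d⟩ h
    simpa using h
  have h := Finsupp.mapDomain_apply hinj (divDiffCoeff m) (i, j - 1)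
  simp only [sub_add_cancel] at h
  rw [Finsupp.add_apply, h, Finsupp.single_apply, divDiffCoeff_apply, divDiffCoeff_apply]
  simp only [Prod.mk.injEq]
  by_cases hm : i + j = m + 1
  · rw [if_pos hm, if_pos (show i + (j - 1) = m by omega)]
    rcases lt_trichotomy j 0 with hc | rfl | hc
    · rw [if_pos hc, if_pos (by omega : j - 1 < 0), if_neg (by omega : ¬(m + 1 = i ∧ 0 = j))]; ring
    · rw [if_neg (lt_irrefl (0 : ℤ)), if_pos (by omega : (0 : ℤ) - 1 < 0),
        if_pos (by omega : (m + 1 = i ∧ (0 : ℤ) = 0))]; ring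
    · rw [if_neg (by omega : ¬ j < 0), if_neg (by omega : ¬ j - 1 < 0),
        if_neg (by omega : ¬(m + 1 = i ∧ 0 = j))]; ring
  · rw [if_neg hm, if_neg (show ¬i + (j - 1) = m by omega),
      if_neg (show ¬(m + 1 = i ∧ 0 = j) by omega)]; ring

theorem divDiffCoeff_neg_one : divDiffCoeff (-1) = 0 := by
  ext ⟨i, j⟩
  rw [divDiffCoeff_apply, Finsupp.zero_apply]
  split_ifs <;> first | omega | simp

/-- Polynomial functions of a pair of functionals on `ℂ[t, t⁻¹]`. -/
abbrev Fock : Type := MvPolynomial (ℤ ⊕ ℤ) ℂ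

namespace Fock

/-- The coordinates. -/
noncomputable def x (i : ℤ ⊕ ℤ) : Fock := (MvPolynomial.X i : MvPolynomial (ℤ ⊕ ℤ) ℂ)

/-- The derivation by which `t ^ (m + 1) d / dt` acts. -/
noncomputable def der (m : ℤ) : Derivation ℂ Fock Fock :=
  (MvPolynomial.mkDerivation (R := ℂ) (A := MvPolynomial (ℤ ⊕ ℤ) ℂ)
    (Sum.elim (fun i => (i : ℂ) • MvPolynomial.X (Sum.inl (i + m)))
      (fun i => (i : ℂ) • MvPolynomial.X (Sum.inr (i + m)))) :
    Derivation ℂ (MvPolynomial (ℤ ⊕ ℤ) ℂ) (MvPolynomial (ℤ ⊕ ℤ) ℂ))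

theorem der_inl (m i : ℤ) : der m (x (Sum.inl i)) = (i : ℂ) • x (Sum.inl (i + m)) :=
  MvPolynomial.mkDerivation_X ℂ _ _

theorem der_inr (m i : ℤ) : der m (x (Sum.inr i)) = (i : ℂ) • x (Sum.inr (i + m)) :=
  MvPolynomial.mkDerivation_X ℂ _ _

theorem induction_on {P : Fock → Prop} (φ : Fock) (hC : ∀ a : ℂ, P (algebraMap ℂ Fock a))
    (hadd : ∀ p q, P p → P q → P (p + q)) (hX : ∀ p i, P p → P (p * x i)) : P φ :=
  MvPolynomial.induction_on (motive := P) φ hC hadd hX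

theorem der_der (m k : ℤ) (φ : Fock) :
    der m (der k φ) - der k (der m φ) = ((k : ℂ) - m) • der (m + k) φ := by
  induction φ using induction_on with
  | hC a => simp
  | hadd p q hp hq =>
    simp only [map_add, smul_add]
    rw [← hp, ← hq]; ring
  | hX p i hp =>
    have hx : der m (der k (x i)) - der k (der m (x i)) = ((k : ℂ) - m) • der (m + k) (x i) := by
      rcases i with i | i
      · rw [der_inl, der_inl, der_inl, Derivation.map_smul, Derivation.map_smul, der_inl, der_inl, smul_smul, smul_smul,
          smul_smul, add_assoc, add_assoc, add_comm k m, ← sub_smul]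
        congr 1
        push_cast
        ring
      · rw [der_inr, der_inr, der_inr, Derivation.map_smul, Derivation.map_smul, der_inr, der_inr, smul_smul, smul_smul,
          smul_smul, add_assoc, add_assoc, add_comm k m, ← sub_smul]
        congr 1
        push_cast
        ring
    simp only [Derivation.leibniz, map_add, smul_eq_mul, smul_add]
    rw [← mul_smul_comm, ← mul_smul_comm, ← hx, ← hp]
    ring

/-- The linear embedding of functions of two variables, `t ^ i u ^ j ↦ x i * y j`. -/
noncomputable def quad : (ℤ × ℤ →₀ ℂ) →ₗ[ℂ] Fock :=
  Finsupp.lsum ℂ fun p => LinearMap.toSpanSingleton ℂ _ (x (Sum.inl p.1) * x (Sum.inr p.2))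

theorem quad_single (i j : ℤ) (a : ℂ) :
    quad (Finsupp.single (i, j) a) = a • (x (Sum.inl i) * x (Sum.inr j)) := by
  rw [quad, Finsupp.lsum_single, LinearMap.toSpanSingleton_apply]

theorem der_quad (m : ℤ) (a : ℤ × ℤ →₀ ℂ) : der m (quad a) = quad (biAct m a) := by
  induction a using Finsupp.induction_linear with
  | zero => simp
  | add a b ha hb => simp only [map_add, ha, hb]
  | single p c =>
    obtain ⟨i, j⟩ := p
    rw [quad_single, biAct_single, Derivation.map_smul, map_smul, map_add, map_smul, map_smul, quad_single,
      quad_single, Derivation.leibniz, der_inl, der_inr]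
    simp only [smul_eq_mul, one_smul, mul_smul_comm]
    rw [add_comm, mul_comm (x (Sum.inr j))]

/-- The action of `t ^ (m + 1) d / dt`, twisted by a cocycle. -/
noncomputable def rhoT (m : ℤ) : Module.End ℂ Fock :=
  (der m : Fock →ₗ[ℂ] Fock) + LinearMap.mulLeft ℂ (quad (divDiffCoeff m))

theorem rhoT_apply (m : ℤ) (φ : Fock) : rhoT m φ = der m φ + quad (divDiffCoeff m) * φ := rfl

theorem rhoT_comm (m k : ℤ) :
    rhoT m * rhoT k - rhoT k * rhoT m = ((k : ℂ) - m) • rhoT (m + k) := by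
  refine LinearMap.ext fun φ => ?_
  have h1 := der_der m k φ
  have h2 := congrArg quad (biAct_divDiffCoeff m k)
  rw [map_sub, map_smul, ← der_quad, ← der_quad] at h2
  simp only [LinearMap.sub_apply, LinearMap.smul_apply, Module.End.mul_apply, rhoT_apply, map_add,
    Derivation.leibniz, smul_eq_mul, smul_add]
  rw [← h1, ← smul_mul_assoc, ← h2]
  ring

/-- The twisted action of the Witt algebra. -/
noncomputable def rho : Vir →ₗ⁅ℂ⁆ Module.End ℂ Fock where
  toLinearMap := ofT rhoT ∘ₗ θ
  map_lie' {v w} := by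
    change ofT rhoT (wittBracket (θ v) (θ w)) = _
    rw [LieRing.of_associative_ring_bracket]
    change _ = ofT rhoT (θ v) * ofT rhoT (θ w) - ofT rhoT (θ w) * ofT rhoT (θ v)
    generalize θ v = g
    generalize θ w = h
    induction g using LaurentPolynomial.induction_on' with
    | add p q hp hq =>
      rw [wittBracket_add_left]
      simp only [map_add, hp, hq]
      noncomm_ring
    | C_mul_T m a =>
      induction h using LaurentPolynomial.induction_on' with
      | add p q hp hq =>
        rw [wittBracket_add_right]
        simp only [map_add, hp, hq]
        noncomm_ring
      | C_mul_T k b =>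
        rw [wittBracket_single]
        simp only [← LaurentPolynomial.smul_eq_C_mul, map_smul, ofT_T, smul_mul_smul_comm]
        rw [mul_comm b a, mul_comm _ (a * b), mul_smul, ← rhoT_comm]
        exact smul_sub _ _ _

noncomputable instance : LieRingModule Vir Fock := LieRingModule.compLieHom Fock rho

noncomputable instance : LieModule ℂ Vir Fock := LieModule.compLieHom Fock rho

theorem lie_eq (v : Vir) (φ : Fock) : ⁅v, φ⁆ = ofT rhoT (θ v) φ := rfl

/-- Evaluation at a pair of functionals. -/
noncomputable def ev (χ₁ χ₂ : ℂ[T;T⁻¹] →ₗ[ℂ] ℂ) : Fock →ₐ[ℂ] ℂ :=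
  MvPolynomial.aeval (Sum.elim (fun i => χ₁ (LaurentPolynomial.T i))
    (fun i => χ₂ (LaurentPolynomial.T i)))

section Ev

variable (χ₁ χ₂ : ℂ[T;T⁻¹] →ₗ[ℂ] ℂ)

theorem ev_inl (i : ℤ) : ev χ₁ χ₂ (x (Sum.inl i)) = χ₁ (LaurentPolynomial.T i) :=
  MvPolynomial.aeval_X _ _

theorem ev_inr (i : ℤ) : ev χ₁ χ₂ (x (Sum.inr i)) = χ₂ (LaurentPolynomial.T i) :=
  MvPolynomial.aeval_X _ _

/-- The value of the cocycle at a pair of functionals. -/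
noncomputable def evCocycle : ℂ[T;T⁻¹] →ₗ[ℂ] ℂ :=
  ofT fun m => ev χ₁ χ₂ (quad (divDiffCoeff m))

theorem ev_ofT_rhoT_inl (g : ℂ[T;T⁻¹]) (i : ℤ) : ev χ₁ χ₂ (ofT rhoT g (x (Sum.inl i))) =
    i * χ₁ (g * LaurentPolynomial.T i) + evCocycle χ₁ χ₂ g * χ₁ (LaurentPolynomial.T i) := by
  have h : (ev χ₁ χ₂).toLinearMap ∘ₗ LinearMap.applyₗ (x (Sum.inl i)) ∘ₗ ofT rhoT =
      (i : ℂ) • (χ₁ ∘ₗ LinearMap.mulRight ℂ (LaurentPolynomial.T i)) +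
        χ₁ (LaurentPolynomial.T i) • evCocycle χ₁ χ₂ := by
    refine ext_T fun m => ?_
    change ev χ₁ χ₂ (ofT rhoT (LaurentPolynomial.T m) (x (Sum.inl i))) =
      (i : ℂ) * χ₁ (LaurentPolynomial.T m * LaurentPolynomial.T i) +
        χ₁ (LaurentPolynomial.T i) * evCocycle χ₁ χ₂ (LaurentPolynomial.T m)
    rw [ofT_T, evCocycle, ofT_T, rhoT_apply, der_inl, map_add, map_smul, map_mul, ev_inl, ev_inl,
      smul_eq_mul, ← LaurentPolynomial.T_add, add_comm i, mul_comm (ev χ₁ χ₂ (quad _))]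
  have h2 := congrArg (fun φ => φ g) h
  refine h2.trans ?_
  change (i : ℂ) * χ₁ (g * LaurentPolynomial.T i) +
        χ₁ (LaurentPolynomial.T i) * evCocycle χ₁ χ₂ g = _
  ring

theorem ev_ofT_rhoT_inr (g : ℂ[T;T⁻¹]) (i : ℤ) : ev χ₁ χ₂ (ofT rhoT g (x (Sum.inr i))) =
    i * χ₂ (g * LaurentPolynomial.T i) + evCocycle χ₁ χ₂ g * χ₂ (LaurentPolynomial.T i) := by
  have h : (ev χ₁ χ₂).toLinearMap ∘ₗ LinearMap.applyₗ (x (Sum.inr i)) ∘ₗ ofT rhoT =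
      (i : ℂ) • (χ₂ ∘ₗ LinearMap.mulRight ℂ (LaurentPolynomial.T i)) +
        χ₂ (LaurentPolynomial.T i) • evCocycle χ₁ χ₂ := by
    refine ext_T fun m => ?_
    change ev χ₁ χ₂ (ofT rhoT (LaurentPolynomial.T m) (x (Sum.inr i))) =
      (i : ℂ) * χ₂ (LaurentPolynomial.T m * LaurentPolynomial.T i) +
        χ₂ (LaurentPolynomial.T i) * evCocycle χ₁ χ₂ (LaurentPolynomial.T m)
    rw [ofT_T, evCocycle, ofT_T, rhoT_apply, der_inr, map_add, map_smul, map_mul, ev_inr, ev_inr,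
      smul_eq_mul, ← LaurentPolynomial.T_add, add_comm i, mul_comm (ev χ₁ χ₂ (quad _))]
  have h2 := congrArg (fun φ => φ g) h
  refine h2.trans ?_
  change (i : ℂ) * χ₂ (g * LaurentPolynomial.T i) +
        χ₂ (LaurentPolynomial.T i) * evCocycle χ₁ χ₂ g = _
  ring

/-- Each operator is a derivation plus multiplication by its value at 1. -/
theorem ofT_rhoT_mul (g : ℂ[T;T⁻¹]) (φ ψ : Fock) :
    ofT rhoT g (φ * ψ) = φ * ofT rhoT g ψ + ψ * ofT rhoT g φ - φ * ψ * ofT rhoT g 1 := by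
  induction g using LaurentPolynomial.induction_on' with
  | add p q hp hq => simp only [map_add, LinearMap.add_apply, hp, hq]; ring
  | C_mul_T m a =>
    simp only [← LaurentPolynomial.smul_eq_C_mul, map_smul, LinearMap.smul_apply, ofT_T,
      rhoT_apply, Derivation.leibniz, Derivation.map_one_eq_zero, smul_eq_mul]
    simp only [Algebra.smul_def]
    ring

theorem ev_ofT_rhoT_one (g : ℂ[T;T⁻¹]) : ev χ₁ χ₂ (ofT rhoT g 1) = evCocycle χ₁ χ₂ g := by
  have h : (ev χ₁ χ₂).toLinearMap ∘ₗ LinearMap.applyₗ (1 : Fock) ∘ₗ ofT rhoT =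
      evCocycle χ₁ χ₂ := by
    refine ext_T fun m => ?_
    change ev χ₁ χ₂ (ofT rhoT (LaurentPolynomial.T m) 1) = _
    rw [ofT_T, evCocycle, ofT_T, rhoT_apply, Derivation.map_one_eq_zero, zero_add, mul_one]
  exact congrArg (fun φ => φ g) h

/-- If both functionals kill the multiples of g, the derivation part vanishes at the point (χ₁, χ₂)
and only multiplication by the cocycle survives. -/
theorem ev_ofT_rhoT {g : ℂ[T;T⁻¹]} (h₁ : ∀ i, χ₁ (g * LaurentPolynomial.T i) = 0)
    (h₂ : ∀ i, χ₂ (g * LaurentPolynomial.T i) = 0) (φ : Fock) :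
    ev χ₁ χ₂ (ofT rhoT g φ) = evCocycle χ₁ χ₂ g * ev χ₁ χ₂ φ := by
  induction φ using induction_on with
  | hC a =>
    rw [Algebra.algebraMap_eq_smul_one, map_smul, map_smul, map_smul, ev_ofT_rhoT_one, map_one]
    simp only [smul_eq_mul]
    ring
  | hadd p q hp hq => simp only [map_add, hp, hq]; ring
  | hX p i hp =>
    have hx : ev χ₁ χ₂ (ofT rhoT g (x i)) = evCocycle χ₁ χ₂ g * ev χ₁ χ₂ (x i) := by
      rcases i with i | i
      · rw [ev_ofT_rhoT_inl, h₁, mul_zero, zero_add, ev_inl]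
      · rw [ev_ofT_rhoT_inr, h₂, mul_zero, zero_add, ev_inr]
    rw [ofT_rhoT_mul]
    simp only [map_add, map_sub, map_mul, hp, hx, ev_ofT_rhoT_one]
    ring

end Ev

end Fock

end Vir

/-! ### The top coefficient functional modulo f and the cocycle on multiples of f -/

namespace Vir

theorem toLaurent_dvd_toLaurent {f p : ℂ[X]} (h0 : f.coeff 0 ≠ 0) :
    toLaurent f ∣ toLaurent p ↔ f ∣ p := by
  refine ⟨?_, fun h => map_dvd _ h⟩
  rintro ⟨g, hg⟩
  obtain ⟨n, q, hq⟩ := LaurentPolynomial.exists_T_pow g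
  have h : p * X ^ n = f * q := by
    apply toLaurent_injective
    rw [map_mul, map_mul, hq, hg, toLaurent_X_pow, mul_assoc]
  have hc : IsCoprime f (X ^ n) := by
    refine IsCoprime.pow_right (IsCoprime.symm ?_)
    refine (Irreducible.coprime_iff_not_dvd irreducible_X).2 ?_
    rwa [X_dvd_iff]
  exact hc.dvd_of_dvd_mul_right ⟨q, h⟩

section TopCoeff

/-- `χ` is the coefficient of `t ^ (deg f - 1)` on `ℂ[t, t⁻¹] / (f)`. -/
structure IsTopCoeff (f : ℂ[X]) (χ : ℂ[T;T⁻¹] →ₗ[ℂ] ℂ) : Prop where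
  mul_eq_zero : ∀ g, χ (toLaurent f * g) = 0
  T_eq_zero : ∀ l : ℕ, l + 1 < f.natDegree → χ (LaurentPolynomial.T l) = 0
  T_eq_one : ∀ l : ℕ, l + 1 = f.natDegree → χ (LaurentPolynomial.T l) = 1

/-- Modulo f, t^(deg f - 1) is not congruent to a polynomial of smaller degree, so some linear form
separates it from these and from the ideal. -/
theorem exists_isTopCoeff {f : ℂ[X]} (h0 : f.coeff 0 ≠ 0) :
    ∃ χ, IsTopCoeff f χ := by
  rcases Nat.eq_zero_or_pos f.natDegree with hN | hN
  -- For constant f the ideal is everything, χ is zero and the normalisation is vacuous.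
  · exact ⟨0, fun _ => rfl, fun _ _ => rfl, fun l hl => by omega⟩
  obtain ⟨N, hN'⟩ : ∃ N, f.natDegree = N + 1 := ⟨f.natDegree - 1, by omega⟩
  have hnot : (LaurentPolynomial.T N : ℂ[T;T⁻¹]) ∉
      (Ideal.span {toLaurent f}).restrictScalars ℂ ⊔
        (degreeLT ℂ N).map (toLaurentAlg : ℂ[X] →ₐ[ℂ] ℂ[T;T⁻¹]).toLinearMap := by
    intro h
    obtain ⟨a, ha, b, ⟨q, hq, rfl⟩, hab⟩ := Submodule.mem_sup.1 h
    rw [SetLike.mem_coe, mem_degreeLT] at hq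
    have hd : f ∣ X ^ N - q := by
      rw [← toLaurent_dvd_toLaurent h0, map_sub, toLaurent_X_pow, ← hab]
      change _ ∣ a + toLaurent q - toLaurent q
      rw [add_sub_cancel_right]
      exact Ideal.mem_span_singleton.1 ha
    have hdeg : (X ^ N - q).degree = (N : WithBot ℕ) := by
      rw [degree_sub_eq_left_of_degree_lt (by rwa [degree_X_pow]), degree_X_pow]
    have hne : X ^ N - q ≠ 0 := by
      intro h
      rw [h, degree_zero] at hdeg
      exact absurd hdeg (by simp)
    have := natDegree_le_of_dvd hd hne
    rw [natDegree_eq_of_degree_eq_some hdeg] at this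
    omega
  obtain ⟨χ, hχ, hle⟩ := Submodule.exists_le_ker_of_notMem hnot
  have hker : ∀ g, g ∈ (Ideal.span {toLaurent f}).restrictScalars ℂ ⊔
      (degreeLT ℂ N).map (toLaurentAlg : ℂ[X] →ₐ[ℂ] ℂ[T;T⁻¹]).toLinearMap → χ g = 0 :=
    fun g hg => LinearMap.mem_ker.1 (hle hg)
  refine ⟨(χ (LaurentPolynomial.T N))⁻¹ • χ, fun g => ?_, fun l hl => ?_, fun l hl => ?_⟩
  · rw [LinearMap.smul_apply, hker (toLaurent f * g) (Submodule.mem_sup_left ?_), smul_zero]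
    exact Ideal.mul_mem_right _ _ (Ideal.subset_span (Set.mem_singleton _))
  · rw [LinearMap.smul_apply, hker (LaurentPolynomial.T l) (Submodule.mem_sup_right ?_), smul_zero]
    refine ⟨X ^ l, ?_, toLaurent_X_pow l⟩
    rw [SetLike.mem_coe, mem_degreeLT, degree_X_pow]
    exact_mod_cast (by omega : l < N)
  · obtain rfl : l = N := by omega
    rw [LinearMap.smul_apply, smul_eq_mul, inv_mul_cancel₀ hχ]

open Fock

theorem evCocycle_T_mul (χ₁ χ₂ : ℂ[T;T⁻¹] →ₗ[ℂ] ℂ) (g : ℂ[T;T⁻¹]) :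
    evCocycle χ₁ χ₂ (LaurentPolynomial.T 1 * g) =
      evCocycle χ₁ (χ₂ ∘ₗ LinearMap.mulLeft ℂ (LaurentPolynomial.T 1)) g +
        χ₁ (LaurentPolynomial.T 1 * g) * χ₂ 1 := by
  have hq : ∀ a : ℤ × ℤ →₀ ℂ, ev χ₁ χ₂ (quad (Finsupp.mapDomain (fun p => (p.1, p.2 + 1)) a)) =
      ev χ₁ (χ₂ ∘ₗ LinearMap.mulLeft ℂ (LaurentPolynomial.T 1)) (quad a) := by
    intro a
    induction a using Finsupp.induction_linear with
    | zero => simp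
    | add a b ha hb => simp only [Finsupp.mapDomain_add, map_add, ha, hb]
    | single p c =>
      obtain ⟨i, j⟩ := p
      rw [Finsupp.mapDomain_single, quad_single, quad_single, map_smul, map_smul, map_mul, map_mul,
        ev_inl, ev_inr, ev_inl, ev_inr, LinearMap.comp_apply, LinearMap.mulLeft_apply,
        ← LaurentPolynomial.T_add, add_comm 1 j]
  induction g using LaurentPolynomial.induction_on' with
  | add p q hp hq => simp only [mul_add, map_add, hp, hq]; ring
  | C_mul_T m a =>
    rw [← LaurentPolynomial.smul_eq_C_mul, mul_smul_comm, map_smul, map_smul, map_smul,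
      ← LaurentPolynomial.T_add, evCocycle, evCocycle, ofT_T, ofT_T, add_comm 1 m,
      divDiffCoeff_succ, map_add, map_add, hq, quad_single, map_smul, map_mul, ev_inl, ev_inr,
      LaurentPolynomial.T_zero]
    simp only [smul_eq_mul]
    ring

theorem evCocycle_T_neg_one (χ₁ χ₂ : ℂ[T;T⁻¹] →ₗ[ℂ] ℂ) :
    evCocycle χ₁ χ₂ (LaurentPolynomial.T (-1)) = 0 := by
  rw [evCocycle, ofT_T, divDiffCoeff_neg_one, map_zero, map_zero]

variable {f : ℂ[X]} {χ₁ : ℂ[T;T⁻¹] →ₗ[ℂ] ℂ}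

theorem IsTopCoeff.evCocycle_T_of_lt (h : IsTopCoeff f χ₁) (l : ℕ) (hl : l < f.natDegree)
    (χ₂ : ℂ[T;T⁻¹] →ₗ[ℂ] ℂ) : evCocycle χ₁ χ₂ (LaurentPolynomial.T (l - 1)) = 0 := by
  induction l generalizing χ₂ with
  | zero => simpa using evCocycle_T_neg_one χ₁ χ₂
  | succ l ih =>
    have e : (LaurentPolynomial.T ((l + 1 : ℕ) - 1 : ℤ) : ℂ[T;T⁻¹]) =
        LaurentPolynomial.T 1 * LaurentPolynomial.T (l - 1) := by
      rw [← LaurentPolynomial.T_add]; congr 1; push_cast; ring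
    rw [e, evCocycle_T_mul, ih (by omega), ← e, zero_add, Nat.cast_add, Nat.cast_one,
      add_sub_cancel_right, h.T_eq_zero l hl, zero_mul]

theorem IsTopCoeff.evCocycle_T_natDegree (h : IsTopCoeff f χ₁) (hd : 0 < f.natDegree)
    (χ₂ : ℂ[T;T⁻¹] →ₗ[ℂ] ℂ) : evCocycle χ₁ χ₂ (LaurentPolynomial.T (f.natDegree - 1)) = χ₂ 1 := by
  obtain ⟨l, hl⟩ : ∃ l, f.natDegree = l + 1 := ⟨f.natDegree - 1, by omega⟩
  have e : (LaurentPolynomial.T (f.natDegree - 1 : ℤ) : ℂ[T;T⁻¹]) =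
      LaurentPolynomial.T 1 * LaurentPolynomial.T (l - 1) := by
    rw [← LaurentPolynomial.T_add, hl]; congr 1; push_cast; ring
  rw [e, evCocycle_T_mul, h.evCocycle_T_of_lt l (by omega), ← e, zero_add, hl, Nat.cast_add,
    Nat.cast_one, add_sub_cancel_right, h.T_eq_one l hl.symm, one_mul]

/-- As χ₁ kills multiples of f, multiplying the argument by t only precomposes χ₂ with
multiplication by t. This reduces the claim to f t⁻¹, where the recursion leaves only the leading
coefficient of f. -/
theorem IsTopCoeff.evCocycle_mul (h : IsTopCoeff f χ₁) (hf : f.Monic) (hd : 0 < f.natDegree)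
    (χ₂ : ℂ[T;T⁻¹] →ₗ[ℂ] ℂ) (g : ℂ[T;T⁻¹]) :
    evCocycle χ₁ χ₂ (toLaurent f * g) = χ₂ (LaurentPolynomial.T 1 * g) := by
  have hshift : ∀ (χ₂ : ℂ[T;T⁻¹] →ₗ[ℂ] ℂ) (j : ℤ),
      evCocycle χ₁ χ₂ (toLaurent f * LaurentPolynomial.T (j + 1)) =
        evCocycle χ₁ (χ₂ ∘ₗ LinearMap.mulLeft ℂ (LaurentPolynomial.T 1))
          (toLaurent f * LaurentPolynomial.T j) := by
    intro χ₂ j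
    have e : toLaurent f * LaurentPolynomial.T (j + 1) =
        LaurentPolynomial.T 1 * (toLaurent f * LaurentPolynomial.T j) := by
      rw [LaurentPolynomial.T_add]; ring
    rw [e, evCocycle_T_mul, ← e, h.mul_eq_zero, zero_mul, add_zero]
  have hbase : ∀ χ₂ : ℂ[T;T⁻¹] →ₗ[ℂ] ℂ,
      evCocycle χ₁ χ₂ (toLaurent f * LaurentPolynomial.T (-1)) = χ₂ 1 := by
    intro χ₂
    have e : toLaurent f * LaurentPolynomial.T (-1) =
        ∑ l ∈ Finset.range (f.natDegree + 1), f.coeff l • LaurentPolynomial.T ((l : ℤ) - 1) := by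
      conv_lhs => rw [f.as_sum_range_C_mul_X_pow]
      rw [map_sum, Finset.sum_mul]
      refine Finset.sum_congr rfl fun l _ => ?_
      rw [toLaurent_C_mul_X_pow, mul_assoc, ← LaurentPolynomial.T_add,
        LaurentPolynomial.smul_eq_C_mul, sub_eq_add_neg]
    rw [e, map_sum, Finset.sum_range_succ, Finset.sum_eq_zero, zero_add, map_smul,
      h.evCocycle_T_natDegree hd, hf.coeff_natDegree, one_smul]
    intro l hl
    rw [map_smul, h.evCocycle_T_of_lt l (Finset.mem_range.1 hl), smul_zero]
  have key : ∀ (j : ℤ) (χ₂ : ℂ[T;T⁻¹] →ₗ[ℂ] ℂ),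
      evCocycle χ₁ χ₂ (toLaurent f * LaurentPolynomial.T (j - 1)) =
        χ₂ (LaurentPolynomial.T j) := by
    intro j
    induction j using Int.induction_on with
    | zero => intro χ₂; rw [zero_sub, hbase, LaurentPolynomial.T_zero]
    | succ j ih =>
      intro χ₂
      rw [show (j : ℤ) + 1 - 1 = (j - 1) + 1 by ring, hshift, ih, LinearMap.comp_apply,
        LinearMap.mulLeft_apply, ← LaurentPolynomial.T_add, add_comm 1]
    | pred j ih =>
      intro χ₂
      -- To descend, the shift is used for χ₂ precomposed with multiplication by t⁻¹.
      have h1 := hshift (χ₂ ∘ₗ LinearMap.mulLeft ℂ (LaurentPolynomial.T (-1))) (-(j : ℤ) - 1 - 1)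
      rw [sub_add_cancel, ih, LinearMap.comp_apply, LinearMap.mulLeft_apply,
        ← LaurentPolynomial.T_add] at h1
      rw [show (-(j : ℤ) - 1) = -1 + -(j : ℤ) by ring] at h1 ⊢
      rw [h1]
      suffices e : (χ₂ ∘ₗ LinearMap.mulLeft ℂ (LaurentPolynomial.T (-1))) ∘ₗ
          LinearMap.mulLeft ℂ (LaurentPolynomial.T 1) = χ₂ by rw [e]
      refine LinearMap.ext fun g => ?_
      change χ₂ (LaurentPolynomial.T (-1) * (LaurentPolynomial.T 1 * g)) = χ₂ g
      rw [← mul_assoc, ← LaurentPolynomial.T_add, neg_add_cancel, LaurentPolynomial.T_zero, one_mul]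
  have hl : evCocycle χ₁ χ₂ ∘ₗ LinearMap.mulLeft ℂ (toLaurent f) =
      χ₂ ∘ₗ LinearMap.mulLeft ℂ (LaurentPolynomial.T 1) := by
    refine ext_T fun m => ?_
    simp only [LinearMap.comp_apply, LinearMap.mulLeft_apply]
    rw [← LaurentPolynomial.T_add, ← key, add_sub_cancel_left]
  exact congrArg (fun φ => φ g) hl

end TopCoeff

/-! ### Realising the induced module by evaluation functionals -/

section Model

open Fock

variable {f : ℂ[X]} {χ : ℂ[T;T⁻¹] →ₗ[ℂ] ℂ}

/-- The second functional of the pair attached to a character `μ`. -/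
noncomputable def twist (μ : poly f →ₗ⁅ℂ⁆ ℂ) : ℂ[T;T⁻¹] →ₗ[ℂ] ℂ :=
  -(onMul μ ∘ₗ LinearMap.mulLeft ℂ (LaurentPolynomial.T (-1)))

theorem twist_apply (μ : poly f →ₗ⁅ℂ⁆ ℂ) (g : ℂ[T;T⁻¹]) :
    twist μ g = -onMul μ (LaurentPolynomial.T (-1) * g) := rfl

theorem IsTopCoeff.evCocycle_twist (h : IsTopCoeff f χ) (hf : f.Monic) (h0 : f.coeff 0 ≠ 0)
    (μ : poly f →ₗ⁅ℂ⁆ ℂ) (g : ℂ[T;T⁻¹]) :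
    evCocycle χ (twist μ) (toLaurent f * g) = -onMul μ g := by
  rcases Nat.eq_zero_or_pos f.natDegree with hd | hd
  -- For f = 1 both functionals are zero, and `evCocycle_mul`, which needs positive degree, does not
  -- apply.
  · obtain rfl := eq_one_of_monic_natDegree_zero hf hd
    have h1 : ∀ g, onMul μ g = 0 := fun g => by
      have := onMul_self_mul (μ := μ) h0 g
      rwa [map_one, one_mul] at this
    have h2 : twist μ = 0 := LinearMap.ext fun g => by
      rw [twist_apply, h1, neg_zero, LinearMap.zero_apply]
    have h3 : χ = 0 := LinearMap.ext fun g => by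
      have := h.mul_eq_zero g
      rwa [map_one, one_mul] at this
    have h4 : ∀ g, evCocycle χ (twist μ) g = 0 := by
      intro g
      have : evCocycle χ (twist μ) = 0 := by
        refine ext_T fun m => ?_
        rw [evCocycle, ofT_T, LinearMap.zero_apply]
        generalize divDiffCoeff m = a
        induction a using Finsupp.induction_linear with
        | zero => simp
        | add a b ha hb => rw [map_add, map_add, ha, hb, add_zero]
        | single p c =>
          obtain ⟨i, j⟩ := p
          rw [quad_single, map_smul, map_mul, ev_inl, h3, LinearMap.zero_apply, zero_mul, smul_zero]
      rw [this, LinearMap.zero_apply]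
    rw [h1, h4, neg_zero]
  · rw [h.evCocycle_mul hf hd, twist_apply, ← mul_assoc, ← LaurentPolynomial.T_add, neg_add_cancel, LaurentPolynomial.T_zero, one_mul]

/-- The sign in `twist` compensates the sign in the dual action, so evaluation at (χ, `twist μ`) has
eigenvalue μ. Both functionals kill multiples of f, the second because μ kills multiples of f². -/
theorem IsTopCoeff.exists_hom (h : IsTopCoeff f χ) (hf : f.Monic) (h0 : f.coeff 0 ≠ 0)
    (μ : poly f →ₗ⁅ℂ⁆ ℂ) :
    ∃ φ : V f μ →ₗ⁅ℂ, Vir⁆ (Fock →ₗ[ℂ] ℂ),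
      φ (InducedModule.gen _ _) = (ev χ (twist μ)).toLinearMap := by
  refine InducedModule.exists_hom _ fun x => LinearMap.ext fun φ => ?_
  obtain ⟨g, hg⟩ := mem_poly_iff_dvd.1 x.2
  rw [Module.Dual.lie_apply, lie_eq]
  change -ev χ (twist μ) _ = μ x * ev χ (twist μ) φ
  rw [hg, ev_ofT_rhoT, h.evCocycle_twist hf h0, apply_eq_onMul h0 x g x.2 hg]
  · ring
  · intro i; rw [mul_assoc, h.mul_eq_zero]
  · intro i
    rw [twist_apply, mul_assoc, mul_left_comm, onMul_self_mul h0, neg_zero]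

/-- The image of the generator is an evaluation, which takes the value 1 at the constant function 1.
-/
theorem gen_ne_zero (hf : f.Monic) (h0 : f.coeff 0 ≠ 0) (μ : poly f →ₗ⁅ℂ⁆ ℂ) :
    InducedModule.gen (poly f) μ ≠ 0 := by
  obtain ⟨χ, h⟩ := exists_isTopCoeff h0
  obtain ⟨φ, hφ⟩ := h.exists_hom hf h0 μ
  intro h1
  rw [h1, map_zero] at hφ
  have h2 : (0 : ℂ) = ev χ (twist μ) 1 := congrArg (fun ψ : Fock →ₗ[ℂ] ℂ => ψ 1) hφ
  rw [map_one] at h2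
  exact zero_ne_one h2

/-- At a simple root of `f`, the vector `f / (t - lam)` applied to the generator of `V f μ` is not a
multiple of the generator. -/
theorem lie_gen_ne_smul_of_simple_root {lam : ℂ} {f' : ℂ[X]} (hf' : f'.Monic)
    (h0 : f'.coeff 0 ≠ 0) (hlam : lam ≠ 0) (hroot : f'.eval lam ≠ 0)
    (μ : poly (f' * (X - C lam)) →ₗ⁅ℂ⁆ ℂ) (κ : ℂ) :
    ⁅lift (toLaurent f'), InducedModule.gen (poly (f' * (X - C lam))) μ⁆ ≠
      κ • InducedModule.gen _ μ := by
  have hfm : (f' * (X - C lam)).Monic := hf'.mul (monic_X_sub_C lam)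
  have hf0 : (f' * (X - C lam)).coeff 0 ≠ 0 := by
    rw [mul_coeff_zero]
    exact mul_ne_zero h0 (by simpa using hlam)
  obtain ⟨χ, h⟩ := exists_isTopCoeff hf0
  obtain ⟨φ, hφ⟩ := h.exists_hom hfm hf0 μ
  intro heq
  have hdeg : (f' * (X - C lam)).natDegree = f'.natDegree + 1 := by
    rw [hf'.natDegree_mul (monic_X_sub_C lam), natDegree_X_sub_C]
  have h1 := congrArg φ heq
  rw [LieModuleHom.map_lie, map_smul, hφ] at h1
  have hbase : χ (toLaurent f') = 1 := by
    have e : toLaurent f' = ∑ l ∈ Finset.range (f'.natDegree + 1),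
        f'.coeff l • LaurentPolynomial.T (l : ℤ) := by
      conv_lhs => rw [f'.as_sum_range_C_mul_X_pow]
      rw [map_sum]
      refine Finset.sum_congr rfl fun l _ => ?_
      rw [toLaurent_C_mul_X_pow, LaurentPolynomial.smul_eq_C_mul]
    rw [e, map_sum, Finset.sum_range_succ, Finset.sum_eq_zero, zero_add, map_smul,
      h.T_eq_one _ hdeg.symm, hf'.coeff_natDegree, one_smul]
    intro l hl
    rw [map_smul, h.T_eq_zero l (by rw [hdeg]; have := Finset.mem_range.1 hl; omega), smul_zero]
  -- χ kills f' (t - lam), so t acts on f' under χ as the scalar lam.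
  have hstep : ∀ j : ℤ, χ (toLaurent f' * LaurentPolynomial.T (j + 1)) =
      lam * χ (toLaurent f' * LaurentPolynomial.T j) := by
    intro j
    have h2 := h.mul_eq_zero (LaurentPolynomial.T j)
    rw [map_mul toLaurent, map_sub toLaurent, toLaurent_X, toLaurent_C, mul_sub, sub_mul, map_sub, sub_eq_zero,
      mul_assoc, ← LaurentPolynomial.T_add, add_comm 1 j] at h2
    rw [h2, mul_assoc, mul_left_comm, ← LaurentPolynomial.smul_eq_C_mul, map_smul, smul_eq_mul]
  have hpow : ∀ j : ℤ, χ (toLaurent f' * LaurentPolynomial.T j) = lam ^ j := by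
    intro j
    induction j using Int.induction_on with
    | zero => rw [LaurentPolynomial.T_zero, mul_one, hbase, zpow_zero]
    | succ j ih => rw [hstep, ih, zpow_add_one₀ hlam, mul_comm]
    | pred j ih =>
      have h2 := hstep (-(j : ℤ) - 1)
      rw [sub_add_cancel, ih] at h2
      rw [zpow_sub_one₀ hlam, h2]
      field_simp
  -- Both sides of the supposed equality are evaluated at the coordinates x_i of the first
  -- functional.
  obtain ⟨κ', hκ'⟩ : ∃ κ' : ℂ, ∀ i : ℤ, i * lam ^ i = κ' * χ (LaurentPolynomial.T i) := by
    refine ⟨-κ - evCocycle χ (twist μ) (toLaurent f'), fun i => ?_⟩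
    have h2 := congrArg (fun ψ : Fock →ₗ[ℂ] ℂ => ψ (x (Sum.inl i))) h1
    rw [Module.Dual.lie_apply, lie_eq] at h2
    change -ev χ (twist μ) _ = κ * ev χ (twist μ) _ at h2
    rw [ev_inl, ev_ofT_rhoT_inl, θ_lift, hpow] at h2
    linear_combination -h2
  have hall : ∀ g : ℂ[X], κ' * χ (toLaurent g) = lam * g.derivative.eval lam := by
    intro g
    induction g using Polynomial.induction_on' with
    | add p q hp hq => rw [map_add, map_add, mul_add, hp, hq, derivative_add, eval_add, mul_add]
    | monomial n a =>
      rw [← C_mul_X_pow_eq_monomial, toLaurent_C_mul_X_pow, ← LaurentPolynomial.smul_eq_C_mul,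
        map_smul, smul_eq_mul, mul_left_comm, ← hκ', derivative_C_mul_X_pow, eval_mul, eval_C,
        eval_pow, eval_X, zpow_natCast]
      rcases n with _ | n
      · simp
      · rw [Nat.add_sub_cancel, pow_succ]; push_cast; ring
  -- At g = f the left side is zero, while the derivative at lam is f'(lam) ≠ 0.
  have h3 := hall (f' * (X - C lam))
  have h4 := h.mul_eq_zero 1
  rw [mul_one] at h4
  rw [h4, mul_zero] at h3
  simp [hlam, hroot] at h3

end Model

end Vir

/-! ### Vector fields at a point acting on a module generated by an eigenvector -/

/-- Operators `g c`, `c ≥ 0`, with the commutation relations of `s ^ c d / ds`, and a vector `v` that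
is an eigenvector of `g c` for `c ≥ n` with eigenvalue `m c`, the last nonzero one at
`k ∈ {2 n - 2, 2 n - 1}`. -/
structure LocalModel {V : Type*} [AddCommGroup V] [Module ℂ V] (g : ℕ → Module.End ℂ V) (v : V)
    (m : ℕ → ℂ) (n k : ℕ) : Prop where
  comm : ∀ b a u, g b (g a u) = g a (g b u) + ((a : ℂ) - b) • g (a + b - 1) u
  eigen : ∀ c, n ≤ c → g c v = m c • v
  one_le : 1 ≤ n
  le_top : n ≤ k
  top_lower : 2 * n ≤ k + 2
  top_upper : k + 1 ≤ 2 * n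
  eq_zero : ∀ c, k < c → m c = 0
  top_ne_zero : m k ≠ 0

namespace LocalModel

variable {V : Type*} [AddCommGroup V] [Module ℂ V] 

/-- Products of the `g a` with `a < n`, applied to `v`, of weight `∑ (k - a)`. -/
inductive Mon (g : ℕ → Module.End ℂ V) (v : V) (n k : ℕ) : ℕ → V → Prop
  | one : Mon g v n k 0 v
  | step {w : ℕ} {u : V} (a : ℕ) (ha : a < n) (h : Mon g v n k w u) :
      Mon g v n k (w + (k - a)) (g a u)

/-- The span of the products of weight at most `d`. -/
def W (g : ℕ → Module.End ℂ V) (v : V) (n k : ℕ) (d : ℤ) : Submodule ℂ V :=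
  Submodule.span ℂ {u | ∃ w : ℕ, (w : ℤ) ≤ d ∧ Mon g v n k w u}

variable {g : ℕ → Module.End ℂ V} {v : V} {m : ℕ → ℂ} {n k : ℕ}

theorem Mon.mem_W {w : ℕ} {u : V} (h : Mon g v n k w u) {d : ℤ} (hd : (w : ℤ) ≤ d) :
    u ∈ W g v n k d := Submodule.subset_span ⟨w, hd, h⟩

theorem W_mono {d d' : ℤ} (h : d ≤ d') : W g v n k d ≤ W g v n k d' :=
  Submodule.span_mono fun _ ⟨w, hw, hu⟩ => ⟨w, hw.trans h, hu⟩

theorem mem_W_of_mon {φ : V →ₗ[ℂ] V} {d d' : ℤ}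
    (h : ∀ (w : ℕ) u, (w : ℤ) ≤ d → Mon g v n k w u → φ u ∈ W g v n k d') {u : V}
    (hu : u ∈ W g v n k d) : φ u ∈ W g v n k d' := by
  have : W g v n k d ≤ (W g v n k d').comap φ :=
    Submodule.span_le.2 fun u ⟨w, hw, hu⟩ => h w u hw hu
  exact this hu

theorem low_mem (H : LocalModel g v m n k) {a : ℕ} (ha : a < n) {d d' : ℤ} (hd : d + k - a ≤ d') {u : V}
    (hu : u ∈ W g v n k d) : g a u ∈ W g v n k d' :=
  mem_W_of_mon (fun w u hw hu => (hu.step a ha).mem_W (by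
    have := H.le_top
    push_cast [Nat.cast_sub (by omega : a ≤ k)]
    omega)) hu

/-- Moving g_c past a factor g_a leaves a multiple of g_{a+c-1}, whose weight k - a - c + 1 is that
of g_a changed by 1 - c. Both bounds follow together by induction on the product. -/
theorem mon_key (H : LocalModel g v m n k) {w : ℕ} {u : V} (hu : Mon g v n k w u) :
    (∀ c : ℕ, g c u ∈ W g v n k (w + k - c)) ∧
      ∀ c : ℕ, n ≤ c → g c u - m c • u ∈ W g v n k (w + 1 - c) := by
  have main : ∀ {w : ℕ} {u : V}, Mon g v n k w u →
      (∀ c : ℕ, n ≤ c → g c u - m c • u ∈ W g v n k (w + 1 - c)) →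
      ∀ c : ℕ, g c u ∈ W g v n k (w + k - c) := by
    intro w u hu h c
    rcases lt_or_ge c n with hc | hc
    · exact H.low_mem hc le_rfl (hu.mem_W le_rfl)
    · rw [← sub_add_cancel (g c u) (m c • u)]
      refine Submodule.add_mem _ (W_mono (by have := H.le_top; have := H.one_le; omega) (h c hc)) ?_
      rcases lt_or_ge k c with hk | hk
      · rw [H.eq_zero c hk, zero_smul]; exact Submodule.zero_mem _
      · exact Submodule.smul_mem _ _ (hu.mem_W (by omega))
  suffices h : ∀ c : ℕ, n ≤ c → g c u - m c • u ∈ W g v n k (w + 1 - c) from ⟨main hu h, h⟩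
  induction hu with
  | one => intro c hc; rw [H.eigen c hc, sub_self]; exact Submodule.zero_mem _
  | @step w u a ha hu ih =>
    intro c hc
    have h1 := H.one_le
    have h2 := H.le_top
    have e : g c (g a u) - m c • g a u =
        g a (g c u - m c • u) + ((a : ℂ) - c) • g (a + c - 1) u := by
      rw [H.comm, map_sub, map_smul]; abel
    rw [e, Nat.cast_add, Nat.cast_sub (by omega : a ≤ k)]
    refine Submodule.add_mem _ (H.low_mem ha (by omega) (ih c hc)) (Submodule.smul_mem _ _ ?_)
    refine W_mono ?_ (main hu ih (a + c - 1))
    rw [Nat.cast_sub (by omega)]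
    push_cast
    omega

theorem apply_mem (H : LocalModel g v m n k) (c : ℕ) {d d' : ℤ} (hd : d + k - c ≤ d') {u : V} (hu : u ∈ W g v n k d) :
    g c u ∈ W g v n k d' :=
  mem_W_of_mon (fun _ _ hw hu => W_mono (by omega) ((H.mon_key hu).1 c)) hu

theorem sub_mem (H : LocalModel g v m n k) (c : ℕ) (hc : n ≤ c) {d d' : ℤ} (hd : d + 1 - c ≤ d') {u : V}
    (hu : u ∈ W g v n k d) : g c u - m c • u ∈ W g v n k d' :=
  mem_W_of_mon (φ := g c - m c • LinearMap.id)
    (fun _ _ hw hu => W_mono (by omega) ((H.mon_key hu).2 c hc)) hu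

/-- The summands of the Euler operator. -/
noncomputable def pair (g : ℕ → Module.End ℂ V) (m : ℕ → ℂ) (k b : ℕ) :
    Module.End ℂ V :=
  g b * (g (k + 1 - b) - m (k + 1 - b) • 1)

/-- The leading part of the commutator with g_a comes from [g_{k+1-b}, g_a], a multiple of
g_{a+k-b}. For a > b this index exceeds k, for a = b it gives m_k, and for a < b the resulting terms
have smaller weight than g_a u, with one exception. The assumption k ≥ 2 makes the error g_b
(g_{a+k-b} - m_{a+k-b}) u drop in weight. -/
theorem pair_comm (H : LocalModel g v m n k) (hk : 2 ≤ k) {a b w : ℕ} (ha : a < n) (hb : b < n) {u : V}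
    (hu : Mon g v n k w u) :
    pair g m k b (g a u) - g a (pair g m k b u) -
      (if a = b then ((2 * a : ℂ) - k - 1) * m k else 0) • g a u -
      (if a = 0 ∧ b + 1 = n ∧ k + 2 = 2 * n then -(n : ℂ) else 0) • g (n - 1) (g (n - 1) u) ∈
      W g v n k (w + k - a - 1) := by
  have h1 := H.one_le
  have h2 := H.le_top
  have h3 := H.top_lower
  have h4 := H.top_upper
  have hbk : b ≤ k + 1 := by omega
  have hmon := hu.mem_W (d := w) le_rfl
  set e := k + 1 - b with he
  set r := g e u - m e • u with hr
  have hrW : r ∈ W g v n k (w - k + b) := H.sub_mem e (by omega) (by omega) hmon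
  have e1 : pair g m k b (g a u) - g a (pair g m k b u) =
      ((a : ℂ) - b) • g (a + b - 1) r + ((a : ℂ) - e) • g b (g (a + k - b) u) := by
    have e2 : pair g m k b u = g b r := rfl
    have e3 : pair g m k b (g a u) = g b (g e (g a u) - m e • g a u) := rfl
    have e4 : g e (g a u) - m e • g a u = g a r + ((a : ℂ) - e) • g (a + k - b) u := by
      rw [H.comm, hr, map_sub, map_smul, show a + e - 1 = a + k - b by omega]; abel
    rw [e2, e3, e4, map_add, map_smul, H.comm b a r]
    abel
  have hfirst : ((a : ℂ) - b) • g (a + b - 1) r ∈ W g v n k (w + k - a - 1) := by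
    rcases Nat.eq_zero_or_pos (a + b) with h0 | h0
    · obtain rfl : a = 0 := by omega
      obtain rfl : b = 0 := by omega
      rw [sub_self, zero_smul]; exact Submodule.zero_mem _
    · refine Submodule.smul_mem _ _ (H.apply_mem _ ?_ hrW)
      rw [Nat.cast_sub (by omega)]
      push_cast
      omega
  rw [e1, add_sub_assoc (((a : ℂ) - b) • g (a + b - 1) r),
    add_sub_assoc (((a : ℂ) - b) • g (a + b - 1) r)]
  refine Submodule.add_mem _ hfirst ?_
  have hcast : (e : ℂ) = k + 1 - b := by rw [he, Nat.cast_sub hbk]; push_cast; ring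
  have hbig : n ≤ a + k - b → ∃ s ∈ W g v n k (w + k - a - 1),
      g b (g (a + k - b) u) = m (a + k - b) • g b u + s := by
    intro hq
    refine ⟨g b (g (a + k - b) u - m (a + k - b) • u), ?_, by rw [map_sub, map_smul]; abel⟩
    exact H.low_mem hb (by omega)
      (H.sub_mem (a + k - b) hq (d' := w + 1 - (a + k - b : ℕ)) (by omega) hmon)
  rcases lt_trichotomy a b with hab | rfl | hab
  · rw [if_neg hab.ne, zero_smul, sub_zero]
    -- The index falls below n only for a = 0, b = n - 1, k = 2n - 2; then g_{n-1} g_{n-1} u has the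
    -- same weight as g_0 u and cannot be discarded.
    rcases lt_or_ge (a + k - b) n with hq | hq
    · have hk2 : k + 2 = 2 * n := by omega
      have ha0 : a = 0 := by omega
      have hbn : b + 1 = n := by omega
      rw [if_pos ⟨ha0, hbn, hk2⟩, show a + k - b = n - 1 by omega, show b = n - 1 by omega,
        ← sub_smul, show (a : ℂ) - e - -n = 0 from ?_, zero_smul]
      · exact Submodule.zero_mem _
      · have h5 : (k : ℂ) + 2 = 2 * n := by exact_mod_cast hk2
        have h6 : (b : ℂ) + 1 = n := by exact_mod_cast hbn
        rw [hcast, ha0]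
        push_cast
        linear_combination -h5 + h6
    · rw [if_neg (by omega), zero_smul, sub_zero]
      obtain ⟨s, hs, hs'⟩ := hbig hq
      rw [hs']
      refine Submodule.smul_mem _ _ (Submodule.add_mem _ (Submodule.smul_mem _ _ ?_) hs)
      exact H.low_mem hb (by omega) hmon
  · obtain ⟨s, hs, hs'⟩ := hbig (by omega)
    rw [if_pos rfl, if_neg (by omega), zero_smul, sub_zero, hs', add_tsub_cancel_left, smul_add,
      smul_smul, hcast, show ((a : ℂ) - (k + 1 - a)) * m k = (2 * a - k - 1) * m k by ring,
      add_sub_cancel_left]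
    exact Submodule.smul_mem _ _ hs
  · obtain ⟨s, hs, hs'⟩ := hbig (by omega)
    rw [if_neg hab.ne', if_neg (by omega), zero_smul, zero_smul, sub_zero, sub_zero, hs',
      H.eq_zero _ (by omega), zero_smul, zero_add]
    exact Submodule.smul_mem _ _ hs

/-- The correction term of the Euler operator. -/
noncomputable def corr (g : ℕ → Module.End ℂ V) (n k : ℕ) : Module.End ℂ V :=
  g (n - 1) * (g (n - 1) * g (k + 1))

/-- g_{k+1} lowers weights by k since m_{k+1} = 0, and its commutator with g_a is a multiple of
g_{a+k}. Only a = 0 reaches the nonzero eigenvalue m_k, which yields the term needed to cancel the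
exceptional one in `pair_comm`. -/
theorem corr_comm (H : LocalModel g v m n k) (hk : 2 ≤ k) (hkn : k + 2 = 2 * n) {a w : ℕ} (ha : a < n) {u : V}
    (hu : Mon g v n k w u) :
    corr g n k (g a u) - g a (corr g n k u) -
      (if a = 0 then -((k : ℂ) + 1) * m k else 0) • g (n - 1) (g (n - 1) u) ∈
      W g v n k (w + k - a - 1) := by
  have hmon := hu.mem_W (d := w) le_rfl
  obtain ⟨y, rfl⟩ : ∃ y, n = y + 1 := ⟨n - 1, by omega⟩
  rw [Nat.add_sub_cancel]
  set r := g (k + 1) u with hr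
  have hrW : r ∈ W g v (y + 1) k (w - k) := by
    have := H.sub_mem (k + 1) (by omega) (d' := (w : ℤ) - k) (by push_cast; omega) hmon
    rwa [H.eq_zero (k + 1) (by omega), zero_smul, sub_zero] at this
  have e0 : ∀ u, corr g (y + 1) k u = g y (g y (g (k + 1) u)) := fun _ => rfl
  have e1 : corr g (y + 1) k (g a u) - g a (corr g (y + 1) k u) =
      (((a : ℂ) - y) • g (a + y - 1) (g y r) + ((a : ℂ) - y) • g y (g (a + y - 1) r)) +
        ((a : ℂ) - (k + 1 : ℕ)) • g y (g y (g (a + k) u)) := by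
    rw [e0, e0, H.comm (k + 1) a, ← hr, map_add, map_add, H.comm y a r, map_smul, map_smul, map_add,
      map_smul, H.comm y a (g y r), show a + (k + 1) - 1 = a + k by omega]
    abel
  have hy : y < y + 1 := Nat.lt_succ_self y
  have hay : ((a + y - 1 : ℕ) : ℤ) = a + y - 1 := by rw [Nat.cast_sub (by omega)]; push_cast; ring
  rw [e1, add_sub_assoc (((a : ℂ) - y) • g (a + y - 1) (g y r) +
    ((a : ℂ) - y) • g y (g (a + y - 1) r))]
  refine Submodule.add_mem _ (Submodule.add_mem _ (Submodule.smul_mem _ _ ?_)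
    (Submodule.smul_mem _ _ ?_)) ?_
  · exact H.apply_mem _ (by omega) (H.low_mem hy (d' := w - k + (k - y)) (by omega) hrW)
  · exact H.low_mem hy (by omega) (H.apply_mem _ (d' := w - k + (k - (a + y - 1))) (by omega) hrW)
  · have hs := H.sub_mem (a + k) (by omega) (d' := (w : ℤ) + 1 - a - k) (by push_cast; omega) hmon
    have hs2 := H.low_mem hy (d' := w + k - a - 1) (by omega)
      (H.low_mem hy (d' := w + 1 - a - k + (k - y)) (by omega) hs)
    rw [map_sub, map_sub, map_smul, map_smul] at hs2
    rcases Nat.eq_zero_or_pos a with rfl | ha0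
    · rw [if_pos rfl]
      rw [zero_add] at hs2 ⊢
      have : (((0 : ℕ) : ℂ) - (k + 1 : ℕ)) • g y (g y (g k u)) -
          (-((k : ℂ) + 1) * m k) • g y (g y u) =
          (-((k : ℂ) + 1)) • (g y (g y (g k u)) - m k • g y (g y u)) := by
        push_cast
        module
      rw [this]
      exact Submodule.smul_mem _ _ hs2
    · rw [H.eq_zero _ (by omega), zero_smul, sub_zero] at hs2
      rw [if_neg ha0.ne', zero_smul, sub_zero]
      exact Submodule.smul_mem _ _ hs2

/-- A combination of the `pair` operators, plus `corr` if k = 2n - 2, commutes with g_a to (k - a)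
g_a up to lower weight, so it counts weights. Each summand ends in an operator that kills vectors
with the eigenvalues of v. -/
theorem exists_euler_of_two_le (H : LocalModel g v m n k) (hk : 2 ≤ k) : ∃ E : Module.End ℂ V,
    (∀ u, (∀ c, n ≤ c → 2 ≤ c → g c u = m c • u) → E u = 0) ∧
      ∀ w u, Mon g v n k w u → E u - (w : ℂ) • u ∈ W g v n k (w - 1) := by
  have h1 := H.one_le
  have h2 := H.le_top
  have h3 := H.top_lower
  have h4 := H.top_upper
  -- Chosen so that the diagonal terms of `pair_comm` become the weight k - b; the denominator is
  -- nonzero because 2b < k + 1 for b < n.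
  let κ : ℕ → ℂ := fun b => ((k : ℂ) - b) / ((2 * b - k - 1) * m k)
  -- Chosen to cancel the exceptional term in g_{n-1} g_{n-1}, see `hcancel`.
  let κ' : ℂ := if k + 2 = 2 * n then -(n * κ (n - 1)) / ((k + 1) * m k) else 0
  have hκ : ∀ b < n, κ b * ((2 * b - k - 1) * m k) = (k : ℂ) - b := by
    intro b hb
    refine div_mul_cancel₀ _ (mul_ne_zero ?_ H.top_ne_zero)
    intro h
    have h5 : ((2 * b : ℕ) : ℂ) = (k + 1 : ℕ) := by push_cast; linear_combination h
    have := Nat.cast_injective h5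
    omega
  let E : Module.End ℂ V := ∑ b ∈ Finset.range n, κ b • pair g m k b + κ' • corr g n k
  have hE : ∀ u, E u = ∑ b ∈ Finset.range n, κ b • pair g m k b u + κ' • corr g n k u := by
    intro u
    simp only [E, LinearMap.add_apply, LinearMap.sum_apply, LinearMap.smul_apply]
  refine ⟨E, fun u hu => ?_, fun w u hu => ?_⟩
  · rw [hE, Finset.sum_eq_zero, zero_add]
    · change κ' • g (n - 1) (g (n - 1) (g (k + 1) u)) = 0
      rw [hu (k + 1) (by omega) (by omega), H.eq_zero _ (Nat.lt_succ_self k), zero_smul, map_zero,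
        map_zero, smul_zero]
    · intro b hb
      have hb := Finset.mem_range.1 hb
      change κ b • g b (g (k + 1 - b) u - m (k + 1 - b) • u) = 0
      rw [hu (k + 1 - b) (by omega) (by omega), sub_self, map_zero, smul_zero]
  · induction hu with
    | one =>
      have : E v = 0 := by
        rw [hE, Finset.sum_eq_zero, zero_add]
        · change κ' • g (n - 1) (g (n - 1) (g (k + 1) v)) = 0
          rw [H.eigen (k + 1) (by omega), H.eq_zero _ (Nat.lt_succ_self k), zero_smul, map_zero,
            map_zero, smul_zero]
        · intro b hb
          have hb := Finset.mem_range.1 hb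
          change κ b • g b (g (k + 1 - b) v - m (k + 1 - b) • v) = 0
          rw [H.eigen (k + 1 - b) (by omega), sub_self, map_zero, smul_zero]
      rw [this, Nat.cast_zero (R := ℂ), zero_smul, sub_zero]
      exact Submodule.zero_mem _
    | @step w u a ha hu ih =>
      have hp := fun b (hb : b < n) => H.pair_comm hk ha hb hu
      have hsum : ∑ b ∈ Finset.range n, κ b • (pair g m k b (g a u) - g a (pair g m k b u) -
          (if a = b then ((2 * a : ℂ) - k - 1) * m k else 0) • g a u -
          (if a = 0 ∧ b + 1 = n ∧ k + 2 = 2 * n then -(n : ℂ) else 0) •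
            g (n - 1) (g (n - 1) u)) ∈ W g v n k (w + k - a - 1) :=
        Submodule.sum_mem _ fun b hb => Submodule.smul_mem _ _ (hp b (Finset.mem_range.1 hb))
      have hcorr : κ' • (corr g n k (g a u) - g a (corr g n k u)) -
          (if a = 0 then κ' * (-((k : ℂ) + 1) * m k) else 0) • g (n - 1) (g (n - 1) u) ∈
          W g v n k (w + k - a - 1) := by
        by_cases hkn : k + 2 = 2 * n
        · have h5 := Submodule.smul_mem _ κ' (H.corr_comm hk hkn ha hu)
          rw [smul_sub, smul_smul, mul_ite, mul_zero] at h5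
          exact h5
        · have : κ' = 0 := if_neg hkn
          rw [this, zero_smul, zero_mul, ite_self, zero_smul, sub_zero]
          exact Submodule.zero_mem _
      have e1 : ∑ b ∈ Finset.range n, κ b • (pair g m k b (g a u) - g a (pair g m k b u) -
          (if a = b then ((2 * a : ℂ) - k - 1) * m k else 0) • g a u -
          (if a = 0 ∧ b + 1 = n ∧ k + 2 = 2 * n then -(n : ℂ) else 0) •
            g (n - 1) (g (n - 1) u)) =
          ∑ b ∈ Finset.range n, κ b • pair g m k b (g a u) -
            g a (∑ b ∈ Finset.range n, κ b • pair g m k b u) - ((k : ℂ) - a) • g a u -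
            (if a = 0 then if k + 2 = 2 * n then κ (n - 1) * -(n : ℂ) else 0 else 0) •
              g (n - 1) (g (n - 1) u) := by
        simp only [smul_sub, Finset.sum_sub_distrib, map_sum, map_smul, smul_smul]
        congr 1
        · congr 1
          rw [← Finset.sum_smul]
          congr 1
          simp only [mul_ite, mul_zero]
          rw [Finset.sum_ite_eq, if_pos (Finset.mem_range.2 ha), hκ a ha]
        · rw [← Finset.sum_smul]
          congr 1
          rw [Finset.sum_eq_single (n - 1)]
          · simp only [show n - 1 + 1 = n by omega, true_and, ite_and, mul_ite, mul_zero]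
          · intro b _ hb
            rw [if_neg (by omega), mul_zero]
          · intro h
            exact absurd (Finset.mem_range.2 (by omega)) h
      have hcancel : (if a = 0 then if k + 2 = 2 * n then κ (n - 1) * -(n : ℂ) else 0 else 0) +
          (if a = 0 then κ' * (-((k : ℂ) + 1) * m k) else 0) = 0 := by
        by_cases ha0 : a = 0
        · rw [if_pos ha0, if_pos ha0]
          by_cases hkn : k + 2 = 2 * n
          · have h5 : κ' = -(n * κ (n - 1)) / ((k + 1) * m k) := if_pos hkn
            have h6 : (k : ℂ) + 1 ≠ 0 := by exact_mod_cast Nat.succ_ne_zero k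
            have h7 := H.top_ne_zero
            rw [if_pos hkn, h5]
            field_simp
            ring
          · have h5 : κ' = 0 := if_neg hkn
            rw [if_neg hkn, h5]
            ring
        · rw [if_neg ha0, if_neg ha0, add_zero]
      rw [e1] at hsum
      have hak : ((w + (k - a) : ℕ) : ℤ) = w + k - a := by
        rw [Nat.cast_add, Nat.cast_sub (by omega)]; ring
      have hakC : ((w + (k - a) : ℕ) : ℂ) = w + k - a := by
        rw [Nat.cast_add, Nat.cast_sub (by omega)]; ring
      rw [hak]
      have hih := H.low_mem ha (d' := w + k - a - 1) (by omega) ih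
      have hfin := Submodule.add_mem _ (Submodule.add_mem _ hsum hcorr) hih
      have e2 : E (g a u) - ((w + (k - a) : ℕ) : ℂ) • g a u =
          (∑ b ∈ Finset.range n, κ b • pair g m k b (g a u) -
            g a (∑ b ∈ Finset.range n, κ b • pair g m k b u) - ((k : ℂ) - a) • g a u -
            (if a = 0 then if k + 2 = 2 * n then κ (n - 1) * -(n : ℂ) else 0 else 0) •
              g (n - 1) (g (n - 1) u) +
            (κ' • (corr g n k (g a u) - g a (corr g n k u)) -
          (if a = 0 then κ' * (-((k : ℂ) + 1) * m k) else 0) • g (n - 1) (g (n - 1) u)) +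
          g a (E u - (w : ℂ) • u)) := by
        rw [hE, hE, hakC, eq_neg_of_add_eq_zero_left hcancel]
        simp only [map_sub, map_add, map_smul]
        module
      rw [e2]
      exact hfin

/-- Here n = 1 and the products are powers of g_0 applied to v, as in an sl₂ Verma module. On weight
w, g_0 g_2 acts by -w (2 m_1 - (w - 1)) and g_0 g_0 g_3 by w (w - 1) (3 m_1 - (w - 2)). For m_1 ≠ 0
these scalars do not both vanish at w = d ≥ 1, so one of the operators can be rescaled to have
eigenvalue d there. -/
theorem exists_euler_of_eq_one (H : LocalModel g v m n k) (hk : k = 1) (d : ℕ) (hd : 1 ≤ d) : ∃ E : Module.End ℂ V,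
    (∀ u, (∀ c, n ≤ c → 2 ≤ c → g c u = m c • u) → E u = 0) ∧
      ∃ γ : ℕ → ℂ, γ d = d ∧ ∀ w u, Mon g v n k w u → E u = γ w • u := by
  have hn : n = 1 := le_antisymm (hk ▸ H.le_top) H.one_le
  subst hk hn
  have hm : ∀ c, 2 ≤ c → m c = 0 := fun c hc => H.eq_zero c hc
  have h1 : ∀ w u, Mon g v 1 1 w u → g 1 u = (m 1 - w) • u := by
    intro w u hu
    induction hu with
    | one => rw [H.eigen 1 le_rfl, Nat.cast_zero, sub_zero]
    | @step w u a ha hu ih =>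
      obtain rfl : a = 0 := by omega
      rw [H.comm, ih, map_smul]
      push_cast
      module
  have h2 : ∀ w u, Mon g v 1 1 w u → g 0 (g 2 u) = (-(w * (2 * m 1 - (w - 1))) : ℂ) • u := by
    intro w u hu
    induction hu with
    | one => rw [H.eigen 2 (by norm_num), hm 2 le_rfl, zero_smul, map_zero]; simp
    | @step w u a ha hu ih =>
      obtain rfl : a = 0 := by omega
      rw [H.comm 2 0, map_add, ih, map_smul, map_smul, zero_add, h1 w u hu, map_smul]
      push_cast
      module
  have h3 : ∀ w u, Mon g v 1 1 w u →
      g 0 (g 0 (g 3 u)) = ((w * (w - 1) * (3 * m 1 - (w - 2))) : ℂ) • u := by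
    intro w u hu
    induction hu with
    | one => rw [H.eigen 3 (by norm_num), hm 3 (by norm_num), zero_smul, map_zero, map_zero]; simp
    | @step w u a ha hu ih =>
      obtain rfl : a = 0 := by omega
      rw [H.comm 3 0, map_add, map_add, ih, map_smul, map_smul, map_smul, zero_add, h2 w u hu, map_smul]
      push_cast
      module
  have hd0 : (d : ℂ) ≠ 0 := by exact_mod_cast (by omega : d ≠ 0)
  by_cases hα : 2 * m 1 - ((d : ℂ) - 1) = 0
  · refine ⟨((d : ℂ) / (d * (d - 1) * (3 * m 1 - (d - 2)))) • (g 0 * (g 0 * g 3)),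
      fun u hu => ?_, fun w => ((d : ℂ) / (d * (d - 1) * (3 * m 1 - (d - 2)))) *
        (w * (w - 1) * (3 * m 1 - (w - 2))), ?_, fun w u hu => ?_⟩
    · rw [LinearMap.smul_apply, Module.End.mul_apply, Module.End.mul_apply, hu 3 (by norm_num) (by norm_num), hm 3 (by norm_num), zero_smul, map_zero, map_zero,
        smul_zero]
    · refine div_mul_cancel₀ _ (mul_ne_zero (mul_ne_zero hd0 ?_) ?_)
      · intro h
        rw [h, sub_zero] at hα
        exact H.top_ne_zero ((mul_eq_zero.1 hα).resolve_left two_ne_zero)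
      · intro h
        have h5 : ((d + 1 : ℕ) : ℂ) = 0 := by push_cast; linear_combination 2 * h - 3 * hα
        exact Nat.succ_ne_zero d (Nat.cast_eq_zero.1 h5)
    · rw [LinearMap.smul_apply, Module.End.mul_apply, Module.End.mul_apply, h3 w u hu, smul_smul]
  · refine ⟨((d : ℂ) / (-(d * (2 * m 1 - (d - 1))))) • (g 0 * g 2),
      fun u hu => ?_, fun w => ((d : ℂ) / (-(d * (2 * m 1 - (d - 1))))) *
        (-(w * (2 * m 1 - (w - 1)))), ?_, fun w u hu => ?_⟩
    · rw [LinearMap.smul_apply, Module.End.mul_apply, hu 2 (by norm_num) (by norm_num), hm 2 (by norm_num), zero_smul, map_zero, smul_zero]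
    · exact div_mul_cancel₀ _ (neg_ne_zero.2 (mul_ne_zero hd0 hα))
    · rw [LinearMap.smul_apply, Module.End.mul_apply, h2 w u hu, smul_smul]

/-- The Euler operator kills u but is multiplication by d modulo lower weight, so d u has lower
weight. -/
theorem mem_W_pred (H : LocalModel g v m n k) {d : ℕ} (hd : 1 ≤ d) {u : V} (hu : u ∈ W g v n k d)
    (h : ∀ c, n ≤ c → 2 ≤ c → g c u = m c • u) : u ∈ W g v n k (d - 1) := by
  obtain ⟨E, hE, hEd⟩ : ∃ E : Module.End ℂ V,
      (∀ u, (∀ c, n ≤ c → 2 ≤ c → g c u = m c • u) → E u = 0) ∧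
        ∀ (w : ℕ) u, (w : ℤ) ≤ d → Mon g v n k w u → E u - (d : ℂ) • u ∈ W g v n k (d - 1) := by
    rcases lt_or_ge k 2 with hk | hk
    · obtain ⟨E, hE, γ, hγ, hEw⟩ := H.exists_euler_of_eq_one
        (by have := H.one_le; have := H.le_top; omega) d hd
      refine ⟨E, hE, fun w u hw hu => ?_⟩
      rw [hEw w u hu, ← sub_smul]
      rcases eq_or_ne w d with rfl | hne
      · rw [hγ, sub_self, zero_smul]; exact Submodule.zero_mem _
      · exact Submodule.smul_mem _ _ (hu.mem_W (by omega))
    · obtain ⟨E, hE, hEw⟩ := H.exists_euler_of_two_le hk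
      refine ⟨E, hE, fun w u hw hu' => ?_⟩
      rcases eq_or_ne w d with rfl | hne
      · exact hEw w u hu'
      · have e : E u - (d : ℂ) • u = (E u - (w : ℂ) • u) + ((w : ℂ) - d) • u := by module
        rw [e]
        exact Submodule.add_mem _ (W_mono (by omega) (hEw w u hu'))
          (Submodule.smul_mem _ _ (hu'.mem_W (by omega)))
  have h1 := mem_W_of_mon (φ := E - (d : ℂ) • LinearMap.id) hEd hu
  change E u - (d : ℂ) • u ∈ _ at h1
  rw [hE u h, zero_sub] at h1
  have h2 := Submodule.smul_mem _ (-(d : ℂ)⁻¹) h1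
  rwa [neg_smul_neg, smul_smul, inv_mul_cancel₀ (by exact_mod_cast (by omega : d ≠ 0)),
    one_smul] at h2

theorem W_zero_le (H : LocalModel g v m n k) : W g v n k 0 ≤ Submodule.span ℂ {v} := by
  refine Submodule.span_le.2 ?_
  rintro u ⟨w, hw, hu⟩
  cases hu with
  | one => exact Submodule.mem_span_singleton_self v
  | step a ha hu => have := H.top_lower; have := H.le_top; omega

/-- A vector of finite weight with the same eigenvalues as `v` is a multiple of `v`. -/
theorem mem_span_of_eigen (H : LocalModel g v m n k) (d : ℕ) {u : V} (hu : u ∈ W g v n k d)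
    (h : ∀ c, n ≤ c → g c u = m c • u) : u ∈ Submodule.span ℂ {v} := by
  induction d with
  | zero => exact H.W_zero_le hu
  | succ d ih =>
    refine ih ?_
    have := H.mem_W_pred (by omega) hu fun c hc _ => h c hc
    rwa [Nat.cast_succ, add_sub_cancel_right] at this

/-- A nonzero subspace stable under all `g c` contains `v` as soon as it contains a nonzero vector
of finite weight. -/
theorem gen_mem_of_stable (H : LocalModel g v m n k) {N : Submodule ℂ V} (hN : ∀ c, ∀ u ∈ N, g c u ∈ N) (d : ℕ) {u : V}
    (hu : u ∈ W g v n k d) (huN : u ∈ N) (hu0 : u ≠ 0) : v ∈ N := by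
  induction d using Nat.strong_induction_on generalizing u with
  | _ d ih =>
    rcases Nat.eq_zero_or_pos d with rfl | hd
    · obtain ⟨c, rfl⟩ := Submodule.mem_span_singleton.1 (H.W_zero_le hu)
      have hc : c ≠ 0 := by rintro rfl; exact hu0 (zero_smul _ _)
      have := N.smul_mem c⁻¹ huN
      rwa [smul_smul, inv_mul_cancel₀ hc, one_smul] at this
    · obtain ⟨e, rfl⟩ : ∃ e, d = e + 1 := ⟨d - 1, by omega⟩
      -- The restriction to c ≥ 2 is needed because g_1 - m_1 need not lower the weight.
      by_cases hall : ∀ c, n ≤ c → 2 ≤ c → g c u = m c • u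
      · have h1 := H.mem_W_pred hd hu hall
        rw [Nat.cast_succ, add_sub_cancel_right] at h1
        exact ih e (Nat.lt_succ_self e) h1 huN hu0
      · push Not at hall
        obtain ⟨c, hc, hc2, hne⟩ := hall
        exact ih e (Nat.lt_succ_self e)
          (H.sub_mem c hc (by push_cast; omega) hu) (N.sub_mem (hN c u huN) (N.smul_mem _ huN))
          (sub_ne_zero.2 hne)

end LocalModel

/-! ### A single root -/

namespace Vir

/-- t is invertible modulo f, so every class of Laurent polynomials has a polynomial representative.
-/
theorem exists_toLaurent_dvd_sub {f : ℂ[X]} (h0 : f.coeff 0 ≠ 0) (h : ℂ[T;T⁻¹]) :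
    ∃ q : ℂ[X], toLaurent f ∣ h - toLaurent q := by
  obtain ⟨n, p, hp⟩ := LaurentPolynomial.exists_T_pow h
  have hc : IsCoprime (X ^ n) f := by
    refine IsCoprime.pow_left ?_
    refine (Irreducible.coprime_iff_not_dvd irreducible_X).2 ?_
    rwa [X_dvd_iff]
  obtain ⟨a, b, hab⟩ := hc
  refine ⟨a * p, h * toLaurent b, ?_⟩
  have h1 := congrArg toLaurent hab
  rw [map_add, map_mul, map_mul, map_one, toLaurent_X_pow] at h1
  rw [map_mul, hp]
  linear_combination -h * h1

theorem z_lie_V {f : ℂ[X]} (h0 : f.coeff 0 ≠ 0) (μ : poly f →ₗ⁅ℂ⁆ ℂ) (u : V f μ) :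
    ⁅z, u⁆ = 0 := by
  let N : LieSubmodule ℂ Vir (V f μ) :=
    { carrier := {u | ⁅z, u⁆ = 0}
      add_mem' := fun {u w} hu hw => by
        change ⁅z, u + w⁆ = 0
        rw [lie_add, show ⁅z, u⁆ = 0 from hu, show ⁅z, w⁆ = 0 from hw, add_zero]
      zero_mem' := lie_zero z
      smul_mem' := fun c u hu => by
        change ⁅z, c • u⁆ = 0
        rw [lie_smul, show ⁅z, u⁆ = 0 from hu, smul_zero]
      lie_mem := fun {x u} hu => by
        change ⁅z, ⁅x, u⁆⁆ = 0
        rw [leibniz_lie, z_lie, zero_lie, show ⁅z, u⁆ = 0 from hu, lie_zero, add_zero] }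
  have hN : N = ⊤ := InducedModule.eq_top_of_gen_mem N (by
    change ⁅z, _⁆ = 0
    rw [InducedModule.lie_gen z (z_mem_poly f), apply_z h0, zero_smul])
  have : u ∈ N := by rw [hN]; trivial
  exact this

theorem lie_V_eq {f : ℂ[X]} (h0 : f.coeff 0 ≠ 0) (μ : poly f →ₗ⁅ℂ⁆ ℂ) (x : Vir) (u : V f μ) :
    ⁅x, u⁆ = ⁅lift (θ x), u⁆ := by
  conv_lhs => rw [eq_lift_add x]
  rw [add_lie, smul_lie, z_lie_V h0, smul_zero, add_zero]

theorem coeff_zero_X_sub_C_pow {lam : ℂ} (hlam : lam ≠ 0) (n : ℕ) :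
    ((X - C lam) ^ n).coeff 0 ≠ 0 := by
  rw [coeff_zero_eq_eval_zero, eval_pow]
  exact pow_ne_zero _ (by simpa using hlam)

theorem laurentDeriv_X_sub_C_pow (lam : ℂ) (c : ℕ) :
    laurentDeriv (toLaurent ((X - C lam) ^ c)) = (c : ℂ) • toLaurent ((X - C lam) ^ (c - 1)) := by
  have h1 : laurentDeriv (toLaurent (X - C lam)) = 1 := by
    have h2 := laurentDeriv_C_mul_T 1 1
    have h3 := laurentDeriv_C_mul_T 0 lam
    simp only [map_one, one_mul, LaurentPolynomial.T_zero, mul_one, sub_self, Int.cast_one] at h2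
    simp only [Int.cast_zero, zero_mul, map_zero, LaurentPolynomial.T_zero, mul_one] at h3
    rw [map_sub, map_sub, toLaurent_X, toLaurent_C, h2, h3, sub_zero]
  induction c with
  | zero =>
    have h3 := laurentDeriv_C_mul_T 0 1
    simp only [Int.cast_zero, zero_mul, map_zero, LaurentPolynomial.T_zero, map_one, mul_one] at h3
    rw [pow_zero, map_one, h3, Nat.cast_zero, zero_smul]
  | succ c ih =>
    rw [pow_succ, map_mul, laurentDeriv_mul, ih, h1, mul_one, Nat.add_sub_cancel, smul_mul_assoc,
      ← map_mul]
    rcases c with _ | c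
    · simp
    · rw [Nat.add_sub_cancel, ← pow_succ]
      push_cast
      module

/-- The element of `Vir` corresponding to the vector field `(t - lam) ^ c d / dt`. -/
noncomputable def field (lam : ℂ) (c : ℕ) : Vir :=
  lift (LaurentPolynomial.T (-1) * toLaurent ((X - C lam) ^ c))

theorem wittBracket_T_neg_one_mul (g h : ℂ[T;T⁻¹]) :
    wittBracket (LaurentPolynomial.T (-1) * g) (LaurentPolynomial.T (-1) * h) =
      LaurentPolynomial.T (-1) * (g * laurentDeriv h - h * laurentDeriv g) := by
  have h1 : (LaurentPolynomial.T 1 * LaurentPolynomial.T (-1) : ℂ[T;T⁻¹]) = 1 := by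
    rw [← LaurentPolynomial.T_add]; simp
  rw [wittBracket_mul_mul, wittBracket]
  linear_combination LaurentPolynomial.T (-1) * (g * laurentDeriv h - h * laurentDeriv g) * h1

theorem θ_field_lie_field (lam : ℂ) (b a : ℕ) :
    θ ⁅field lam b, field lam a⁆ = θ (((a : ℂ) - b) • field lam (a + b - 1)) := by
  rw [θ_lie, map_smul, field, field, field, θ_lift, θ_lift, θ_lift, wittBracket_T_neg_one_mul,
    laurentDeriv_X_sub_C_pow, laurentDeriv_X_sub_C_pow]
  have h1 : ∀ a b : ℕ, (a : ℂ) • (toLaurent ((X - C lam) ^ b) * toLaurent ((X - C lam) ^ (a - 1))) =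
      (a : ℂ) • toLaurent ((X - C lam) ^ (a + b - 1)) := by
    intro a b
    rcases a with _ | a
    · simp
    · rw [← map_mul, ← pow_add, show a + 1 + b - 1 = b + (a + 1 - 1) by omega]
  rw [mul_smul_comm, mul_smul_comm, h1 a b, h1 b a, add_comm b a, ← sub_smul, mul_smul_comm]

section Single

variable {lam : ℂ} {n : ℕ} {μ : poly ((X - C lam) ^ n) →ₗ⁅ℂ⁆ ℂ} {p : ℂ[X]}

theorem IsAssociated.onMul_T (hp : IsAssociated lam n μ p) (j : ℤ) :
    onMul μ (LaurentPolynomial.T j) = p.eval (j : ℂ) * lam ^ j := by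
  rw [Vir.onMul_T, hp]

/-- Multiplication by t - lam acts on j ↦ p(j) lam^j as lam times the forward difference of p. So
deg p is read off from the last power of t - lam not killed by μ. -/
theorem IsAssociated.onMul_mul_pow (hlam : lam ≠ 0) (hp : IsAssociated lam n μ p) (i : ℕ) (j : ℤ) :
    onMul μ (LaurentPolynomial.T j * toLaurent ((X - C lam) ^ i)) =
      lam ^ (j + i) * ((fwdDiff (1 : ℂ))^[i] fun x => p.eval x) (j : ℂ) := by
  induction i generalizing j with
  | zero => simp [hp.onMul_T, mul_comm]
  | succ i ih =>
    have e : LaurentPolynomial.T j * toLaurent ((X - C lam) ^ (i + 1)) =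
        LaurentPolynomial.T (j + 1) * toLaurent ((X - C lam) ^ i) -
          lam • (LaurentPolynomial.T j * toLaurent ((X - C lam) ^ i)) := by
      rw [pow_succ, map_mul, map_sub, toLaurent_X, toLaurent_C, LaurentPolynomial.T_add,
        LaurentPolynomial.smul_eq_C_mul]
      ring
    rw [e, map_sub, map_smul, ih, ih, Function.iterate_succ_apply', fwdDiff, smul_eq_mul,
      ← mul_assoc, ← zpow_one_add₀ hlam]
    push_cast
    rw [show (1 : ℤ) + (j + i) = j + (i + 1) by ring, show j + 1 + (i : ℤ) = j + (i + 1) by ring]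
    ring

theorem IsAssociated.onMul_mul_pow_eq_zero (hlam : lam ≠ 0) (hp : IsAssociated lam n μ p) {i : ℕ}
    (hi : p.natDegree < i) (g : ℂ[T;T⁻¹]) : onMul μ (g * toLaurent ((X - C lam) ^ i)) = 0 := by
  have h : onMul μ ∘ₗ LinearMap.mulRight ℂ (toLaurent ((X - C lam) ^ i)) = 0 := by
    refine ext_T fun j => ?_
    rw [LinearMap.comp_apply, LinearMap.mulRight_apply, hp.onMul_mul_pow hlam,
      Polynomial.fwdDiff_iter_eq_zero_of_degree_lt hi, Pi.zero_apply, mul_zero, LinearMap.zero_apply]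
  exact congrArg (fun φ => φ g) h

theorem IsAssociated.onMul_mul_pow_natDegree_ne_zero (hlam : lam ≠ 0) (hp : IsAssociated lam n μ p)
    (hp0 : p ≠ 0) (j : ℤ) :
    onMul μ (LaurentPolynomial.T j * toLaurent ((X - C lam) ^ p.natDegree)) ≠ 0 := by
  rw [hp.onMul_mul_pow hlam, Polynomial.fwdDiff_iter_degree_eq_factorial]
  refine mul_ne_zero (zpow_ne_zero _ hlam) ?_
  rw [Pi.smul_apply]
  refine smul_ne_zero (leadingCoeff_ne_zero.2 hp0) ?_
  simpa using Nat.factorial_ne_zero _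

/-- Otherwise a multiple of f² would have nonzero value under μ. -/
theorem IsAssociated.natDegree_lt (hlam : lam ≠ 0) (hp : IsAssociated lam n μ p) (hp0 : p ≠ 0) :
    p.natDegree < n := by
  by_contra! h
  refine hp.onMul_mul_pow_natDegree_ne_zero hlam hp0 0 ?_
  obtain ⟨e, he⟩ := Nat.exists_eq_add_of_le h
  rw [he, pow_add, map_mul toLaurent, mul_left_comm, onMul_self_mul (coeff_zero_X_sub_C_pow hlam n)]

theorem field_mem_poly {c : ℕ} (hc : n ≤ c) : field lam c ∈ poly ((X - C lam) ^ n) :=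
  mem_poly_iff_dvd.2 ((_root_.map_dvd toLaurent (pow_dvd_pow _ hc)).trans (dvd_mul_left _ _))

variable (lam μ) in
/-- The operator by which `(t - lam) ^ c d / dt` acts. -/
noncomputable def fieldEnd (c : ℕ) : Module.End ℂ (V ((X - C lam) ^ n) μ) :=
  LieModule.toEnd ℂ Vir _ (field lam c)

open Classical in
-- The eigenvalue at c = n + e is μ(t⁻¹ (t - lam)^e f), whose last nonzero value is at e = deg p.
-- The hypothesis gives n - 2 ≤ deg p, and deg p ≤ n - 1 always holds. The default 0 below n is
-- never used.
theorem IsAssociated.localModel (hlam : lam ≠ 0) (hp : IsAssociated lam n μ p) (hn : 1 ≤ n)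
    (hdeg : (n : WithBot ℕ) ≤ p.degree + 2) :
    LocalModel (fieldEnd lam μ) (InducedModule.gen _ μ)
      (fun c => if h : n ≤ c then μ ⟨field lam c, field_mem_poly h⟩ else 0) n (n + p.natDegree) := by
  have h0 := coeff_zero_X_sub_C_pow hlam n
  have hp0 : p ≠ 0 := by
    rintro rfl
    rw [degree_zero, WithBot.bot_add] at hdeg
    exact absurd (le_bot_iff.1 hdeg) (by simp)
  rw [degree_eq_natDegree hp0] at hdeg
  have hdeg' : n ≤ p.natDegree + 2 := by exact_mod_cast hdeg
  have hlt := hp.natDegree_lt hlam hp0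
  have hval : ∀ e, μ ⟨field lam (n + e), field_mem_poly (Nat.le_add_right n e)⟩ =
      onMul μ (LaurentPolynomial.T (-1) * toLaurent ((X - C lam) ^ e)) := by
    intro e
    refine apply_eq_onMul h0 _ _ _ ?_
    rw [field, θ_lift, pow_add, map_mul]
    ring
  refine ⟨fun b a u => ?_, fun c hc => ?_, hn, by omega, by omega, by omega, fun c hc => ?_, ?_⟩
  · change ⁅field lam b, ⁅field lam a, u⁆⁆ = ⁅field lam a, ⁅field lam b, u⁆⁆ +
      ((a : ℂ) - b) • ⁅field lam (a + b - 1), u⁆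
    rw [leibniz_lie, add_comm, lie_V_eq h0 μ ⁅field lam b, field lam a⁆, θ_field_lie_field,
      ← lie_V_eq h0 μ, smul_lie]
  · rw [dif_pos hc]
    exact InducedModule.lie_gen _ _
  · obtain ⟨e, rfl⟩ := Nat.exists_eq_add_of_le (by omega : n ≤ c)
    rw [dif_pos (Nat.le_add_right n e), hval, hp.onMul_mul_pow_eq_zero hlam (by omega)]
  · rw [dif_pos (Nat.le_add_right n _), hval]
    exact hp.onMul_mul_pow_natDegree_ne_zero hlam hp0 _

/-- By local nilpotency an element of Vir acts on a given vector as a polynomial vector field, hence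
as a finite combination of the operators (t - lam)^c d/dt, each of which preserves finiteness of
weight. -/
theorem exists_mem_W {m : ℕ → ℂ} {k : ℕ} (hlam : lam ≠ 0)
    (H : LocalModel (fieldEnd lam μ) (InducedModule.gen _ μ) m n k) (u : V ((X - C lam) ^ n) μ) :
    ∃ d : ℕ, u ∈ LocalModel.W (fieldEnd lam μ) (InducedModule.gen _ μ) n k d := by
  have h0 := coeff_zero_X_sub_C_pow hlam n
  let N : LieSubmodule ℂ Vir (V ((X - C lam) ^ n) μ) :=
    { carrier := {u | ∃ d : ℕ, u ∈ LocalModel.W (fieldEnd lam μ) (InducedModule.gen _ μ) n k d}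
      add_mem' := by
        rintro u w ⟨d, hd⟩ ⟨e, he⟩
        exact ⟨d + e, Submodule.add_mem _ (LocalModel.W_mono (by push_cast; omega) hd)
          (LocalModel.W_mono (by push_cast; omega) he)⟩
      zero_mem' := ⟨0, Submodule.zero_mem _⟩
      smul_mem' := by
        rintro c u ⟨d, hd⟩
        exact ⟨d, Submodule.smul_mem _ c hd⟩
      lie_mem := by
        rintro x u ⟨d, hd⟩
        have hnil : u ∈ nilpotentVectors (V ((X - C lam) ^ n) μ) (toLaurent ((X - C lam) ^ n)) := by
          rw [nilpotentVectors_V h0]; trivial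
        obtain ⟨M, hM⟩ := hnil
        -- The factor t converts θ x into the coefficient of d/dt, since e_j is t^(j+1) d/dt.
        obtain ⟨q, hq⟩ := exists_toLaurent_dvd_sub (f := ((X - C lam) ^ n) ^ M)
          (by rw [← pow_mul]; exact coeff_zero_X_sub_C_pow hlam _) (LaurentPolynomial.T 1 * θ x)
        have h1 : (LaurentPolynomial.T (-1) * LaurentPolynomial.T 1 : ℂ[T;T⁻¹]) = 1 := by
          rw [← LaurentPolynomial.T_add]; simp
        have h2 : ⁅x - lift (LaurentPolynomial.T (-1) * toLaurent q), u⁆ = 0 := by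
          refine hM _ ?_
          rw [← map_pow, map_sub, θ_lift]
          refine (hq.mul_left (LaurentPolynomial.T (-1))).trans (dvd_of_eq ?_)
          linear_combination θ x * h1
        rw [sub_lie, sub_eq_zero] at h2
        have h3 : lift (LaurentPolynomial.T (-1) * toLaurent q) =
            ∑ c ∈ (taylor lam q).support, (taylor lam q).coeff c • field lam c := by
          conv_lhs => rw [← sum_taylor_eq q lam]
          rw [Polynomial.sum, map_sum, Finset.mul_sum, map_sum]
          refine Finset.sum_congr rfl fun c _ => ?_
          rw [field, ← map_smul, ← mul_smul_comm, map_mul toLaurent, toLaurent_C,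
            LaurentPolynomial.smul_eq_C_mul]
        refine ⟨d + k, ?_⟩
        rw [h2, h3, _root_.sum_lie]
        refine Submodule.sum_mem _ fun c _ => ?_
        rw [smul_lie]
        exact Submodule.smul_mem _ _ (H.apply_mem c (by push_cast; omega) hd) }
  have hN : N = ⊤ := InducedModule.eq_top_of_gen_mem N
    ⟨0, (LocalModel.Mon.one).mem_W le_rfl⟩
  have : u ∈ N := by rw [hN]; trivial
  exact this

theorem IsAssociated.isIrreducible (hlam : lam ≠ 0) (hp : IsAssociated lam n μ p) (hn : 1 ≤ n)
    (hdeg : (n : WithBot ℕ) ≤ p.degree + 2) :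
    LieModule.IsIrreducible ℂ Vir (V ((X - C lam) ^ n) μ) := by
  have H := hp.localModel hlam hn hdeg
  have : Nontrivial (V ((X - C lam) ^ n) μ) :=
    ⟨_, _, gen_ne_zero ((monic_X_sub_C lam).pow n) (coeff_zero_X_sub_C_pow hlam n) μ⟩
  refine LieModule.IsIrreducible.mk fun N hN => InducedModule.eq_top_of_gen_mem N ?_
  obtain ⟨u, huN, hu0⟩ : ∃ u ∈ N, u ≠ 0 := by
    by_contra! h
    exact hN ((LieSubmodule.eq_bot_iff N).2 h)
  obtain ⟨d, hd⟩ := exists_mem_W hlam H u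
  exact H.gen_mem_of_stable (N := N.toSubmodule) (fun c u hu => N.lie_mem hu) d hd huN hu0

/-- Used to show that endomorphisms of the simple module are scalars. -/
theorem IsAssociated.mem_span_gen (hlam : lam ≠ 0) (hp : IsAssociated lam n μ p) (hn : 1 ≤ n)
    (hdeg : (n : WithBot ℕ) ≤ p.degree + 2) (u : V ((X - C lam) ^ n) μ)
    (hu : ∀ x (hx : x ∈ poly ((X - C lam) ^ n)), ⁅x, u⁆ = μ ⟨x, hx⟩ • u) :
    u ∈ Submodule.span ℂ {InducedModule.gen _ μ} := by
  have H := hp.localModel hlam hn hdeg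
  obtain ⟨d, hd⟩ := exists_mem_W hlam H u
  refine H.mem_span_of_eigen d hd fun c hc => ?_
  rw [dif_pos hc]
  exact hu _ _

end Single

end Vir

/-! ### Maps out of a tensor product of induced modules -/

namespace InducedModule

section

variable {R L : Type*} [CommRing R] [LieRing L] [LieAlgebra R L]
variable {a : LieSubalgebra R L} {μ : a →ₗ⁅R⁆ R} {M : Type*} [AddCommGroup M] [Module R M]

/-- The representation is an argument because below the same space carries several commuting ones.
-/
theorem exists_linearMap_of_representation (ρ : L →ₗ⁅R⁆ Module.End R M) (m : M)
    (h : ∀ x : a, ρ x m = μ x • m) :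
    ∃ φ : InducedModule a μ →ₗ[R] M, φ (gen a μ) = m ∧ ∀ x u, φ ⁅x, u⁆ = ρ x (φ u) := by
  let _ : LieRingModule L M := LieRingModule.compLieHom M ρ
  have _ : LieModule R L M := LieModule.compLieHom M ρ
  obtain ⟨φ, hφ⟩ := exists_hom (a := a) (μ := μ) m h
  exact ⟨φ, hφ, fun x u => φ.map_lie x u⟩

theorem apply_smul_of_intertwines (ρ : L →ₗ⁅R⁆ Module.End R M) {φ : InducedModule a μ →ₗ[R] M}
    (hφ : ∀ x u, φ ⁅x, u⁆ = ρ x (φ u)) (w : UniversalEnvelopingAlgebra R L) :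
    ∀ u, φ (w • u) = UniversalEnvelopingAlgebra.lift R ρ w (φ u) := by
  induction w using UniversalEnvelopingAlgebra.induction_ι with
  | halg r =>
    intro u
    rw [AlgHom.commutes, Module.algebraMap_end_apply, algebraMap_smul, map_smul]
  | hι x =>
    intro u
    rw [UniversalEnvelopingAlgebra.lift_ι_apply, ← hφ]
    rfl
  | hadd w w' hw hw' => intro u; rw [map_add, add_smul, map_add, hw, hw', LinearMap.add_apply]
  | hmul w w' hw hw' => intro u; rw [map_mul, mul_smul, hw, hw', Module.End.mul_apply]

theorem commute_lift {ρ σ : L →ₗ⁅R⁆ Module.End R M} (h : ∀ x y, Commute (ρ x) (σ y))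
    (u w : UniversalEnvelopingAlgebra R L) :
    Commute (UniversalEnvelopingAlgebra.lift R ρ u) (UniversalEnvelopingAlgebra.lift R σ w) := by
  induction u using UniversalEnvelopingAlgebra.induction_ι with
  | halg r => rw [AlgHom.commutes]; exact Algebra.commutes _ _
  | hadd u u' hu hu' => rw [map_add]; exact hu.add_left hu'
  | hmul u u' hu hu' => rw [map_mul]; exact hu.mul_left hu'
  | hι x =>
    rw [UniversalEnvelopingAlgebra.lift_ι_apply]
    induction w using UniversalEnvelopingAlgebra.induction_ι with
    | halg r => rw [AlgHom.commutes]; exact (Algebra.commutes _ _).symm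
    | hadd u u' hu hu' => rw [map_add]; exact hu.add_right hu'
    | hmul u u' hu hu' => rw [map_mul]; exact hu.mul_right hu'
    | hι y => rw [UniversalEnvelopingAlgebra.lift_ι_apply]; exact h x y

end

section

variable {K L : Type*} [Field K] [LieRing L] [LieAlgebra K L]
variable {ι : Type*} [Fintype ι] [DecidableEq ι]
variable {a : ι → LieSubalgebra K L} {μ : ∀ i, a i →ₗ⁅K⁆ K}

/-- u_1 ⊗ ⋯ ⊗ u_k goes to the product of the operators ρ_i(w_i) applied to m, where w_i · `gen` =
u_i. As the ρ_i commute, any factor can be applied first, where it depends only on u_i; so the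
choice of w_i is harmless. -/
theorem exists_linearMap_tensor {M : Type*} [AddCommGroup M] [Module K M]
    (ρ : ι → L →ₗ⁅K⁆ Module.End K M) (hρ : Pairwise fun i j => ∀ x y, Commute (ρ i x) (ρ j y))
    (m : M) (h : ∀ i (x : a i), ρ i x m = μ i x • m) :
    ∃ Ψ : (⨂[K] i, InducedModule (a i) (μ i)) →ₗ[K] M,
      Ψ (PiTensorProduct.tprod K fun i => gen (a i) (μ i)) = m ∧
        ∀ i x t, Ψ (PiTensorLie.actAt _ i x t) = ρ i x (Ψ t) := by
  choose η hηg hη using fun i => exists_linearMap_of_representation (ρ i) m (h i)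
  have hη' : ∀ i (w : UniversalEnvelopingAlgebra K L),
      η i (w • gen (a i) (μ i)) = UniversalEnvelopingAlgebra.lift K (ρ i) w m := fun i w => by
    rw [apply_smul_of_intertwines (ρ i) (hη i), hηg]
  let ρU : ∀ _ : ι, UniversalEnvelopingAlgebra K L →* Module.End K M := fun i =>
    (UniversalEnvelopingAlgebra.lift K (ρ i)).toRingHom.toMonoidHom
  have hcomm : Pairwise fun i j => ∀ x y, Commute (ρU i x) (ρU j y) :=
    fun i j hij x y => commute_lift (hρ hij) x y
  let ψ := MonoidHom.noncommPiCoprod ρU hcomm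
  -- A linear section of U(L) → V_i, which exists over a field.
  have hs : ∀ i, ∃ s : InducedModule (a i) (μ i) →ₗ[K] UniversalEnvelopingAlgebra K L,
      ∀ u, s u • gen (a i) (μ i) = u := by
    intro i
    let q : UniversalEnvelopingAlgebra K L →ₗ[K] InducedModule (a i) (μ i) :=
      ((LinearMap.toSpanSingleton (UniversalEnvelopingAlgebra K L) _
        (gen (a i) (μ i))).restrictScalars K)
    have hq : LinearMap.range q = ⊤ := LinearMap.range_eq_top.2 fun u => by
      obtain ⟨w, hw⟩ := exists_smul_gen u
      exact ⟨w, hw.symm⟩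
    obtain ⟨s, hs⟩ := q.exists_rightInverse_of_surjective hq
    exact ⟨s, fun u => LinearMap.congr_fun hs u⟩
  choose s hs using hs
  have hψ : ∀ (v : ∀ _ : ι, UniversalEnvelopingAlgebra K L) i w,
      ψ (Function.update v i w) m =
        ψ (Function.update v i 1) (UniversalEnvelopingAlgebra.lift K (ρ i) w m) := by
    intro v i w
    have e : Function.update v i w = Function.update v i 1 * Pi.mulSingle i w := by
      funext j
      by_cases hj : j = i
      · subst hj; simp
      · simp [hj]
    have e2 : ψ (Pi.mulSingle i w) = UniversalEnvelopingAlgebra.lift K (ρ i) w :=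
      MonoidHom.noncommPiCoprod_mulSingle _ _ _
    rw [e, map_mul, Module.End.mul_apply, e2]
  have hψη : ∀ (v : ∀ i, InducedModule (a i) (μ i)) i u,
      ψ (fun j => s j (Function.update v i u j)) m =
        ψ (Function.update (fun j => s j (v j)) i 1) (η i u) := by
    intro v i u
    have e : (fun j => s j (Function.update v i u j)) =
        Function.update (fun j => s j (v j)) i (s i u) := by
      funext j
      by_cases hj : j = i
      · subst hj; simp
      · simp [hj]
    rw [e, hψ, ← hη', hs]
  let F : MultilinearMap K (fun i => InducedModule (a i) (μ i)) M :=
    MultilinearMap.mk' (fun v => ψ (fun i => s i (v i)) m)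
      (fun v i u w => by rw [hψη, hψη, hψη, map_add, map_add])
      (fun v i c u => by rw [hψη, hψη, map_smul, map_smul])
  refine ⟨PiTensorProduct.lift F, ?_, fun i x t => ?_⟩
  · rw [PiTensorProduct.lift.tprod]
    change ψ _ m = m
    let S : Submonoid (Module.End K M) :=
      { carrier := {T | T m = m}
        one_mem' := rfl
        mul_mem' := fun {A B} hA hB => by
          change A (B m) = m
          rw [show B m = m from hB, show A m = m from hA] }
    have : ψ (fun i => s i (gen (a i) (μ i))) ∈ S := by
      rw [MonoidHom.noncommPiCoprod_apply]
      refine Submonoid.noncommProd_mem _ _ _ _ fun i _ => ?_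
      change UniversalEnvelopingAlgebra.lift K (ρ i) _ m = m
      rw [← hη', hs, hηg]
    exact this
  · have : PiTensorProduct.lift F ∘ₗ PiTensorLie.actAt _ i x =
        ρ i x ∘ₗ PiTensorProduct.lift F := by
      refine PiTensorProduct.ext (MultilinearMap.ext fun v => ?_)
      simp only [LinearMap.compMultilinearMap_apply, LinearMap.comp_apply,
        PiTensorLie.actAt_tprod, PiTensorProduct.lift.tprod]
      change ψ _ m = ρ i x (ψ _ m)
      have e1 := hψη v i (v i)
      rw [Function.update_eq_self] at e1
      rw [hψη, e1, hη]
      have hc : Commute (ψ (Function.update (fun j => s j (v j)) i 1)) (ρ i x) := by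
        have e2 : ρ i x = ψ (Pi.mulSingle i (UniversalEnvelopingAlgebra.ι K x)) := by
          rw [MonoidHom.noncommPiCoprod_mulSingle]
          exact (UniversalEnvelopingAlgebra.lift_ι_apply K (ρ i) x).symm
        rw [e2]
        refine Commute.map ?_ ψ
        refine funext fun j => ?_
        by_cases hj : j = i
        · subst hj; simp
        · simp [hj]
      exact LinearMap.congr_fun hc.eq (η i (v i))
    exact LinearMap.congr_fun this t

/-- A subspace of a tensor product of induced modules that is stable under the action on each factor
and contains the tensor product of the generators is everything. -/
theorem tensor_eq_top {N : Submodule K (⨂[K] i, InducedModule (a i) (μ i))}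
    (hN : ∀ i (x : L), ∀ t ∈ N, PiTensorLie.actAt _ i x t ∈ N)
    (hg : PiTensorProduct.tprod K (fun i => gen (a i) (μ i)) ∈ N) : N = ⊤ := by
  have step : ∀ (i : ι) (v : ∀ i, InducedModule (a i) (μ i)),
      PiTensorProduct.tprod K (Function.update v i (gen (a i) (μ i))) ∈ N →
        PiTensorProduct.tprod K v ∈ N := by
    intro i v hv
    let N' : LieSubmodule K L (InducedModule (a i) (μ i)) :=
      { toSubmodule := N.comap ((PiTensorProduct.tprod K).toLinearMap v i)
        lie_mem := fun {x u} hu => by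
          change PiTensorProduct.tprod K (Function.update v i ⁅x, u⁆) ∈ N
          have h1 : PiTensorProduct.tprod K (Function.update v i u) ∈ N := hu
          have h2 := hN i x _ h1
          rwa [PiTensorLie.actAt_tprod, Function.update_self, Function.update_idem] at h2 }
    have hN' : N' = ⊤ := eq_top_of_gen_mem N' hv
    have h1 : v i ∈ N' := by rw [hN']; trivial
    have h2 : PiTensorProduct.tprod K (Function.update v i (v i)) ∈ N := h1
    rwa [Function.update_eq_self] at h2
  -- Generators are replaced by arbitrary vectors one factor at a time.
  have key : ∀ (S : Finset ι) (v : ∀ i, InducedModule (a i) (μ i)),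
      PiTensorProduct.tprod K (S.piecewise v fun i => gen (a i) (μ i)) ∈ N := by
    intro S
    induction S using Finset.induction_on with
    | empty => intro v; rwa [Finset.piecewise_empty]
    | insert i S hi ih =>
      intro v
      refine step i _ ?_
      rw [Finset.piecewise_insert, Function.update_idem,
        show Function.update (S.piecewise v fun i => gen (a i) (μ i)) i (gen (a i) (μ i)) =
          S.piecewise v fun i => gen (a i) (μ i) from
          Function.update_eq_self_iff.2 (by simp [hi])]
      exact ih v
  refine eq_top_iff.2 fun t _ => ?_
  induction t using PiTensorProduct.induction_on with
  | smul_tprod r v =>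
    refine N.smul_mem r ?_
    simpa using key Finset.univ v
  | add s t hs ht => exact N.add_mem (hs trivial) (ht trivial)

end

end InducedModule

/-! ### Decomposing the action along the roots -/

namespace Vir

section LocalPart

variable {ι : Type*} {F : ι → ℂ[T;T⁻¹]}

/-- `y` is congruent to `x` modulo `F i ^ N` and to `0` modulo the other `F j ^ N`. -/
def IsLocalPart (F : ι → ℂ[T;T⁻¹]) (N : ℕ) (i : ι) (x y : Vir) : Prop :=
  F i ^ N ∣ θ y - θ x ∧ ∀ j, j ≠ i → F j ^ N ∣ θ y

/-- `u` is killed by all elements divisible by all `F j ^ N`. -/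
def KilledAt {M : Type*} [AddCommGroup M] [LieRingModule Vir M] (F : ι → ℂ[T;T⁻¹]) (N : ℕ)
    (u : M) : Prop :=
  ∀ x : Vir, (∀ j, F j ^ N ∣ θ x) → ⁅x, u⁆ = 0

theorem IsLocalPart.mono {N N' : ℕ} (h : N ≤ N') {i : ι} {x y : Vir}
    (hy : IsLocalPart F N' i x y) : IsLocalPart F N i x y :=
  ⟨(pow_dvd_pow _ h).trans hy.1, fun j hj => (pow_dvd_pow _ h).trans (hy.2 j hj)⟩

theorem IsLocalPart.add {N : ℕ} {i : ι} {x y x' y' : Vir}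
    (h : IsLocalPart F N i x y) (h' : IsLocalPart F N i x' y') :
    IsLocalPart F N i (x + x') (y + y') := by
  refine ⟨?_, fun j hj => ?_⟩
  · rw [map_add, map_add, add_sub_add_comm]
    exact dvd_add h.1 h'.1
  · rw [map_add]
    exact dvd_add (h.2 j hj) (h'.2 j hj)

theorem IsLocalPart.smul {N : ℕ} {i : ι} {x y : Vir} (c : ℂ)
    (h : IsLocalPart F N i x y) : IsLocalPart F N i (c • x) (c • y) := by
  refine ⟨?_, fun j hj => ?_⟩
  · rw [map_smul, map_smul, ← smul_sub]
    exact h.1.trans (Dvd.intro_left _ (LaurentPolynomial.smul_eq_C_mul c _).symm)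
  · rw [map_smul]
    exact (h.2 j hj).trans (Dvd.intro_left _ (LaurentPolynomial.smul_eq_C_mul c _).symm)

theorem dvd_wittBracket_of_pow_succ_right {g x y : ℂ[T;T⁻¹]} {N : ℕ} (h : g ^ (N + 1) ∣ y) :
    g ^ N ∣ wittBracket x y := by
  have e : wittBracket x y = -wittBracket y x := by simp only [wittBracket]; ring
  rw [e]
  exact (dvd_wittBracket_of_pow_succ h).neg_right

theorem IsLocalPart.lie {N : ℕ} {i : ι} {x y x' y' : Vir}
    (h : IsLocalPart F (N + 1) i x y) (h' : IsLocalPart F (N + 1) i x' y') :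
    IsLocalPart F N i ⁅x, x'⁆ ⁅y, y'⁆ := by
  refine ⟨?_, fun j hj => dvd_wittBracket_of_pow_succ (h.2 j hj)⟩
  have e : θ ⁅y, y'⁆ - θ ⁅x, x'⁆ =
      wittBracket (θ y - θ x) (θ y') + wittBracket (θ x) (θ y' - θ x') := by
    rw [θ_lie, θ_lie]
    simp only [wittBracket, map_sub]
    ring
  rw [e]
  exact dvd_add (dvd_wittBracket_of_pow_succ h.1) (dvd_wittBracket_of_pow_succ_right h'.1)

/-- At each root at least one of the two local parts vanishes to high order; this makes the local
actions commute. -/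
theorem IsLocalPart.dvd_lie_of_ne {N : ℕ} {i j : ι} (hij : i ≠ j) {x y x' y' : Vir}
    (h : IsLocalPart F (N + 1) i x y) (h' : IsLocalPart F (N + 1) j x' y') (l : ι) :
    F l ^ N ∣ θ ⁅y, y'⁆ := by
  by_cases hl : l = i
  · subst hl
    exact dvd_wittBracket_of_pow_succ_right (h'.2 l hij)
  · exact dvd_wittBracket_of_pow_succ (h.2 l hl)

/-- The Chinese remainder theorem for pairwise coprime powers. -/
theorem exists_isLocalPart [Fintype ι] (hF : Pairwise fun i j => IsCoprime (F i) (F j)) (N : ℕ)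
    (i : ι) (x : Vir) : ∃ y, IsLocalPart F N i x y := by
  classical
  have hc : IsCoprime (F i ^ N) (∏ j ∈ Finset.univ.erase i, F j ^ N) :=
    IsCoprime.prod_right fun j hj => (hF (Finset.ne_of_mem_erase hj).symm).pow
  obtain ⟨a, b, hab⟩ := hc
  refine ⟨lift (b * (∏ j ∈ Finset.univ.erase i, F j ^ N) * θ x), ⟨-(a * θ x), ?_⟩, fun j hj => ?_⟩
  · rw [θ_lift]
    linear_combination θ x * hab
  · rw [θ_lift]
    exact ((Finset.dvd_prod_of_mem _ (Finset.mem_erase.2 ⟨hj, Finset.mem_univ j⟩)).mul_left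
      b).mul_right _

section Module

variable {M : Type*} [AddCommGroup M] [LieRingModule Vir M]

theorem KilledAt.mono {N N' : ℕ} (h : N ≤ N') {u : M} (hu : KilledAt F N u) : KilledAt F N' u :=
  fun x hx => hu x fun j => (pow_dvd_pow _ h).trans (hx j)

theorem KilledAt.add {N : ℕ} {u w : M} (hu : KilledAt F N u) (hw : KilledAt F N w) :
    KilledAt F N (u + w) := fun x hx => by rw [lie_add, hu x hx, hw x hx, add_zero]

theorem KilledAt.lie {N : ℕ} {u : M} (hu : KilledAt F N u) (y : Vir) :
    KilledAt F (N + 1) ⁅y, u⁆ := fun x hx => by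
  rw [leibniz_lie, hu ⁅x, y⁆ fun j => dvd_wittBracket_of_pow_succ (hx j),
    hu x fun j => (pow_dvd_pow _ N.le_succ).trans (hx j), lie_zero, add_zero]

theorem KilledAt.lie_eq_lie {N : ℕ} {u : M} (hu : KilledAt F N u) {x y : Vir}
    (h : ∀ j, F j ^ N ∣ θ x - θ y) : ⁅x, u⁆ = ⁅y, u⁆ := by
  rw [← sub_eq_zero, ← sub_lie]
  exact hu _ fun j => by rw [map_sub]; exact h j

theorem IsLocalPart.lie_eq_lie {N N' : ℕ} {i : ι} {x y y' : Vir} {u : M}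
    (hu : KilledAt F N u) (hu' : KilledAt F N' u) (hy : IsLocalPart F N i x y)
    (hy' : IsLocalPart F N' i x y') : ⁅y, u⁆ = ⁅y', u⁆ := by
  have hmin : KilledAt F (min N N') u := by
    rcases le_total N N' with h | h
    · rwa [min_eq_left h]
    · rwa [min_eq_right h]
  have h1 := hy.mono (min_le_left N N')
  have h2 := hy'.mono (min_le_right N N')
  refine hmin.lie_eq_lie fun j => ?_
  by_cases hj : j = i
  · subst hj
    have := dvd_sub h1.1 h2.1
    rwa [sub_sub_sub_cancel_right] at this
  · exact dvd_sub (h1.2 j hj) (h2.2 j hj)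

variable [Module ℂ M]

/-- `ρ i x` acts on a vector killed at level `N` like any local part of `x` at level `N`. -/
def IsLocalAction (F : ι → ℂ[T;T⁻¹]) (ρ : ι → Vir →ₗ⁅ℂ⁆ Module.End ℂ M) : Prop :=
  ∀ i x u N y, KilledAt F N u → IsLocalPart F N i x y → ρ i x u = ⁅y, u⁆

variable {ρ : ι → Vir →ₗ⁅ℂ⁆ Module.End ℂ M}

theorem IsLocalAction.commute [Fintype ι] (hF : Pairwise fun i j => IsCoprime (F i) (F j))
    (hM : ∀ u : M, ∃ N, KilledAt F N u) (h : IsLocalAction F ρ) {i j : ι} (hij : i ≠ j)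
    (x x' : Vir) : Commute (ρ i x) (ρ j x') := by
  refine LinearMap.ext fun u => ?_
  obtain ⟨N, hu⟩ := hM u
  obtain ⟨y, hy⟩ := exists_isLocalPart hF (N + 1) i x
  obtain ⟨y', hy'⟩ := exists_isLocalPart hF (N + 1) j x'
  have hu' := hu.mono N.le_succ
  rw [Module.End.mul_apply, Module.End.mul_apply, h i x u _ y hu' hy, h j x' u _ y' hu' hy',
    h i x _ _ y (hu.lie y') hy, h j x' _ _ y' (hu.lie y) hy', ← sub_eq_zero, ← lie_lie]
  exact hu _ (hy.dvd_lie_of_ne hij hy')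

theorem IsLocalAction.sum_apply [Fintype ι] (hF : Pairwise fun i j => IsCoprime (F i) (F j))
    (hM : ∀ u : M, ∃ N, KilledAt F N u) (h : IsLocalAction F ρ) (x : Vir) (u : M) :
    ∑ i, ρ i x u = ⁅x, u⁆ := by
  classical
  obtain ⟨N, hu⟩ := hM u
  choose y hy using fun i => exists_isLocalPart hF N i x
  rw [Finset.sum_congr rfl fun i _ => h i x u N (y i) hu (hy i), ← _root_.sum_lie]
  refine hu.lie_eq_lie fun j => ?_
  rw [map_sum, ← Finset.add_sum_erase _ _ (Finset.mem_univ j), add_sub_right_comm]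
  exact dvd_add (hy j).1 (Finset.dvd_sum fun i hi => (hy i).2 j (Finset.ne_of_mem_erase hi).symm)

variable [LieModule ℂ Vir M]

theorem KilledAt.smul {N : ℕ} {u : M} (c : ℂ) (hu : KilledAt F N u) :
    KilledAt F N (c • u) := fun x hx => by rw [lie_smul, hu x hx, smul_zero]

/-- Local parts at different levels act alike on a killed vector. So linearity and brackets can be
checked after raising the levels until one choice serves all vectors involved; a bracket costs one
level. -/
theorem exists_isLocalAction [Fintype ι] (hF : Pairwise fun i j => IsCoprime (F i) (F j))
    (hM : ∀ u : M, ∃ N, KilledAt F N u) :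
    ∃ ρ : ι → Vir →ₗ⁅ℂ⁆ Module.End ℂ M, IsLocalAction F ρ := by
  choose K hK using hM
  choose Y hY using fun N i x => exists_isLocalPart hF N i x
  have hact : ∀ i x (u : M) N y, KilledAt F N u → IsLocalPart F N i x y →
      ⁅Y (K u) i x, u⁆ = ⁅y, u⁆ := fun i x u N y hu hy =>
    IsLocalPart.lie_eq_lie (hK u) hu (hY _ _ _) hy
  refine ⟨fun i =>
    { toFun := fun x =>
        { toFun := fun u => ⁅Y (K u) i x, u⁆
          map_add' := fun u w => ?_
          map_smul' := fun c u => ?_ }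
      map_add' := fun x x' => LinearMap.ext fun u => ?_
      map_smul' := fun c x => LinearMap.ext fun u => ?_
      map_lie' := fun {x x'} => LinearMap.ext fun u => ?_ }, hact⟩
  · have hu := (hK u).mono (Nat.le_add_right (K u) (K w))
    have hw := (hK w).mono (Nat.le_add_left (K w) (K u))
    rw [hact i x (u + w) _ _ (hu.add hw) (hY _ i x), hact i x u _ _ hu (hY _ i x),
      hact i x w _ _ hw (hY _ i x), lie_add]
  · rw [RingHom.id_apply, hact i x (c • u) _ _ ((hK u).smul c) (hY _ i x), lie_smul]
  · change _ = ⁅Y (K u) i x, u⁆ + ⁅Y (K u) i x', u⁆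
    rw [← add_lie]
    exact hact i (x + x') u _ _ (hK u) ((hY _ i x).add (hY _ i x'))
  · change _ = c • ⁅Y (K u) i x, u⁆
    rw [← smul_lie]
    exact hact i (c • x) u _ _ (hK u) ((hY _ i x).smul c)
  · change ⁅Y (K u) i ⁅x, x'⁆, u⁆ = ⁅Y (K ⁅Y (K u) i x', u⁆) i x, ⁅Y (K u) i x', u⁆⁆ -
      ⁅Y (K ⁅Y (K u) i x, u⁆) i x', ⁅Y (K u) i x, u⁆⁆
    rw [hact i x ⁅Y (K u) i x', u⁆ (K u + 1) _ ((hK u).lie _) (hY _ i x),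
      hact i x' ⁅Y (K u) i x, u⁆ (K u + 1) _ ((hK u).lie _) (hY _ i x'),
      hact i x u (K u + 1) _ ((hK u).mono (Nat.le_succ _)) (hY _ i x),
      hact i x' u (K u + 1) _ ((hK u).mono (Nat.le_succ _)) (hY _ i x'), ← lie_lie]
    exact hact _ _ _ _ _ (hK u) ((hY _ i x).lie (hY _ i x'))

end Module

end LocalPart

/-! ### The tensor product isomorphism -/

namespace Data

variable {k : ℕ} (D : Data k)

/-- The power of `t - lam i` as a Laurent polynomial. -/
noncomputable def factor (i : Fin k) : ℂ[T;T⁻¹] := toLaurent ((X - C (D.lam i)) ^ D.n i)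

theorem isCoprime_pow {i j : Fin k} (h : i ≠ j) :
    IsCoprime ((X - C (D.lam i)) ^ D.n i) ((X - C (D.lam j)) ^ D.n j) :=
  (isCoprime_X_sub_C_of_isUnit_sub (sub_ne_zero.2 (D.lam_injective.ne h)).isUnit).pow

theorem pairwise_isCoprime_factor : Pairwise fun i j => IsCoprime (D.factor i) (D.factor j) :=
  fun _ _ h => (D.isCoprime_pow h).map toLaurent

theorem coeff_zero_f : D.f.coeff 0 ≠ 0 := by
  rw [coeff_zero_eq_eval_zero, f, eval_prod]
  refine Finset.prod_ne_zero_iff.2 fun i _ => ?_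
  rw [← coeff_zero_eq_eval_zero]
  exact coeff_zero_X_sub_C_pow (D.lam_ne_zero i) _

theorem toLaurent_f : toLaurent D.f = ∏ i, D.factor i := map_prod _ _ _

theorem monic_f : D.f.Monic := monic_prod_of_monic _ _ fun _ _ => (monic_X_sub_C _).pow _

theorem exists_killedAt (u : V D.f D.sumμ) : ∃ N, KilledAt D.factor N u := by
  have hu : u ∈ nilpotentVectors (V D.f D.sumμ) (toLaurent D.f) := by
    rw [nilpotentVectors_V D.coeff_zero_f]; trivial
  obtain ⟨N, hN⟩ := hu
  refine ⟨N, fun x hx => hN x ?_⟩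
  rw [toLaurent_f, ← Finset.prod_pow]
  exact Finset.prod_dvd_of_coprime
    (fun _ _ _ _ h => (D.pairwise_isCoprime_factor h).pow) fun i _ => hx i

theorem killedAt_gen : KilledAt D.factor 2 (InducedModule.gen (poly D.f) D.sumμ) := by
  intro x hx
  have h : toLaurent D.f * toLaurent D.f ∣ θ x := by
    rw [← sq, toLaurent_f, ← Finset.prod_pow]
    exact Finset.prod_dvd_of_coprime
      (fun _ _ _ _ h => (D.pairwise_isCoprime_factor h).pow) fun i _ => hx i
  have hx' : x ∈ poly D.f := mem_poly_iff_dvd.2 ((dvd_mul_right _ _).trans h)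
  rw [InducedModule.lie_gen x hx', apply_eq_zero_of_sq_dvd D.coeff_zero_f x hx' h, zero_smul]

/-- A local part at root i kills the other tensor factors at high level. Thus the action on a single
factor is already visible in the diagonal action, and submodules are stable under it. -/
theorem exists_lie_eq_actAt (t : D.tensor) :
    ∃ N, ∀ i x y, IsLocalPart D.factor N i x y → ⁅y, t⁆ = PiTensorLie.actAt _ i x t := by
  induction t using PiTensorProduct.induction_on with
  | smul_tprod r v =>
    have hv : ∀ i, ∃ N, ∀ x, D.factor i ^ N ∣ θ x → ⁅x, v i⁆ = 0 := fun i => by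
      have h : v i ∈ nilpotentVectors _ (D.factor i) := by
        rw [factor, nilpotentVectors_V (coeff_zero_X_sub_C_pow (D.lam_ne_zero i) _)]; trivial
      exact h
    choose N hN using hv
    refine ⟨∑ j, N j, fun i x y hy => ?_⟩
    have hle : ∀ j, N j ≤ ∑ j, N j := fun j =>
      Finset.single_le_sum (fun _ _ => Nat.zero_le _) (Finset.mem_univ j)
    rw [lie_smul, map_smul, PiTensorLie.lie_tprod, PiTensorLie.actAt_tprod,
      Finset.sum_eq_single i]
    · have h := hN i (y - x) (by rw [map_sub]; exact (pow_dvd_pow _ (hle i)).trans hy.1)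
      rw [sub_lie, sub_eq_zero] at h
      rw [h]
    · intro j _ hj
      rw [hN j y ((pow_dvd_pow _ (hle j)).trans (hy.2 j hj)), MultilinearMap.map_update_zero]
    · exact fun h => absurd (Finset.mem_univ i) h
  | add s t hs ht =>
    obtain ⟨N, hN⟩ := hs
    obtain ⟨N', hN'⟩ := ht
    refine ⟨N + N', fun i x y hy => ?_⟩
    rw [lie_add, map_add, hN i x y (hy.mono (Nat.le_add_right _ _)),
      hN' i x y (hy.mono (Nat.le_add_left _ _))]

theorem actAt_mem (N : LieSubmodule ℂ Vir D.tensor) (i : Fin k) (x : Vir) (t : D.tensor)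
    (ht : t ∈ N) : PiTensorLie.actAt _ i x t ∈ N := by
  obtain ⟨n, hn⟩ := D.exists_lie_eq_actAt t
  obtain ⟨y, hy⟩ := exists_isLocalPart D.pairwise_isCoprime_factor n i x
  rw [← hn i x y hy]
  exact N.lie_mem ht

/-- The tensor product of the generators. -/
noncomputable def tensorGen : D.tensor := PiTensorProduct.tprod ℂ fun _ => InducedModule.gen _ _

theorem lie_tensorGen (x : poly D.f) : ⁅(x : Vir), D.tensorGen⁆ = D.sumμ x • D.tensorGen := by
  rw [tensorGen, PiTensorLie.lie_tprod, sumμ_apply, Finset.sum_smul]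
  refine Finset.sum_congr rfl fun i _ => ?_
  rw [InducedModule.lie_gen (x : Vir) (D.poly_f_le i x.2), MultilinearMap.map_update_smul,
    Function.update_eq_self]

theorem eq_top_of_tensorGen_mem (N : LieSubmodule ℂ Vir D.tensor) (h : D.tensorGen ∈ N) :
    N = ⊤ := by
  have := InducedModule.tensor_eq_top (N := N.toSubmodule) (fun i x t ht => D.actAt_mem N i x t ht)
    h
  exact LieSubmodule.toSubmodule_injective this

theorem exists_tensor_retraction :
    ∃ Ψ : D.tensor →ₗ⁅ℂ, Vir⁆ V D.f D.sumμ, Ψ D.tensorGen = InducedModule.gen _ _ := by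
  obtain ⟨ρ, hρ⟩ := exists_isLocalAction D.pairwise_isCoprime_factor D.exists_killedAt
  obtain ⟨Ψ, hΨg, hΨ⟩ := InducedModule.exists_linearMap_tensor
    (a := fun i => poly ((X - C (D.lam i)) ^ D.n i)) (μ := D.μ) ρ
    (fun i j hij x y => hρ.commute D.pairwise_isCoprime_factor D.exists_killedAt hij x y)
    (InducedModule.gen (poly D.f) D.sumμ) (fun i x => by
      -- Level 2 suffices: `gen` is killed at level 2, each μ_j with j ≠ i kills y because the
      -- square of its factor divides y, and μ_i cannot distinguish y from x.
      obtain ⟨y, hy⟩ := exists_isLocalPart D.pairwise_isCoprime_factor 2 i x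
      rw [hρ i x _ 2 y D.killedAt_gen hy]
      have hi : ∀ j, j ≠ i → D.factor j * D.factor j ∣ θ y := fun j hj => by
        rw [← sq]; exact hy.2 j hj
      have hyi : y ∈ poly ((X - C (D.lam i)) ^ D.n i) := by
        rw [mem_poly_iff_dvd]
        have h1 := mem_poly_iff_dvd.1 x.2
        have h2 := (dvd_pow_self (D.factor i) two_ne_zero).trans hy.1
        have := dvd_add h2 h1
        rwa [sub_add_cancel] at this
      have hyf : y ∈ poly D.f := by
        rw [mem_poly_iff_dvd, toLaurent_f]
        refine Finset.prod_dvd_of_coprime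
          (fun _ _ _ _ h => D.pairwise_isCoprime_factor h) fun j _ => ?_
        by_cases hj : j = i
        · subst hj
          exact mem_poly_iff_dvd.1 hyi
        · exact (dvd_mul_right _ _).trans (hi j hj)
      rw [InducedModule.lie_gen y hyf]
      congr 1
      rw [sumμ_apply, Finset.sum_eq_single i]
      · rw [← sub_eq_zero, ← map_sub]
        refine apply_eq_zero_of_sq_dvd (coeff_zero_X_sub_C_pow (D.lam_ne_zero i) _) _ _ ?_
        rw [← sq, map_sub]
        exact hy.1
      · intro j _ hj
        exact apply_eq_zero_of_sq_dvd (coeff_zero_X_sub_C_pow (D.lam_ne_zero j) _) _ _ (hi j hj)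
      · exact fun h => absurd (Finset.mem_univ i) h)
  refine ⟨{ toLinearMap := Ψ, map_lie' := fun {x t} => ?_ }, hΨg⟩
  change Ψ (PiTensorLie.act _ x t) = ⁅x, Ψ t⁆
  rw [PiTensorLie.act, LinearMap.sum_apply, map_sum,
    ← hρ.sum_apply D.pairwise_isCoprime_factor D.exists_killedAt]
  exact Finset.sum_congr rfl fun i _ => hΨ i x t

/-- The map Φ sending generator to generator has left inverse Ψ by uniqueness of maps on `gen`, and
is onto because the tensor product of the generators generates. -/
theorem nonempty_tensor_equiv : Nonempty (D.tensor ≃ₗ⁅ℂ, Vir⁆ V D.f D.sumμ) := by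
  obtain ⟨Ψ, hΨ⟩ := D.exists_tensor_retraction
  obtain ⟨Φ, hΦ⟩ := InducedModule.exists_hom (a := poly D.f) (μ := D.sumμ) D.tensorGen
    D.lie_tensorGen
  have h1 : ∀ u, Ψ (Φ u) = u := fun u => by
    have : Ψ.comp Φ = LieModuleHom.id := InducedModule.hom_ext (by
      rw [LieModuleHom.comp_apply, hΦ, hΨ, LieModuleHom.id_apply])
    exact congrArg (fun φ : V D.f D.sumμ →ₗ⁅ℂ, Vir⁆ V D.f D.sumμ => φ u) this
  have h2 : ∀ t, Φ (Ψ t) = t := fun t => by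
    have h3 : Φ.range = ⊤ := D.eq_top_of_tensorGen_mem _ ⟨_, hΦ⟩
    have h4 : t ∈ Φ.range := by rw [h3]; trivial
    obtain ⟨u, rfl⟩ := Φ.mem_range t |>.1 h4
    rw [h1]
  exact ⟨{ toLieModuleHom := Ψ, invFun := Φ, left_inv := h2, right_inv := h1 }⟩

end Data

end Vir

/-! ### Tensor products of simple induced modules -/

namespace InducedModule

variable {K L : Type*} [Field K] [LieRing L] [LieAlgebra K L]

section

variable {a : LieSubalgebra K L} {μ : a →ₗ⁅K⁆ K}

theorem isSimpleModule [h : LieModule.IsIrreducible K L (InducedModule a μ)] :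
    IsSimpleModule (UniversalEnvelopingAlgebra K L) (InducedModule a μ) := by
  have hsub : ∀ N : Submodule (UniversalEnvelopingAlgebra K L) (InducedModule a μ),
      N = ⊥ ∨ N = ⊤ := by
    intro N
    let N' : LieSubmodule K L (InducedModule a μ) :=
      { carrier := N
        add_mem' := N.add_mem
        zero_mem' := N.zero_mem
        smul_mem' := fun c u hu => by
          rw [← algebraMap_smul (UniversalEnvelopingAlgebra K L) c u]
          exact N.smul_mem _ hu
        lie_mem := fun {x u} hu => N.smul_mem (UniversalEnvelopingAlgebra.ι K x) hu }
    rcases h.eq_bot_or_eq_top N' with h1 | h1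
    · left
      refine (Submodule.eq_bot_iff N).2 fun u hu => ?_
      have : u ∈ N' := hu
      rwa [h1, LieSubmodule.mem_bot] at this
    · right
      refine eq_top_iff.2 fun u _ => ?_
      have : u ∈ N' := by rw [h1]; trivial
      exact this
  have : Nontrivial (InducedModule a μ) := by
    obtain ⟨N, N', hN⟩ := h.exists_pair_ne
    by_contra hn
    rw [not_nontrivial_iff_subsingleton] at hn
    refine hN (LieSubmodule.ext _ _ fun u => ?_)
    rw [Subsingleton.elim u 0]
    exact iff_of_true N.zero_mem N'.zero_mem
  have : IsSimpleOrder (Submodule (UniversalEnvelopingAlgebra K L) (InducedModule a μ)) :=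
    { eq_bot_or_eq_top := hsub }
  exact isSimpleModule_iff .. |>.2 this

/-- A consequence of the Jacobson density theorem. -/
theorem exists_smul_eq [LieModule.IsIrreducible K L (InducedModule a μ)]
    (hμ : ∀ u : InducedModule a μ, (∀ x : a, ⁅(x : L), u⁆ = μ x • u) →
      u ∈ Submodule.span K {gen a μ})
    {κ : Type*} (b : Module.Basis κ K (InducedModule a μ)) (s : Finset κ)
    (w : κ → InducedModule a μ) :
    ∃ r : UniversalEnvelopingAlgebra K L, ∀ j ∈ s, r • b j = w j := by
  classical
  have := isSimpleModule (a := a) (μ := μ)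
  -- An endomorphism sends `gen` to an eigenvector with character μ, hence to a multiple of `gen`.
  have hend : ∀ φ : Module.End (UniversalEnvelopingAlgebra K L) (InducedModule a μ),
      ∃ c : K, ∀ u, φ u = c • u := by
    intro φ
    obtain ⟨c, hc⟩ := Submodule.mem_span_singleton.1 (hμ (φ (gen a μ)) fun x => by
      rw [lie_eq_smul, ← map_smul, ← lie_eq_smul, lie_gen (x : L) x.2,
        ← algebraMap_smul (UniversalEnvelopingAlgebra K L), map_smul, algebraMap_smul])
    refine ⟨c, fun u => ?_⟩
    obtain ⟨r, rfl⟩ := exists_smul_gen u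
    rw [map_smul, ← hc, ← algebraMap_smul (UniversalEnvelopingAlgebra K L) c,
      ← algebraMap_smul (UniversalEnvelopingAlgebra K L) c, smul_smul, smul_smul,
      Algebra.commutes]
  let f : Module.End (Module.End (UniversalEnvelopingAlgebra K L) (InducedModule a μ))
      (InducedModule a μ) :=
    { toFun := b.constr K w
      map_add' := map_add _
      map_smul' := fun φ u => by
        obtain ⟨c, hc⟩ := hend φ
        rw [RingHom.id_apply, Module.End.smul_def, Module.End.smul_def, hc, hc, map_smul] }
  obtain ⟨r, hr⟩ := jacobson_density f (s.image b)
  refine ⟨r, fun j hj => ?_⟩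
  rw [← hr _ (Finset.mem_image_of_mem b hj)]
  exact b.constr_basis K w j

end

section

variable {ι : Type*} [DecidableEq ι]
variable {a : ι → LieSubalgebra K L} {μ : ∀ i, a i →ₗ⁅K⁆ K}

theorem map_update_toEnd_mem {N : Submodule K (⨂[K] i, InducedModule (a i) (μ i))}
    (hN : ∀ i (x : L), ∀ t ∈ N, PiTensorLie.actAt _ i x t ∈ N) (i : ι)
    (r : UniversalEnvelopingAlgebra K L) :
    ∀ t ∈ N, PiTensorProduct.map (Function.update (fun _ => 1) i
      (UniversalEnvelopingAlgebra.toEnd K L (InducedModule (a i) (μ i)) r)) t ∈ N := by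
  induction r using UniversalEnvelopingAlgebra.induction_ι with
  | halg c =>
    intro t ht
    rw [AlgHom.commutes, Algebra.algebraMap_eq_smul_one, PiTensorProduct.map_update_smul,
      Function.update_eq_self_iff.2 rfl]
    have : PiTensorProduct.map (fun j => (1 : Module.End K (InducedModule (a j) (μ j)))) =
      LinearMap.id := PiTensorProduct.map_id
    rw [this]
    exact N.smul_mem c ht
  | hι x =>
    intro t ht
    rw [UniversalEnvelopingAlgebra.toEnd, UniversalEnvelopingAlgebra.lift_ι_apply]
    exact hN i x t ht
  | hadd r r' hr hr' =>
    intro t ht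
    rw [map_add, PiTensorProduct.map_update_add]
    exact N.add_mem (hr t ht) (hr' t ht)
  | hmul r r' hr hr' =>
    intro t ht
    have e := hr _ (hr' t ht)
    rw [← LinearMap.comp_apply, ← PiTensorProduct.map_comp] at e
    convert e using 3
    funext j
    by_cases hj : j = i
    · subst hj
      rw [Function.update_self, Function.update_self, Function.update_self, map_mul]
      rfl
    · rw [Function.update_of_ne hj, Function.update_of_ne hj, Function.update_of_ne hj]
      rfl

variable [Fintype ι]

theorem map_toEnd_mem {N : Submodule K (⨂[K] i, InducedModule (a i) (μ i))}
    (hN : ∀ i (x : L), ∀ t ∈ N, PiTensorLie.actAt _ i x t ∈ N)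
    (r : ι → UniversalEnvelopingAlgebra K L) {t} (ht : t ∈ N) :
    PiTensorProduct.map (fun i => UniversalEnvelopingAlgebra.toEnd K L
      (InducedModule (a i) (μ i)) (r i)) t ∈ N := by
  have key : ∀ S : Finset ι, PiTensorProduct.map (S.piecewise (fun i =>
      UniversalEnvelopingAlgebra.toEnd K L (InducedModule (a i) (μ i)) (r i)) fun _ => 1) t ∈ N := by
    intro S
    induction S using Finset.induction_on with
    | empty =>
      rw [Finset.piecewise_empty]
      have : PiTensorProduct.map (fun j => (1 : Module.End K (InducedModule (a j) (μ j)))) =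
        LinearMap.id := PiTensorProduct.map_id
      rwa [this]
    | insert i S hi ih =>
      have e := map_update_toEnd_mem hN i (r i) _ ih
      rw [← LinearMap.comp_apply, ← PiTensorProduct.map_comp] at e
      convert e using 3
      funext j
      rw [Finset.piecewise_insert]
      by_cases hj : j = i
      · subst hj
        rw [Function.update_self, Function.update_self, Finset.piecewise_eq_of_notMem _ _ _ hi]
        rfl
      · rw [Function.update_of_ne hj, Function.update_of_ne hj]
        rfl
  have := key Finset.univ
  rwa [Finset.piecewise_univ] at this

/-- For a nonzero t in N pick a basis tensor occurring in it. Density gives in each factor an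
element of U(L) sending the chosen basis vector to `gen` and the other basis vectors occurring there
to zero. Their tensor product maps t to a nonzero multiple of the tensor product of the generators.
-/
theorem tensor_eq_bot_or_eq_top [∀ i, LieModule.IsIrreducible K L (InducedModule (a i) (μ i))]
    (hμ : ∀ i, ∀ u : InducedModule (a i) (μ i), (∀ x : a i, ⁅(x : L), u⁆ = μ i x • u) →
      u ∈ Submodule.span K {gen (a i) (μ i)})
    {N : Submodule K (⨂[K] i, InducedModule (a i) (μ i))}
    (hN : ∀ i (x : L), ∀ t ∈ N, PiTensorLie.actAt _ i x t ∈ N) : N = ⊥ ∨ N = ⊤ := by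
  classical
  refine or_iff_not_imp_left.2 fun hbot => tensor_eq_top hN ?_
  obtain ⟨t, htN, ht0⟩ := Submodule.exists_mem_ne_zero_of_ne_bot hbot
  let b := fun i => Module.Basis.ofVectorSpace K (InducedModule (a i) (μ i))
  let B := Basis.piTensorProduct b
  obtain ⟨q, hq⟩ : ∃ q, B.repr t q ≠ 0 := by
    by_contra! h
    exact ht0 (B.repr.map_eq_zero_iff.1 (Finsupp.ext h))
  choose r hr using fun i => exists_smul_eq (hμ i) (b i) ((B.repr t).support.image fun p => p i)
    (fun j => if j = q i then gen (a i) (μ i) else 0)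
  have h1 := map_toEnd_mem hN r htN
  have h2 : PiTensorProduct.map (fun i => UniversalEnvelopingAlgebra.toEnd K L
      (InducedModule (a i) (μ i)) (r i)) t =
      B.repr t q • PiTensorProduct.tprod K fun i => gen (a i) (μ i) := by
    conv_lhs => rw [← B.linearCombination_repr t, Finsupp.linearCombination_apply, Finsupp.sum,
      map_sum]
    rw [Finset.sum_eq_single q]
    · rw [map_smul, Basis.piTensorProduct_apply, PiTensorProduct.map_tprod]
      congr 2
      funext i
      rw [toEnd_apply, hr i _ (Finset.mem_image_of_mem _ (Finsupp.mem_support_iff.2 hq)),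
        if_pos rfl]
    · intro p hp hpq
      obtain ⟨i, hi⟩ := Function.ne_iff.1 hpq
      rw [map_smul, Basis.piTensorProduct_apply, PiTensorProduct.map_tprod,
        MultilinearMap.map_coord_zero _ i, smul_zero]
      rw [toEnd_apply, hr i _ (Finset.mem_image_of_mem _ hp), if_neg hi]
    · exact fun h => absurd (Finsupp.mem_support_iff.2 hq) h
  rw [h2] at h1
  exact (N.smul_mem_iff hq).1 h1

end

end InducedModule

/-! ### Simplicity under the degree condition -/

namespace Vir.Data

variable {k : ℕ} (D : Data k) {p : Fin k → ℂ[X]}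

theorem isIrreducible (hp : ∀ i, IsAssociated (D.lam i) (D.n i) (D.μ i) (p i))
    (hdeg : ∀ i, (D.n i : WithBot ℕ) ≤ (p i).degree + 2) :
    LieModule.IsIrreducible ℂ Vir (V D.f D.sumμ) := by
  obtain ⟨e⟩ := D.nonempty_tensor_equiv
  have : ∀ i, LieModule.IsIrreducible ℂ Vir (V ((X - C (D.lam i)) ^ D.n i) (D.μ i)) := fun i =>
    (hp i).isIrreducible (D.lam_ne_zero i) (D.n_pos i) (hdeg i)
  have : Nontrivial (V D.f D.sumμ) := ⟨_, _, gen_ne_zero D.monic_f D.coeff_zero_f _⟩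
  refine LieModule.IsIrreducible.mk fun N hN => ?_
  have h := InducedModule.tensor_eq_bot_or_eq_top
    (fun i u hu => (hp i).mem_span_gen (D.lam_ne_zero i) (D.n_pos i) (hdeg i) u
      fun x hx => hu ⟨x, hx⟩)
    (N := (N.comap e.toLieModuleHom).toSubmodule)
    (fun i x t ht => D.actAt_mem (N.comap e.toLieModuleHom) i x t ht)
  rcases h with h | h
  · refine absurd ((LieSubmodule.eq_bot_iff N).2 fun u hu => ?_) hN
    have h1 : e.symm u ∈ (N.comap e.toLieModuleHom).toSubmodule := by
      change e (e.symm u) ∈ N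
      rwa [LieModuleEquiv.apply_symm_apply]
    rw [h, Submodule.mem_bot] at h1
    rw [← e.apply_symm_apply u, h1]
    exact map_zero e.toLieModuleHom
  · refine eq_top_iff.2 fun u _ => ?_
    have h1 : e.symm u ∈ (N.comap e.toLieModuleHom).toSubmodule := by rw [h]; trivial
    have h2 : e (e.symm u) ∈ N := h1
    rwa [LieModuleEquiv.apply_symm_apply] at h2

end Vir.Data

/-! ### Modules that are not simple -/

namespace Vir

/-- A linear form vanishing on brackets restricts to a homomorphism. -/
noncomputable def characterOfForm (a : LieSubalgebra ℂ Vir) (ν : Vir →ₗ[ℂ] ℂ)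
    (h : ∀ x ∈ a, ∀ y ∈ a, ν ⁅x, y⁆ = 0) : a →ₗ⁅ℂ⁆ ℂ where
  toLinearMap := ν ∘ₗ a.toSubmodule.subtype
  map_lie' {x y} := by
    rw [LieRing.of_associative_ring_bracket]
    change ν ⁅(x : Vir), (y : Vir)⁆ = ν x * ν y - ν y * ν x
    rw [h x x.2 y y.2, mul_comm, sub_self]

theorem exists_form_eq {a : LieSubalgebra ℂ Vir} (μ : a →ₗ⁅ℂ⁆ ℂ) :
    ∃ ν : Vir →ₗ[ℂ] ℂ, ∀ x : a, ν x = μ x := by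
  obtain ⟨ν, hν⟩ := LinearMap.exists_extend (p := a.toSubmodule) μ.toLinearMap
  exact ⟨ν, fun x => LinearMap.congr_fun hν x⟩

/-- ν defines a character of the larger subalgebra. The induced map to its module is nonzero, hence
injective by simplicity, and the relation holds for the generator of the target. -/
theorem lie_gen_of_isIrreducible {f f' : ℂ[X]} (hf' : f'.Monic) (h0 : f'.coeff 0 ≠ 0)
    (hle : poly f ≤ poly f') {μ : poly f →ₗ⁅ℂ⁆ ℂ} [h : LieModule.IsIrreducible ℂ Vir (V f μ)]
    (ν : Vir →ₗ[ℂ] ℂ) (hν : ∀ x : poly f, ν x = μ x)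
    (hlie : ∀ x ∈ poly f', ∀ y ∈ poly f', ν ⁅x, y⁆ = 0) (x : Vir) (hx : x ∈ poly f') :
    ⁅x, InducedModule.gen _ μ⁆ = ν x • InducedModule.gen _ μ := by
  let μ' := characterOfForm (poly f') ν hlie
  obtain ⟨φ, hφ⟩ := InducedModule.exists_hom (a := poly f) (μ := μ)
    (InducedModule.gen (poly f') μ') (fun y => by
      rw [InducedModule.lie_gen (y : Vir) (hle y.2), ← hν]
      rfl)
  have hker : φ.ker = ⊥ := by
    refine (h.eq_bot_or_eq_top _).resolve_right fun htop => gen_ne_zero hf' h0 μ' ?_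
    have h1 : InducedModule.gen _ μ ∈ φ.ker := by rw [htop]; trivial
    rw [← hφ]
    exact LieModuleHom.mem_ker.1 h1
  have h1 : ⁅x, InducedModule.gen _ μ⁆ - ν x • InducedModule.gen _ μ ∈ φ.ker := by
    rw [LieModuleHom.mem_ker, map_sub, map_smul, LieModuleHom.map_lie, hφ,
      InducedModule.lie_gen x hx]
    exact sub_self _
  rw [hker, LieSubmodule.mem_bot] at h1
  exact sub_eq_zero.1 h1

theorem IsAssociated.onMul_eq_zero {lam : ℂ} {n : ℕ} {μ : poly ((X - C lam) ^ n) →ₗ⁅ℂ⁆ ℂ}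
    (hp : IsAssociated lam n μ 0) (g : ℂ[T;T⁻¹]) : onMul μ g = 0 := by
  have h : onMul μ = 0 := ext_T fun j => by
    rw [hp.onMul_T, eval_zero, zero_mul, LinearMap.zero_apply]
  rw [h, LinearMap.zero_apply]

namespace Data

variable {k : ℕ} (D : Data k) (i : Fin k)

/-- `f` with one factor `t - lam i` removed. -/
noncomputable def deflate : ℂ[X] :=
  (∏ j ∈ Finset.univ.erase i, (X - C (D.lam j)) ^ D.n j) * (X - C (D.lam i)) ^ (D.n i - 1)

theorem deflate_mul : D.deflate i * (X - C (D.lam i)) = D.f := by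
  rw [deflate, mul_assoc, ← pow_succ, Nat.sub_add_cancel (D.n_pos i),
    Finset.prod_erase_mul _ _ (Finset.mem_univ i), f]

theorem monic_deflate : (D.deflate i).Monic :=
  (monic_prod_of_monic _ _ fun _ _ => (monic_X_sub_C _).pow _).mul ((monic_X_sub_C _).pow _)

theorem coeff_zero_deflate : (D.deflate i).coeff 0 ≠ 0 := by
  have h := D.coeff_zero_f
  rw [← D.deflate_mul i, mul_coeff_zero] at h
  exact left_ne_zero_of_mul h

theorem dvd_deflate {j : Fin k} (hj : j ≠ i) : (X - C (D.lam j)) ^ D.n j ∣ D.deflate i :=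
  (Finset.dvd_prod_of_mem _ (Finset.mem_erase.2 ⟨hj, Finset.mem_univ j⟩)).mul_right _

theorem poly_f_le_deflate : poly D.f ≤ poly (D.deflate i) :=
  poly_le_of_dvd (Dvd.intro _ (D.deflate_mul i))

theorem eval_deflate_ne_zero (hn : D.n i = 1) : (D.deflate i).eval (D.lam i) ≠ 0 := by
  rw [deflate, hn, Nat.sub_self, pow_zero, mul_one, eval_prod]
  refine Finset.prod_ne_zero_iff.2 fun j hj => ?_
  rw [eval_pow, eval_sub, eval_X, eval_C]
  exact pow_ne_zero _ (sub_ne_zero.2 (D.lam_injective.ne (Finset.ne_of_mem_erase hj).symm))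

theorem lift_deflate_notMem : lift (toLaurent (D.deflate i)) ∉ poly D.f := by
  rw [mem_poly_iff_dvd, θ_lift, toLaurent_dvd_toLaurent D.coeff_zero_f]
  intro h
  have h1 := natDegree_le_of_dvd h (D.monic_deflate i).ne_zero
  rw [← D.deflate_mul i, (D.monic_deflate i).natDegree_mul (monic_X_sub_C _), natDegree_X_sub_C]
    at h1
  omega

theorem lift_deflate_mem : lift (toLaurent (D.deflate i)) ∈ poly (D.deflate i) :=
  mem_poly_iff_dvd.2 dvd_rfl

theorem sq_dvd_lie {f : ℂ[X]} {x y : Vir} (hx : x ∈ poly f) (hy : y ∈ poly f) :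
    toLaurent f * toLaurent f ∣ θ ⁅x, y⁆ := by
  obtain ⟨a, ha⟩ := mem_poly_iff_dvd.1 hx
  obtain ⟨b, hb⟩ := mem_poly_iff_dvd.1 hy
  rw [θ_lie, ha, hb, wittBracket_mul_mul]
  exact dvd_mul_right _ _

/-- Here μ_i = 0, so the sum of the other μ_j extends to the deflated subalgebra, against
`lie_gen_ne_smul_of_simple_root`. The two-extension argument needs f to divide the square of f / (t
- lam i), which fails at a simple root. -/
theorem not_isIrreducible_of_simple_root (hn : D.n i = 1)
    (hp : IsAssociated (D.lam i) (D.n i) (D.μ i) 0) :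
    ¬ LieModule.IsIrreducible ℂ Vir (V D.f D.sumμ) := by
  intro h
  choose ν hν using fun j => exists_form_eq (D.μ j)
  have h0 : ∀ x (hx : x ∈ poly ((X - C (D.lam i)) ^ D.n i)), D.μ i ⟨x, hx⟩ = 0 := by
    intro x hx
    obtain ⟨g, hg⟩ := mem_poly_iff_dvd.1 hx
    rw [apply_eq_onMul (coeff_zero_X_sub_C_pow (D.lam_ne_zero i) _) x g hx hg, hp.onMul_eq_zero]
  have key : ∀ (f : ℂ[X]) (μ : poly f →ₗ⁅ℂ⁆ ℂ) (_ : f = D.deflate i * (X - C (D.lam i))) (κ : ℂ),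
      ⁅lift (toLaurent (D.deflate i)), InducedModule.gen _ μ⁆ ≠ κ • InducedModule.gen _ μ := by
    rintro f μ rfl κ
    exact lie_gen_ne_smul_of_simple_root (D.monic_deflate i) (D.coeff_zero_deflate i)
      (D.lam_ne_zero i) (D.eval_deflate_ne_zero i hn) μ κ
  refine key D.f D.sumμ (D.deflate_mul i).symm _ (lie_gen_of_isIrreducible (D.monic_deflate i)
    (D.coeff_zero_deflate i) (D.poly_f_le_deflate i) (∑ j ∈ Finset.univ.erase i, ν j)
    (fun x => ?_) (fun x hx y hy => ?_) _ (D.lift_deflate_mem i))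
  · rw [sumμ_apply, LinearMap.sum_apply, ← Finset.add_sum_erase _ _ (Finset.mem_univ i), h0,
      zero_add]
    exact Finset.sum_congr rfl fun j _ => hν j ⟨x, D.poly_f_le j x.2⟩
  · rw [LinearMap.sum_apply]
    refine Finset.sum_eq_zero fun j hj => ?_
    have hle := poly_le_of_dvd (D.dvd_deflate i (Finset.ne_of_mem_erase hj))
    rw [← map_lie_eq_zero (D.μ j) ⟨x, hle hx⟩ ⟨y, hle hy⟩, ← hν]
    rfl

/-- Brackets in the deflated subalgebra are divisible by the square of f / (t - lam i). At lam i its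
order is 2n - 2 = n + (n - 2), where μ_i vanishes as deg p < n - 2. So every linear extension of μ
is a character there, and two of them give `gen` different eigenvalues. -/
theorem not_isIrreducible_of_multiple_root {p : ℂ[X]} (hn : 2 ≤ D.n i)
    (hp : IsAssociated (D.lam i) (D.n i) (D.μ i) p) (hdeg : p.degree + 2 < D.n i) :
    ¬ LieModule.IsIrreducible ℂ Vir (V D.f D.sumμ) := by
  intro h
  obtain ⟨ν, hν⟩ := exists_form_eq D.sumμ
  obtain ⟨δ, hδ, hker⟩ := Submodule.exists_le_ker_of_notMem (p := (poly D.f).toSubmodule)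
    (D.lift_deflate_notMem i)
  have hi : (X - C (D.lam i)) ^ (D.n i + (D.n i - 2)) ∣ D.deflate i * D.deflate i := by
    rw [deflate, mul_mul_mul_comm, ← pow_add,
      show D.n i + (D.n i - 2) = D.n i - 1 + (D.n i - 1) by omega]
    exact dvd_mul_left _ _
  have hf : D.f ∣ D.deflate i * D.deflate i := by
    rw [← D.deflate_mul i]
    refine mul_dvd_mul_left _ ((dvd_pow_self _ ?_).mul_left _)
    omega
  have hmem : ∀ x ∈ poly (D.deflate i), ∀ y ∈ poly (D.deflate i), ⁅x, y⁆ ∈ poly D.f := by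
    intro x hx y hy
    rw [mem_poly_iff_dvd]
    refine (_root_.map_dvd toLaurent hf).trans ?_
    rw [map_mul toLaurent]
    exact sq_dvd_lie hx hy
  have hsum : ∀ x ∈ poly (D.deflate i), ∀ y ∈ poly (D.deflate i), ν ⁅x, y⁆ = 0 := by
    intro x hx y hy
    rw [hν ⟨_, hmem x hx y hy⟩, sumμ_apply]
    refine Finset.sum_eq_zero fun j _ => ?_
    have h0 := coeff_zero_X_sub_C_pow (D.lam_ne_zero j) (D.n j)
    have hdvd := sq_dvd_lie hx hy
    by_cases hj : j = i
    · subst hj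
      rw [← map_mul toLaurent] at hdvd
      obtain ⟨g, hg⟩ := (_root_.map_dvd toLaurent hi).trans hdvd
      rw [pow_add, map_mul toLaurent, mul_assoc] at hg
      rw [apply_eq_onMul h0 _ _ _ hg]
      rcases eq_or_ne p 0 with rfl | hp0
      · exact hp.onMul_eq_zero _
      · rw [mul_comm]
        refine hp.onMul_mul_pow_eq_zero (D.lam_ne_zero j) ?_ g
        rw [degree_eq_natDegree hp0] at hdeg
        have : p.natDegree + 2 < D.n j := by exact_mod_cast hdeg
        omega
    · have h1 := _root_.map_dvd toLaurent (D.dvd_deflate i hj)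
      exact apply_eq_zero_of_sq_dvd h0 _ _ ((mul_dvd_mul h1 h1).trans hdvd)
  have h1 := lie_gen_of_isIrreducible (D.monic_deflate i) (D.coeff_zero_deflate i)
    (D.poly_f_le_deflate i) ν hν hsum _ (D.lift_deflate_mem i)
  have h2 := lie_gen_of_isIrreducible (D.monic_deflate i) (D.coeff_zero_deflate i)
    (D.poly_f_le_deflate i) (μ := D.sumμ) (ν + δ)
    (fun x => by rw [LinearMap.add_apply, hν, show δ x = 0 from hker x.2, add_zero])
    (fun x hx y hy => by
      rw [LinearMap.add_apply, hsum x hx y hy, show δ ⁅x, y⁆ = 0 from hker (hmem x hx y hy),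
        add_zero]) _ (D.lift_deflate_mem i)
  rw [h1, LinearMap.add_apply, add_smul, left_eq_add, smul_eq_zero] at h2
  exact h2.elim hδ (gen_ne_zero D.monic_f D.coeff_zero_f _)

theorem isIrreducible_iff {p : Fin k → ℂ[X]}
    (hp : ∀ i, IsAssociated (D.lam i) (D.n i) (D.μ i) (p i)) :
    LieModule.IsIrreducible ℂ Vir (V D.f D.sumμ) ↔
      ∀ i, (D.n i : WithBot ℕ) ≤ (p i).degree + 2 := by
  refine ⟨fun h => ?_, D.isIrreducible hp⟩
  by_contra! hdeg
  obtain ⟨i, hi⟩ := hdeg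
  rcases (D.n_pos i).eq_or_lt with hn | hn
  -- For n = 1 the degree condition fails only for p = 0.
  · refine D.not_isIrreducible_of_simple_root i hn.symm ?_ h
    have hp0 : p i = 0 := by
      by_contra hp0
      rw [degree_eq_natDegree hp0, ← hn] at hi
      have : (p i).natDegree + 2 < 1 := by exact_mod_cast hi
      omega
    rw [← hp0]
    exact hp i
  · exact D.not_isIrreducible_of_multiple_root i hn (hp i) hi h

end Data

end Vir

/-! ### Decomposing a character along the roots of a polynomial -/

/-- Bernoulli polynomials satisfy B_{n+1}(x + 1) - B_{n+1}(x) = (n + 1) x^n. -/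
theorem Polynomial.exists_eval_add_one_sub_eval (p : ℂ[X]) :
    ∃ q : ℂ[X], ∀ x : ℂ, q.eval (x + 1) - q.eval x = p.eval x := by
  induction p using Polynomial.induction_on' with
  | add p p' hp hp' =>
    obtain ⟨q, hq⟩ := hp
    obtain ⟨q', hq'⟩ := hp'
    refine ⟨q + q', fun x => ?_⟩
    rw [eval_add, eval_add, eval_add, ← hq, ← hq']
    ring
  | monomial n a =>
    refine ⟨C (a / (n + 1)) * (Polynomial.bernoulli (n + 1)).map (algebraMap ℚ ℂ), fun x => ?_⟩
    have hn : (n : ℂ) + 1 ≠ 0 := Nat.cast_add_one_ne_zero n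
    have h := congrArg (fun r : ℚ[X] => (r.map (algebraMap ℚ ℂ)).eval x)
      (Polynomial.bernoulli_comp_one_add_X (n + 1))
    simp only [Polynomial.map_comp, eval_comp, Polynomial.map_add, Polynomial.map_one, map_X,
      eval_add, eval_one, eval_X, nsmul_eq_mul, Polynomial.map_mul, Polynomial.map_natCast,
      eval_mul, eval_natCast, Polynomial.map_pow, eval_pow, Nat.add_sub_cancel] at h
    rw [eval_mul, eval_mul, eval_C, eval_C, add_comm x 1, h, eval_monomial]
    push_cast
    field_simp
    ring

namespace Vir

/-- The values ν(t^j) satisfy a recurrence with the single characteristic root lam. Removing one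
factor t - lam leaves a difference equation for the polynomial, solved by an antidifference and a
constant fitted at j = 0. -/
theorem exists_eval_mul_zpow {lam : ℂ} (hlam : lam ≠ 0) (n : ℕ) (ν : ℂ[T;T⁻¹] →ₗ[ℂ] ℂ)
    (hν : ∀ g, ν (g * toLaurent ((X - C lam) ^ n)) = 0) :
    ∃ p : ℂ[X], ∀ j : ℤ, ν (LaurentPolynomial.T j) = p.eval (j : ℂ) * lam ^ j := by
  induction n generalizing ν with
  | zero =>
    refine ⟨0, fun j => ?_⟩
    have := hν (LaurentPolynomial.T j)
    rwa [pow_zero, map_one toLaurent, mul_one, ← zero_mul (lam ^ j), ← eval_zero (x := (j : ℂ))]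
      at this
  | succ n ih =>
    obtain ⟨p, hp⟩ := ih (ν ∘ₗ LinearMap.mulRight ℂ (toLaurent (X - C lam))) fun g => by
      rw [LinearMap.comp_apply, LinearMap.mulRight_apply, mul_assoc, ← map_mul toLaurent,
        ← pow_succ, hν]
    obtain ⟨q, hq⟩ := exists_eval_add_one_sub_eval (C lam⁻¹ * p)
    have step : ∀ j : ℤ, ν (LaurentPolynomial.T (j + 1)) - lam * ν (LaurentPolynomial.T j) =
        p.eval (j : ℂ) * lam ^ j := by
      intro j
      rw [← hp, LinearMap.comp_apply, LinearMap.mulRight_apply, map_sub toLaurent, toLaurent_X,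
        toLaurent_C, mul_sub, map_sub ν, LaurentPolynomial.T_add,
        mul_comm (LaurentPolynomial.T j) (LaurentPolynomial.C lam),
        ← LaurentPolynomial.smul_eq_C_mul, map_smul ν, smul_eq_mul]
    have hstep : ∀ j : ℤ, q.eval ((j : ℂ) + 1) = q.eval (j : ℂ) + lam⁻¹ * p.eval (j : ℂ) := by
      intro j
      have := hq j
      rw [eval_mul, eval_C] at this
      rw [← this]
      ring
    refine ⟨q + C (ν (LaurentPolynomial.T 0) - q.eval 0), fun j => ?_⟩
    rw [eval_add, eval_C]
    induction j using Int.induction_on with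
    | zero => simp
    | succ i hi =>
      have h1 := step i
      have h2 := hstep i
      rw [hi] at h1
      push_cast at h1 h2 ⊢
      rw [zpow_add_one₀ hlam, h2]
      field_simp
      linear_combination h1
    | pred i hi =>
      have h1 := step (-i - 1)
      have h2 := hstep (-i - 1)
      rw [sub_add_cancel, hi] at h1
      push_cast at h1 h2 ⊢
      rw [sub_add_cancel] at h2
      rw [h2, zpow_sub_one₀ hlam] at h1
      rw [zpow_sub_one₀ hlam]
      field_simp at h1 ⊢
      refine mul_left_cancel₀ hlam ?_
      linear_combination -h1

theorem exists_isAssociated {lam : ℂ} (hlam : lam ≠ 0) (n : ℕ)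
    (μ : poly ((X - C lam) ^ n) →ₗ⁅ℂ⁆ ℂ) : ∃ p : ℂ[X], IsAssociated lam n μ p := by
  obtain ⟨p, hp⟩ := exists_eval_mul_zpow hlam n (onMul μ) fun g => by
    rw [mul_comm, onMul_self_mul (coeff_zero_X_sub_C_pow hlam n)]
  exact ⟨p, fun j => by rw [← Vir.onMul_T, hp]⟩

theorem exists_data_eq {f : ℂ[X]} (h0 : f.coeff 0 ≠ 0) :
    ∃ (k : ℕ) (D : Data k) (c : ℂ), c ≠ 0 ∧ f = C c * D.f := by
  classical
  have hf : f ≠ 0 := by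
    rintro rfl
    exact h0 (coeff_zero 0)
  let e := f.roots.toFinset.equivFin.symm
  have he : ∀ i, f.IsRoot (e i) := fun i => isRoot_of_mem_roots (Multiset.mem_toFinset.1 (e i).2)
  refine ⟨_, { lam := fun i => e i
               lam_ne_zero := fun i h => h0 ?_
               lam_injective := Subtype.val_injective.comp e.injective
               n := fun i => rootMultiplicity (e i : ℂ) f
               n_pos := fun i => (rootMultiplicity_pos hf).2 (he i)
               μ := fun i => 0 }, f.leadingCoeff, leadingCoeff_ne_zero.2 hf, ?_⟩
  · have h1 : f.eval (e i : ℂ) = 0 := he i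
    rwa [show (e i : ℂ) = 0 from h, ← coeff_zero_eq_eval_zero] at h1
  · have h1 := (IsAlgClosed.splits f).eq_prod_roots
    rw [prod_multiset_root_eq_finset_root, ← Finset.prod_coe_sort, ← e.prod_comp] at h1
    exact h1

/-- μ factors through Vir^f modulo f². With y_i congruent to 1 at root i and to 0 at the others,
modulo squares, the i-th component is x ↦ ν(y_i x) for a linear extension ν of μ; it kills brackets,
since these are divisible by the square of the i-th factor. -/
theorem exists_decomposes {f : ℂ[X]} (h0 : f.coeff 0 ≠ 0) (μ : poly f →ₗ⁅ℂ⁆ ℂ) :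
    ∃ (k : ℕ) (D : Data k), D.Decomposes f μ := by
  obtain ⟨k, D, c, hc, hf⟩ := exists_data_eq h0
  have hf2 : toLaurent f * toLaurent f ∣ ∏ i, D.factor i ^ 2 := by
    rw [Finset.prod_pow, ← D.toLaurent_f, sq, ← map_mul toLaurent, ← map_mul toLaurent]
    refine _root_.map_dvd toLaurent ⟨C (c⁻¹ * c⁻¹), ?_⟩
    rw [hf, C_mul]
    have : (C c * C c⁻¹ : ℂ[X]) = 1 := by rw [← C_mul, mul_inv_cancel₀ hc, C_1]
    linear_combination -D.f * D.f * (C c * C c⁻¹ + 1) * this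
  have hdvd : ∀ g, (∀ i, D.factor i ^ 2 ∣ g) → toLaurent f * toLaurent f ∣ g := fun g hg =>
    hf2.trans (Finset.prod_dvd_of_coprime
      (fun _ _ _ _ h => (D.pairwise_isCoprime_factor h).pow) fun i _ => hg i)
  obtain ⟨ν, hν⟩ := exists_form_eq μ
  have hν0 : ∀ x, (∀ i, D.factor i ^ 2 ∣ θ x) → ν x = 0 := fun x hx => by
    have hx' : x ∈ poly f := mem_poly_iff_dvd.2 ((dvd_mul_right _ _).trans (hdvd _ hx))
    rw [hν ⟨x, hx'⟩, apply_eq_zero_of_sq_dvd h0 x hx' (hdvd _ hx)]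
  choose y hy using fun i => exists_isLocalPart D.pairwise_isCoprime_factor 2 i (lift 1)
  let νloc : Fin k → Vir →ₗ[ℂ] ℂ := fun i => ν ∘ₗ lift ∘ₗ LinearMap.mulLeft ℂ (θ (y i)) ∘ₗ θ
  refine ⟨k, { D with μ := fun i => characterOfForm _ (νloc i) fun x hx x' hx' => ?_ }, c, hc, hf,
    fun x => ?_⟩
  · refine hν0 _ fun j => ?_
    change D.factor j ^ 2 ∣ θ (y i) * θ ⁅x, x'⁆
    by_cases hj : j = i
    · subst hj
      have := Data.sq_dvd_lie hx hx'
      rw [← sq] at this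
      exact this.mul_left _
    · exact ((hy i).2 j hj).mul_right _
  · rw [Data.sumμ_apply]
    change μ x = ∑ i, ν (lift (θ (y i) * θ x))
    rw [← map_sum, ← map_sum, ← Finset.sum_mul, ← hν x, ← sub_eq_zero, ← map_sub]
    refine hν0 _ fun j => ?_
    have h1 : D.factor j ^ 2 ∣ 1 - ∑ i, θ (y i) := by
      rw [← Finset.add_sum_erase _ _ (Finset.mem_univ j), ← sub_sub]
      refine dvd_sub ?_ (Finset.dvd_sum fun i hi => (hy i).2 j (Finset.ne_of_mem_erase hi).symm)
      rw [← neg_sub]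
      exact (hy j).1.neg_right
    rw [map_sub, θ_lift]
    refine (h1.mul_right (θ x)).trans (dvd_of_eq ?_)
    ring

/-- f and `D.f` differ by a unit, so the subalgebras are equal but not definitionally; quantifying
over a property P allows substitution. -/
theorem Data.Decomposes.transfer {k : ℕ} {D : Data k} {f : ℂ[X]} {μ : poly f →ₗ⁅ℂ⁆ ℂ}
    (h : D.Decomposes f μ) {P : ∀ a : LieSubalgebra ℂ Vir, (a →ₗ⁅ℂ⁆ ℂ) → Prop} :
    P (poly D.f) D.sumμ ↔ P (poly f) μ := by
  obtain ⟨c, hc, hf, hμ⟩ := h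
  have hle : poly D.f ≤ poly f := by
    refine poly_le_of_dvd ⟨C c⁻¹, ?_⟩
    rw [hf, mul_right_comm, ← C_mul, mul_inv_cancel₀ hc, C_1, one_mul]
  have heq : poly f = poly D.f := le_antisymm (poly_le_of_dvd (Dvd.intro_left (C c) hf.symm)) hle
  have key : ∀ (a b : LieSubalgebra ℂ Vir) (α : a →ₗ⁅ℂ⁆ ℂ) (β : b →ₗ⁅ℂ⁆ ℂ) (_ : a = b),
      (∀ x (hx : x ∈ a) (hx' : x ∈ b), α ⟨x, hx⟩ = β ⟨x, hx'⟩) → (P b β ↔ P a α) := by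
    rintro a _ α β rfl h
    rw [show α = β from LieHom.ext fun x => h x x.2 x.2]
  exact key _ _ _ _ heq fun x hx _ => hμ ⟨x, hx⟩

theorem Data.Decomposes.isIrreducible_iff {k : ℕ} {D : Data k} {f : ℂ[X]} {μ : poly f →ₗ⁅ℂ⁆ ℂ}
    (h : D.Decomposes f μ) :
    LieModule.IsIrreducible ℂ Vir (V D.f D.sumμ) ↔ LieModule.IsIrreducible ℂ Vir (V f μ) :=
  h.transfer (P := fun a α => LieModule.IsIrreducible ℂ Vir (InducedModule a α))

theorem Data.Decomposes.nonempty_tensor_equiv {k : ℕ} {D : Data k} {f : ℂ[X]}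
    {μ : poly f →ₗ⁅ℂ⁆ ℂ} (h : D.Decomposes f μ) : Nonempty (D.tensor ≃ₗ⁅ℂ, Vir⁆ V f μ) :=
  (h.transfer (P := fun a α => Nonempty (D.tensor ≃ₗ⁅ℂ, Vir⁆ InducedModule a α))).1
    D.nonempty_tensor_equiv

end Vir
-- The main theorem
theorem mainTheorem2 :
    (∀ (k : ℕ) (D : Vir.Data k), Nonempty (D.tensor ≃ₗ⁅ℂ, Vir⁆ Vir.V D.f D.sumμ)) ∧
    (∀ (k : ℕ) (D : Vir.Data k) (p : Fin k → Polynomial ℂ),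
      (∀ i, Vir.IsAssociated (D.lam i) (D.n i) (D.μ i) (p i)) →
      (LieModule.IsIrreducible ℂ Vir (Vir.V D.f D.sumμ) ↔
        ∀ i, (D.n i : WithBot ℕ) ≤ (p i).degree + 2)) ∧
    (∀ f : Polynomial ℂ, f.coeff 0 ≠ 0 → ∀ μ : Vir.poly f →ₗ⁅ℂ⁆ ℂ,
      (∃ (k : ℕ) (D : Vir.Data k) (p : Fin k → Polynomial ℂ),
        D.Decomposes f μ ∧ (∀ i, Vir.IsAssociated (D.lam i) (D.n i) (D.μ i) (p i)) ∧
        Nonempty (D.tensor ≃ₗ⁅ℂ, Vir⁆ Vir.V f μ)) ∧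
      (LieModule.IsIrreducible ℂ Vir (Vir.V f μ) ↔ Vir.HasLargeDegree f μ)) := by
  refine ⟨fun k D => D.nonempty_tensor_equiv, fun k D p hp => D.isIrreducible_iff hp,
    fun f h0 μ => ?_⟩
  obtain ⟨k, D, hD⟩ := Vir.exists_decomposes h0 μ
  choose p hp using fun i => Vir.exists_isAssociated (D.lam_ne_zero i) (D.n i) (D.μ i)
  refine ⟨⟨k, D, p, hD, hp, hD.nonempty_tensor_equiv⟩, fun h => ?_, ?_⟩
  · exact ⟨k, D, p, hD, hp, (D.isIrreducible_iff hp).1 (hD.isIrreducible_iff.2 h)⟩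
  -- The criterion applies to any decomposition, so uniqueness of the decomposition is not needed.
  · rintro ⟨k', D', p', hD', hp', hdeg⟩
    exact hD'.isIrreducible_iff.1 ((D'.isIrreducible_iff hp').2 hdeg)
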